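/- **Setting.** Let $d\ge 1$, let $\mathrm P$ be a probability measure on $\mathbb R^d$ and let $X\sim \mathrm P$ with $\mathbb E\|X\|^4<\infty$ ($X$ need not be centred). Let $X_1,\dots,X_n$ be an i.i.d. sample of law $\mathrm P$. Put $G=\mathbb E(XX^\top)$, $s_4^2=\mathbb E(\|X\|^4)^{1/2}$, $\|M\|_F^2=\mathrm{Tr}(M^\top M)$ and $$\kappa=\sup_{\theta:\ \mathbb E\langle\theta,X\rangle^2>0}\frac{\mathbb E\langle\theta,X\rangle^4}{(\mathbb E\langle\theta,X\rangle^2)^2},\qquad c=\frac{15}{8\log(2)(\sqrt2-1)}\exp\Bigl(\frac{1+2\sqrt2}{2}\Bigr).$$ Let $a>0$, $\epsilon>0$, $\sigma\in(0,s_4^2]$, $K=1+\lceil a^{-1}\log(n/(72(2+c)\kappa^{1/2}))\rceil$ and, for $t>0$, $$\zeta(t)=\sqrt{2(\kappa-1)\Bigl(\frac{(2+3c)s_4^2}{4(2+c)\kappa^{1/2}t}+\log(K/\epsilon)\Bigr)}\cosh(a/4)+\sqrt{\frac{2(2+c)\kappa^{1/2}s_4^2}{t}}\cosh(a/2).$$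 Put $$B_*(t)=\frac{n^{-1/2}\zeta(\max\{t,\sigma\})}{1-4n^{-1/2}\zeta(\max\{t,\sigma\})}\ \text{ if } [6+(\kappa-1)^{-1}]\,\zeta(\max\{t,\sigma\})\le\sqrt n,\qquad B_*(t)=+\infty\ \text{ otherwise.}$$ Let $\Theta$ be a finite $\delta$-net of the unit sphere of $\mathbb R^d$ (a finite set of unit vectors such that every unit vector is at distance at most $\delta$ from it), and let $$B(t)=2\max\{t,\sigma\}\,B_*(\min\{t,s_4^2\})+7\delta\|G\|_F+\sigma .$$ Assume that $8\zeta(\sigma)\le\sqrt n$ and $\kappa\ge 3/2$. **The estimator $\widehat G$.** Let $\psi$ be the odd function with $\psi(t)=-\log(1-t+t^2/2)$ for $0\le t\le1$ and $\psi(t)=\log2$ for $t\ge1$. For $l>0$ and $\theta\in\mathbb R^d$ let $$r_l(\theta)=\frac1n\sum_{i=1}^n\psi(\langle\theta,X_i\rangle^2-l),\qquad \widehat\alpha_l(\theta)=\sup\{\alpha\ge0: r_l(\alpha\theta)\le0\},\qquad \widetilde N_l(\theta)=l\,\widehat\alpha_l(\theta)^{-2}$$ (with $\widetilde N_l(\theta)=0$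 if $\widehat\alpha_l(\theta)=\infty$). For $j=0,\dots,K-1$ let $t_j=s_4^2e^{-ja}$ and $$l_j=\sqrt{\frac{2}{n(\kappa-1)}\Bigl(\frac{(2+3c)s_4^2}{4(2+c)\kappa^{1/2}t_j}+\log(K/\epsilon)\Bigr)},\qquad \beta_j=\sqrt{2n\,t_j(2+c)\kappa^{1/2}s_4^2},$$ $$\mu_j=l_j(\kappa-1)+\frac{(2+c)\kappa^{1/2}s_4^2}{\beta_j},\qquad \gamma_j=\frac{l_j(\kappa-1)}2+\frac{(2+c)\kappa^{1/2}s_4^2}{\beta_j}+\frac{(2+3c)s_4^4}{2\beta_j^2l_j}+\frac{\log(K/\epsilon)}{nl_j},\qquad \eta_j=\frac{\beta_j}{2n}.$$ For a unit vector $\theta$ let $M_j(\theta)=\max\{\widetilde N_{l_j}(\theta),\sigma\}$ and $D_j(\theta)=1-\mu_j-\gamma_j-2\eta_j/M_j(\theta)$. The confidence interval $I(\theta)$ is the set of all $N\ge0$ such that, for every $j\in\{0,\dots,K-1\}$ with $\kappa l_j/2\le D_j(\theta)$, $$\bigl|\max\{N,\sigma\}-M_j(\theta)\bigr|\le M_j(\theta)\,\frac{\gamma_j+\eta_j/M_j(\theta)}{D_j(\theta)}.$$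 Let $Q$ be the symmetric $d\times d$ matrix of smallest Frobenius norm such that $\xi^\top Q\xi\in I(\xi)$ for all $\xi\in\Theta$ ($Q=0$ if there is none), and let $\widehat G=Q_+$ be its positive part. **Statement.** Let $\lambda_1\ge\dots\ge\lambda_d$ be the eigenvalues of $G$. Let $\widehat\lambda_1\ge\dots\ge\widehat\lambda_d$ be the eigenvalues of $\widehat G$, let $q_1,\dots,q_d$ be a corresponding orthonormal basis of eigenvectors, and put $$\widetilde G=\sum_{i=1}^d\widetilde\lambda_i\,q_iq_i^\top,\qquad \widetilde\lambda_i=\bigl[\widehat\lambda_i-B(\widehat\lambda_i)\bigr]_+ .$$ Then, with probability at least $1-2\epsilon$ (and whatever the choice of the eigenbasis), $$\|G-\widetilde G\|_F\le\min_{r\in\{1,\dots,d\}}\sqrt{13\,r\,B(\lambda_1)^2+2\sum_{i=r+1}^d\lambda_i^2}\;.$$ -/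

import Mathlib

open MeasureTheory ProbabilityTheory
open scoped ENNReal

noncomputable section

namespace RobustPCA

/-! ## Linear algebra -/

/-- The Frobenius norm, `‖M‖_F² = Tr(Mᵀ M)`. -/
def frob {d : ℕ} (M : Matrix (Fin d) (Fin d) ℝ) : ℝ :=
  √((M.transpose * M).trace)

/-- The quadratic form `θᵀ M θ`. -/
def quad {d : ℕ} (M : Matrix (Fin d) (Fin d) ℝ) (θ : EuclideanSpace ℝ (Fin d)) : ℝ :=
  ∑ i, ∑ j, θ i * M i j * θ j

/-- The symmetric matrix `∑ i, l i • q_i q_iᵀ`. -/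
def ofEigen {d : ℕ} (l : Fin d → ℝ)
    (q : OrthonormalBasis (Fin d) ℝ (EuclideanSpace ℝ (Fin d))) : Matrix (Fin d) (Fin d) ℝ :=
  ∑ i, l i • Matrix.vecMulVec (fun k => q i k) (fun k => q i k)

/-- `l 0 ≥ l 1 ≥ …` are the eigenvalues of `M` and `q` is a corresponding orthonormal basis of
eigenvectors. -/
def IsEigenDecomp {d : ℕ} (M : Matrix (Fin d) (Fin d) ℝ) (l : Fin d → ℝ)
    (q : OrthonormalBasis (Fin d) ℝ (EuclideanSpace ℝ (Fin d))) : Prop :=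
  Antitone l ∧ M = ofEigen l q

/-- The positive part `Q₊` of a symmetric matrix `Q` (so `Q = Q₊ - Q₋`), by functional calculus. -/
def posPart {d : ℕ} (Q : Matrix (Fin d) (Fin d) ℝ) : Matrix (Fin d) (Fin d) ℝ :=
  cfc (fun x : ℝ => max x 0) Q

/-- `Θ` is a finite `δ`-net of the unit sphere. -/
def IsNet {d : ℕ} (δ : ℝ) (Θ : Finset (EuclideanSpace ℝ (Fin d))) : Prop :=
  (∀ ξ ∈ Θ, ‖ξ‖ = 1) ∧ ∀ θ : EuclideanSpace ℝ (Fin d), ‖θ‖ = 1 → ∃ ξ ∈ Θ, ‖θ - ξ‖ ≤ δ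

/-! ## Characteristics of the law `P` -/

/-- The Gram matrix `G = 𝔼(X Xᵀ)`. -/
def gram {d : ℕ} (P : Measure (EuclideanSpace ℝ (Fin d))) : Matrix (Fin d) (Fin d) ℝ :=
  Matrix.of fun i j => ∫ x, x i * x j ∂P

/-- `κ`, the supremum of `𝔼⟨θ,X⟩⁴ / (𝔼⟨θ,X⟩²)²` over the `θ` with `𝔼⟨θ,X⟩² > 0`. (If `𝔼‖X‖⁴ < ∞`
the supremum is that of a bounded set.) -/
def kappa {d : ℕ} (P : Measure (EuclideanSpace ℝ (Fin d))) : ℝ :=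
  sSup {k | ∃ θ : EuclideanSpace ℝ (Fin d), 0 < ∫ x, (inner ℝ θ x) ^ 2 ∂P ∧
    k = (∫ x, (inner ℝ θ x) ^ 4 ∂P) / (∫ x, (inner ℝ θ x) ^ 2 ∂P) ^ 2}

/-- `s₄² = (𝔼‖X‖⁴)^{1/2}`. -/
def s4sq {d : ℕ} (P : Measure (EuclideanSpace ℝ (Fin d))) : ℝ :=
  √(∫ x, ‖x‖ ^ 4 ∂P)

/-! ## The functions `ζ`, `B_*` and `B`

Here `n` is the sample size, and the real numbers `κ` and `S` stand for `κ` and `s₄²`. -/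

/-- The numerical constant `c`. -/
def cc : ℝ :=
  15 / (8 * Real.log 2 * (√2 - 1)) * Real.exp ((1 + 2 * √2) / 2)

/-- The integer `K`. (The logarithm is positive in the range of parameters of interest.) -/
def gridSize (n : ℕ) (κ a : ℝ) : ℕ :=
  1 + ⌈a⁻¹ * Real.log (n / (72 * (2 + cc) * √κ))⌉₊

def zeta (n : ℕ) (κ S ε a t : ℝ) : ℝ :=
  √(2 * (κ - 1) * ((2 + 3 * cc) * S / (4 * (2 + cc) * √κ * t)
      + Real.log (gridSize n κ a / ε))) * Real.cosh (a / 4)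
    + √(2 * (2 + cc) * √κ * S / t) * Real.cosh (a / 2)

/-- `B_*`, with values in `[0, ∞]`. -/
def bStar (n : ℕ) (κ S ε a σ t : ℝ) : ℝ≥0∞ :=
  if (6 + (κ - 1)⁻¹) * zeta n κ S ε a (max t σ) ≤ √n then
    ENNReal.ofReal ((zeta n κ S ε a (max t σ) / √n) /
      (1 - 4 * (zeta n κ S ε a (max t σ) / √n)))
  else ⊤

/-- `B(t) = 2 max{t,σ} B_*(min{t,s₄²}) + 7 δ ‖G‖_F + σ`, where `g` stands for `‖G‖_F`. -/
def bound (n : ℕ) (κ S ε a σ δ g t : ℝ) : ℝ≥0∞ :=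
  2 * ENNReal.ofReal (max t σ) * bStar n κ S ε a σ (min t S) + ENNReal.ofReal (7 * δ * g + σ)

/-! ## The robust estimator of the Gram matrix -/

/-- The influence function: `ψ(t) = -log(1 - t + t²/2)` on `[0,1]`, `ψ(t) = log 2` for `t ≥ 1`,
and `ψ` is odd. -/
def psi (t : ℝ) : ℝ :=
  if 1 ≤ t then Real.log 2
  else if 0 ≤ t then -Real.log (1 - t + t ^ 2 / 2)
  else if -1 ≤ t then Real.log (1 + t + t ^ 2 / 2)
  else -Real.log 2

/-- `r_l(θ) = n⁻¹ ∑ i, ψ(⟨θ, x_i⟩² - l)`, for the sample `x`. -/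
def rEmp {d n : ℕ} (x : Fin n → EuclideanSpace ℝ (Fin d)) (l : ℝ)
    (θ : EuclideanSpace ℝ (Fin d)) : ℝ :=
  (n : ℝ)⁻¹ * ∑ i, psi ((inner ℝ θ (x i)) ^ 2 - l)

/-- The preliminary estimate of `𝔼⟨θ,X⟩²`: it equals `l / α̂²`, where
`α̂ = sup {α ≥ 0 | r_l(α θ) ≤ 0} ∈ (0, ∞]`. If `α̂ = ∞` it equals `0`, also for the real `sSup`,
which is `0` on unbounded sets. -/
def nTilde {d n : ℕ} (x : Fin n → EuclideanSpace ℝ (Fin d)) (l : ℝ)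
    (θ : EuclideanSpace ℝ (Fin d)) : ℝ :=
  l / (sSup {α : ℝ | 0 ≤ α ∧ rEmp x l (α • θ) ≤ 0}) ^ 2

/-- The grid points `t_j = s₄² e^{-ja}`, `0 ≤ j < K`. -/
def gridT (S a : ℝ) (j : ℕ) : ℝ :=
  S * Real.exp (-(j * a))

/-- The parameter `l` attached to `t`. -/
def gridL (n : ℕ) (κ S ε a t : ℝ) : ℝ :=
  √(2 / (n * (κ - 1)) * ((2 + 3 * cc) * S / (4 * (2 + cc) * √κ * t)
    + Real.log (gridSize n κ a / ε)))

/-- The parameter `β` (inverse variance of the Gaussian perturbation) attached to `t`. -/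
def gridBeta (n : ℕ) (κ S t : ℝ) : ℝ :=
  √(2 * n * t * (2 + cc) * √κ * S)

def muCoef (κ S l β : ℝ) : ℝ :=
  l * (κ - 1) + (2 + cc) * √κ * S / β

def gammaCoef (n : ℕ) (κ S ε a l β : ℝ) : ℝ :=
  l * (κ - 1) / 2 + (2 + cc) * √κ * S / β + (2 + 3 * cc) * S ^ 2 / (2 * β ^ 2 * l)
    + Real.log (gridSize n κ a / ε) / (n * l)

/-- `1 - μ - γ - 2 (β/2n) / M`, the denominator of the relative half-width of the interval. -/
def widthDen (n : ℕ) (κ S ε a l β M : ℝ) : ℝ :=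
  1 - muCoef κ S l β - gammaCoef n κ S ε a l β - 2 * (β / (2 * n)) / M

/-- The relative half-width of the confidence interval at level `M`. -/
def relWidth (n : ℕ) (κ S ε a l β M : ℝ) : ℝ :=
  (gammaCoef n κ S ε a l β + β / (2 * n) / M) / widthDen n κ S ε a l β M

/-- `N` belongs to the confidence interval for `𝔼⟨θ,X⟩²` (`‖θ‖ = 1`) built on the sample `x`: it is
nonnegative and compatible at the threshold `σ`, up to the relative width, with the preliminary
estimates for all parameters `(l, β)` of the grid for which the width is controlled. -/
def InInterval {d n : ℕ} (κ S ε a σ : ℝ) (x : Fin n → EuclideanSpace ℝ (Fin d))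
    (θ : EuclideanSpace ℝ (Fin d)) (N : ℝ) : Prop :=
  0 ≤ N ∧ ∀ j < gridSize n κ a,
    let l := gridL n κ S ε a (gridT S a j)
    let β := gridBeta n κ S (gridT S a j)
    let M := max (nTilde x l θ) σ
    κ * l / 2 ≤ widthDen n κ S ε a l β M →
      |max N σ - M| ≤ M * relWidth n κ S ε a l β M

/-- The symmetric matrices that satisfy the constraints in all the directions of the net `Θ`. -/
def Feasible {d n : ℕ} (κ S ε a σ : ℝ) (Θ : Finset (EuclideanSpace ℝ (Fin d)))
    (x : Fin n → EuclideanSpace ℝ (Fin d)) (Q : Matrix (Fin d) (Fin d) ℝ) : Prop :=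
  Q.IsSymm ∧ ∀ ξ ∈ Θ, InInterval κ S ε a σ x ξ (quad Q ξ)

/-- `Q` solves the convex program: minimize `‖Q‖_F` under the constraints. -/
def IsSolution {d n : ℕ} (κ S ε a σ : ℝ) (Θ : Finset (EuclideanSpace ℝ (Fin d)))
    (x : Fin n → EuclideanSpace ℝ (Fin d)) (Q : Matrix (Fin d) (Fin d) ℝ) : Prop :=
  Feasible κ S ε a σ Θ x Q ∧ ∀ Q', Feasible κ S ε a σ Θ x Q' → frob Q ≤ frob Q'

open Classical in
/-- The matrix `Q`: the solution of the convex program (`0` if the constraints are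
incompatible). -/
def qMat {d n : ℕ} (κ S ε a σ : ℝ) (Θ : Finset (EuclideanSpace ℝ (Fin d)))
    (x : Fin n → EuclideanSpace ℝ (Fin d)) : Matrix (Fin d) (Fin d) ℝ :=
  if h : ∃ Q, IsSolution κ S ε a σ Θ x Q then h.choose else 0

/-- The robust estimator `Ĝ = Q₊`. -/
def gHat {d n : ℕ} (κ S ε a σ : ℝ) (Θ : Finset (EuclideanSpace ℝ (Fin d)))
    (x : Fin n → EuclideanSpace ℝ (Fin d)) : Matrix (Fin d) (Fin d) ℝ :=
  posPart (qMat κ S ε a σ Θ x)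

/-- `[l - b]₊` for `l ≥ 0` and `b ∈ [0, ∞]` (subtraction in `[0, ∞]` is truncated). -/
def shrink (l : ℝ) (b : ℝ≥0∞) : ℝ :=
  (ENNReal.ofReal l - b).toReal

end RobustPCA

end

/-!
The estimator is controlled through the quadratic form of the Gram matrix `G`, uniformly over all
directions, and this control is then transferred to eigenvalues and to the Frobenius norm.

*Concentration.* For a fixed pair `(l, β)`, the empirical influence `r_l(θ)` is compared with
`𝔼⟨θ,X⟩² - l` simultaneously for all `θ` by a PAC-Bayes argument: the direction `θ` is replaced by a
Gaussian vector with mean `θ` and covariance `β⁻¹ I`, whose entropy relative to the Gaussian vector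
centred at the origin is `β ‖θ‖² / 2`, independently of the dimension. The influence function is
dominated by the Gaussian average of a bounded function `pert` (`psi_le_integral_pert`), obtained
from `min (log (1 + y + y²/2)) (log (2e))`, which stays above a concave parabola touching `ψ`
(`exists_parabola_le_cutLog`), plus a correction for the variance of the perturbation. The
exponential of `pert` is at most a polynomial of degree four (`exp_pert_le`), which is where the
constant `c` comes from, and its mean is bounded by means of `κ` and `s₄²`. With the entropy duality
`integral_gaussAt_le_log` and Markov's inequality this gives the two-sided bounds
`InfluenceBounds`, valid on the whole grid with probability `1 - 2 ε`
(`exists_event_influenceBounds`). Everything below is deterministic on that event.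

*Confidence intervals.* The bounds, read along the ray `α ↦ α θ` at the root `α̂`, are quadratic
inequalities for the ratio of `𝔼⟨θ,X⟩²` to the preliminary estimate; they show that
`𝔼⟨θ,X⟩²` lies in the interval (`inInterval_secMom`). The grid point just above
`max (𝔼⟨θ,X⟩²) σ` yields parameters that are optimal up to the factors `cosh (a/4)` and
`cosh (a/2)`, so that the interval has relative half-width at most `B_*`
(`abs_max_sub_le_of_inInterval`).

*From the net to the sphere.* Consequently `G` satisfies the constraints of the convex program; the
solution `Q` exists and `‖Q‖_F ≤ ‖G‖_F`. Passing from the net to an arbitrary direction and from `Q`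
to `Q₊` gives `|θᵀĜθ - θᵀGθ| ≤ B(θᵀGθ)` on the unit sphere (`abs_quad_gHat_sub_le`).

*Eigenvalues.* The function `B` is nondecreasing and grows slowly, so that the min-max principle
gives `λ̃_i ≤ λ_i` for the shrunk eigenvalues, while `λ̂_i - λ̃_i ≤ 3/2 B(λ₁)`. Hence
`D = G - G̃` has operator norm at most `5/2 B(λ₁)`. Its Frobenius norm is the sum of squares of
its entries `(λ_i - λ̃_j) ⟨p_i, q_j⟩` in the two eigenbases: the first `r` rows and the first `r`
columns contribute at most `r (5/2 B(λ₁))²` each, and the remaining entries at most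
`2 ∑_{i > r} λ_i²` since `0 ≤ λ̃_j ≤ λ_j` (`frob_sub_shrink_sq_le`).
-/

open MeasureTheory ProbabilityTheory
open scoped ENNReal

namespace RobustPCA

noncomputable section

/-! ### Gaussian perturbations of a direction -/

section Gaussian

variable {d : ℕ}

/-- Gaussian integral with a linear term, on Euclidean space. -/
lemma integral_gauss_linear {b : ℝ} (hb : 0 < b) (w : EuclideanSpace ℝ (Fin d)) :
    Integrable (fun v : EuclideanSpace ℝ (Fin d) =>
        Real.exp (-(b / 2) * ‖v‖ ^ 2 + inner ℝ w v)) ∧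
      ∫ v : EuclideanSpace ℝ (Fin d), Real.exp (-(b / 2) * ‖v‖ ^ 2 + inner ℝ w v) =
        (∫ v : EuclideanSpace ℝ (Fin d), Real.exp (-(b / 2) * ‖v‖ ^ 2)) *
          Real.exp (‖w‖ ^ 2 / (2 * b)) := by
  have h0 : Integrable (fun v : EuclideanSpace ℝ (Fin d) => Real.exp (-(b / 2) * ‖v‖ ^ 2)) := by
    have := (GaussianFourier.integrable_cexp_neg_mul_sq_norm_add (V := EuclideanSpace ℝ (Fin d))
      (b := ((b / 2 : ℝ) : ℂ)) (by simpa using hb) 0 0).norm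
    refine this.congr (Filter.Eventually.of_forall fun v => ?_)
    simp only [Complex.norm_exp]
    congr 1
    have : (-((b / 2 : ℝ) : ℂ) * (‖v‖ : ℂ) ^ 2 + 0 * ((inner ℝ 0 v : ℝ) : ℂ)) =
      ((-(b / 2) * ‖v‖ ^ 2 : ℝ) : ℂ) := by push_cast; ring
    rw [this, Complex.ofReal_re]
  have key : (fun v : EuclideanSpace ℝ (Fin d) =>
        Real.exp (-(b / 2) * ‖v‖ ^ 2 + inner ℝ w v)) =
      fun v => Real.exp (-(b / 2) * ‖v - b⁻¹ • w‖ ^ 2) * Real.exp (‖w‖ ^ 2 / (2 * b)) := by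
    funext v
    rw [← Real.exp_add]
    congr 1
    rw [norm_sub_sq_real, inner_smul_right, norm_smul, real_inner_comm w v, mul_pow,
      Real.norm_eq_abs, sq_abs]
    field_simp
    ring
  rw [key]
  refine ⟨(h0.comp_sub_right (b⁻¹ • w)).mul_const _, ?_⟩
  rw [integral_mul_const,
    integral_sub_right_eq_self (fun v : EuclideanSpace ℝ (Fin d) => Real.exp (-(b / 2) * ‖v‖ ^ 2))]

/-- The density of the isotropic Gaussian law with mean `θ` and covariance `b⁻¹ • 1`; its
normalization is written as an integral. -/
def gaussDens (b : ℝ) (θ v : EuclideanSpace ℝ (Fin d)) : ℝ :=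
  (∫ u : EuclideanSpace ℝ (Fin d), Real.exp (-(b / 2) * ‖u‖ ^ 2))⁻¹ *
    Real.exp (-(b / 2) * ‖v - θ‖ ^ 2)

/-- The isotropic Gaussian law with mean `θ` and covariance `b⁻¹ • 1`. -/
def gaussAt (b : ℝ) (θ : EuclideanSpace ℝ (Fin d)) : Measure (EuclideanSpace ℝ (Fin d)) :=
  volume.withDensity fun v => ENNReal.ofReal (gaussDens b θ v)

lemma integrable_gauss {b : ℝ} (hb : 0 < b) :
    Integrable (fun v : EuclideanSpace ℝ (Fin d) => Real.exp (-(b / 2) * ‖v‖ ^ 2)) := by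
  simpa using (integral_gauss_linear hb (0 : EuclideanSpace ℝ (Fin d))).1

lemma gauss_norm_pos {b : ℝ} (hb : 0 < b) :
    0 < ∫ u : EuclideanSpace ℝ (Fin d), Real.exp (-(b / 2) * ‖u‖ ^ 2) :=
  integral_exp_pos (integrable_gauss hb)

lemma continuous_gaussDens (b : ℝ) (θ : EuclideanSpace ℝ (Fin d)) :
    Continuous (gaussDens b θ) := by
  unfold gaussDens
  fun_prop

lemma gaussDens_pos {b : ℝ} (hb : 0 < b) (θ v : EuclideanSpace ℝ (Fin d)) :
    0 < gaussDens b θ v :=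
  mul_pos (inv_pos.2 (gauss_norm_pos hb)) (Real.exp_pos _)

lemma isProbabilityMeasure_gaussAt {b : ℝ} (hb : 0 < b) (θ : EuclideanSpace ℝ (Fin d)) :
    IsProbabilityMeasure (gaussAt b θ) := by
  constructor
  rw [gaussAt, withDensity_apply _ MeasurableSet.univ, Measure.restrict_univ,
    ← ofReal_integral_eq_lintegral_ofReal]
  · unfold gaussDens
    rw [integral_const_mul, integral_sub_right_eq_self
      (fun v : EuclideanSpace ℝ (Fin d) => Real.exp (-(b / 2) * ‖v‖ ^ 2)),
      inv_mul_cancel₀ (gauss_norm_pos hb).ne', ENNReal.ofReal_one]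
  · exact ((integrable_gauss hb).comp_sub_right θ).const_mul _
  · exact Filter.Eventually.of_forall fun v => (gaussDens_pos hb θ v).le

lemma integral_gaussAt {b : ℝ} (hb : 0 < b) (θ : EuclideanSpace ℝ (Fin d))
    (F : EuclideanSpace ℝ (Fin d) → ℝ) :
    ∫ v, F v ∂(gaussAt b θ) = ∫ v, gaussDens b θ v * F v := by
  rw [gaussAt, integral_withDensity_eq_integral_toReal_smul
    (continuous_gaussDens b θ).measurable.ennreal_ofReal
    (Filter.Eventually.of_forall fun _ => ENNReal.ofReal_lt_top)]
  refine integral_congr_ae (Filter.Eventually.of_forall fun v => ?_)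
  simp [ENNReal.toReal_ofReal (gaussDens_pos hb θ v).le]

lemma integrable_gaussAt_iff {b : ℝ} (hb : 0 < b) (θ : EuclideanSpace ℝ (Fin d))
    (F : EuclideanSpace ℝ (Fin d) → ℝ) :
    Integrable F (gaussAt b θ) ↔ Integrable fun v => gaussDens b θ v * F v := by
  rw [gaussAt, integrable_withDensity_iff_integrable_smul'
    (continuous_gaussDens b θ).measurable.ennreal_ofReal
    (Filter.Eventually.of_forall fun _ => ENNReal.ofReal_lt_top)]
  refine integrable_congr (Filter.Eventually.of_forall fun v => ?_)
  simp [ENNReal.toReal_ofReal (gaussDens_pos hb θ v).le]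

/-- The Gaussian law is symmetric about its mean. -/
lemma integral_gaussAt_reflect {b : ℝ} (hb : 0 < b) (θ : EuclideanSpace ℝ (Fin d))
    (F : EuclideanSpace ℝ (Fin d) → ℝ) :
    ∫ v, F ((2 : ℝ) • θ - v) ∂(gaussAt b θ) = ∫ v, F v ∂(gaussAt b θ) := by
  rw [integral_gaussAt hb, integral_gaussAt hb,
    ← integral_sub_left_eq_self (fun v => gaussDens b θ v * F v) volume ((2 : ℝ) • θ)]
  refine integral_congr_ae (Filter.Eventually.of_forall fun v => ?_)
  have : (2 : ℝ) • θ - v - θ = -(v - θ) := by rw [two_smul]; abel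
  simp only [gaussDens, this, norm_neg]

lemma integral_gaussAt_translate {b : ℝ} (hb : 0 < b) (θ : EuclideanSpace ℝ (Fin d))
    (F : EuclideanSpace ℝ (Fin d) → ℝ) :
    ∫ v, F v ∂(gaussAt b θ) = ∫ v, F (v + θ) ∂(gaussAt b 0) := by
  rw [integral_gaussAt hb, integral_gaussAt hb,
    ← integral_add_right_eq_self (fun v => gaussDens b θ v * F v) θ]
  simp [gaussDens]

lemma integrable_gaussAt_translate {b : ℝ} (hb : 0 < b) (θ : EuclideanSpace ℝ (Fin d))
    (F : EuclideanSpace ℝ (Fin d) → ℝ) (h : Integrable (fun v => F (v + θ)) (gaussAt b 0)) :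
    Integrable F (gaussAt b θ) := by
  rw [integrable_gaussAt_iff hb] at h ⊢
  refine (h.comp_sub_right θ).congr (Filter.Eventually.of_forall fun v => ?_)
  simp [gaussDens]

lemma mgf_gaussAt_zero {b : ℝ} (hb : 0 < b) (x : EuclideanSpace ℝ (Fin d)) (t : ℝ) :
    Integrable (fun v => Real.exp (t * inner ℝ v x)) (gaussAt b 0) ∧
    mgf (fun v => inner ℝ v x) (gaussAt b 0) t = Real.exp (‖x‖ ^ 2 / b * t ^ 2 / 2) := by
  have h := integral_gauss_linear hb (t • x)
  have key : ∀ v : EuclideanSpace ℝ (Fin d), gaussDens b 0 v * Real.exp (t * inner ℝ v x) =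
      (∫ u : EuclideanSpace ℝ (Fin d), Real.exp (-(b / 2) * ‖u‖ ^ 2))⁻¹ *
        Real.exp (-(b / 2) * ‖v‖ ^ 2 + inner ℝ (t • x) v) := by
    intro v
    rw [gaussDens, mul_assoc, ← Real.exp_add, sub_zero, inner_smul_left, real_inner_comm]
    simp
  constructor
  · rw [integrable_gaussAt_iff hb]
    simp_rw [key]
    exact h.1.const_mul _
  · rw [mgf, integral_gaussAt hb]
    simp_rw [key]
    rw [integral_const_mul, h.2, ← mul_assoc, inv_mul_cancel₀ (gauss_norm_pos hb).ne', one_mul,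
      norm_smul, mul_pow, Real.norm_eq_abs, sq_abs]
    congr 1
    field_simp

lemma zero_mem_interior_gaussAt {b : ℝ} (hb : 0 < b) (x : EuclideanSpace ℝ (Fin d)) :
    (0 : ℝ) ∈ interior (integrableExpSet (fun v => inner ℝ v x) (gaussAt b 0)) := by
  have : integrableExpSet (fun v => inner ℝ v x) (gaussAt b 0) = Set.univ :=
    Set.eq_univ_of_forall fun t => (mgf_gaussAt_zero hb x t).1
  simp [this]

lemma integrable_inner_pow_gaussAt_zero {b : ℝ} (hb : 0 < b) (x : EuclideanSpace ℝ (Fin d))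
    (k : ℕ) : Integrable (fun v => (inner ℝ v x) ^ k) (gaussAt b 0) :=
  integrable_pow_of_mem_interior_integrableExpSet (zero_mem_interior_gaussAt hb x) k

/-- Moments of a centred Gaussian linear form, read off its moment generating function. -/
lemma moments_gaussAt_zero {b : ℝ} (hb : 0 < b) (x : EuclideanSpace ℝ (Fin d)) :
    ∫ v, (inner ℝ v x) ∂(gaussAt b 0) = 0 ∧
    ∫ v, (inner ℝ v x) ^ 2 ∂(gaussAt b 0) = ‖x‖ ^ 2 / b ∧
    ∫ v, (inner ℝ v x) ^ 3 ∂(gaussAt b 0) = 0 ∧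
    ∫ v, (inner ℝ v x) ^ 4 ∂(gaussAt b 0) = 3 * (‖x‖ ^ 2 / b) ^ 2 := by
  set s := ‖x‖ ^ 2 / b with hs
  have hmgf : mgf (fun v => inner ℝ v x) (gaussAt b 0) = fun t => Real.exp (s * t ^ 2 / 2) := by
    funext t
    exact (mgf_gaussAt_zero hb x t).2
  have hmom := fun k => iteratedDeriv_mgf_zero (zero_mem_interior_gaussAt hb x) k
  rw [hmgf] at hmom
  have hd0 : ∀ t, HasDerivAt (fun t => Real.exp (s * t ^ 2 / 2)) (s * t * Real.exp (s * t ^ 2 / 2))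
      t := by
    intro t
    have := (((hasDerivAt_pow 2 t).const_mul s).div_const 2).exp
    convert this using 1
    push_cast
    ring
  have d1 : deriv (fun t => Real.exp (s * t ^ 2 / 2)) =
      fun t => s * t * Real.exp (s * t ^ 2 / 2) := funext fun t => (hd0 t).deriv
  have d2 : deriv (fun t => s * t * Real.exp (s * t ^ 2 / 2)) =
      fun t => (s + s ^ 2 * t ^ 2) * Real.exp (s * t ^ 2 / 2) := by
    funext t
    have := (((hasDerivAt_id t).const_mul s).mul (hd0 t)).deriv
    simp only [id] at this
    rw [show (fun t => s * t * Real.exp (s * t ^ 2 / 2)) =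
      (fun t => s * t) * fun t => Real.exp (s * t ^ 2 / 2) from rfl, this]
    ring
  have d3 : deriv (fun t => (s + s ^ 2 * t ^ 2) * Real.exp (s * t ^ 2 / 2)) =
      fun t => (3 * s ^ 2 * t + s ^ 3 * t ^ 3) * Real.exp (s * t ^ 2 / 2) := by
    funext t
    have := ((((hasDerivAt_pow 2 t).const_mul (s ^ 2)).const_add s).mul (hd0 t)).deriv
    rw [show (fun t => (s + s ^ 2 * t ^ 2) * Real.exp (s * t ^ 2 / 2)) =
      (fun t => s + s ^ 2 * t ^ 2) * fun t => Real.exp (s * t ^ 2 / 2) from rfl, this]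
    push_cast
    ring
  have d4 : deriv (fun t => (3 * s ^ 2 * t + s ^ 3 * t ^ 3) * Real.exp (s * t ^ 2 / 2)) 0 =
      3 * s ^ 2 := by
    have := ((((hasDerivAt_id (0 : ℝ)).const_mul (3 * s ^ 2)).add
      ((hasDerivAt_pow 3 (0 : ℝ)).const_mul (s ^ 3))).mul (hd0 0)).deriv
    rw [show (fun t => (3 * s ^ 2 * t + s ^ 3 * t ^ 3) * Real.exp (s * t ^ 2 / 2)) =
      ((fun t => 3 * s ^ 2 * id t) + fun t => s ^ 3 * t ^ 3) *
        fun t => Real.exp (s * t ^ 2 / 2) from rfl, this]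
    simp
  have h1 := hmom 1
  have h2 := hmom 2
  have h3 := hmom 3
  have h4 := hmom 4
  simp only [iteratedDeriv_succ, iteratedDeriv_zero, d1, d2, d3] at h1 h2 h3 h4
  rw [d4] at h4
  simp only [Pi.pow_apply, pow_one] at h1 h2 h3 h4
  refine ⟨?_, ?_, ?_, ?_⟩
  · rw [← h1]; simp
  · rw [← h2]; simp
  · rw [← h3]; simp
  · rw [← h4]

lemma integrable_inner_pow_gaussAt {b : ℝ} (hb : 0 < b) (θ x : EuclideanSpace ℝ (Fin d))
    (k : ℕ) : Integrable (fun v => (inner ℝ v x) ^ k) (gaussAt b θ) := by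
  refine integrable_gaussAt_translate hb θ _ ?_
  simp_rw [inner_add_left, add_pow]
  refine integrable_finsetSum _ fun i _ => ?_
  exact ((integrable_inner_pow_gaussAt_zero hb x i).mul_const _).mul_const _

lemma integral_inner_sq_gaussAt {b : ℝ} (hb : 0 < b) (θ x : EuclideanSpace ℝ (Fin d)) :
    ∫ v, (inner ℝ v x) ^ 2 ∂(gaussAt b θ) = (inner ℝ θ x) ^ 2 + ‖x‖ ^ 2 / b := by
  have := isProbabilityMeasure_gaussAt hb (0 : EuclideanSpace ℝ (Fin d))
  rw [integral_gaussAt_translate hb]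
  have i1 : Integrable (fun v => (inner ℝ v x)) (gaussAt b 0) := by
    simpa using integrable_inner_pow_gaussAt_zero hb x 1
  have i2 := integrable_inner_pow_gaussAt_zero hb x 2
  obtain ⟨m1, m2, -, -⟩ := moments_gaussAt_zero hb x
  have : (fun v : EuclideanSpace ℝ (Fin d) => (inner ℝ (v + θ) x) ^ 2) =
      fun v => (inner ℝ v x) ^ 2 + (2 * inner ℝ θ x) * (inner ℝ v x) + (inner ℝ θ x) ^ 2 := by
    funext v
    rw [inner_add_left]
    ring
  rw [this, integral_add (i2.fun_add (i1.const_mul _)) (integrable_const _),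
    integral_add i2 (i1.const_mul _), integral_const_mul, m1, m2]
  simp
  ring

lemma integral_inner_pow_four_gaussAt {b : ℝ} (hb : 0 < b) (θ x : EuclideanSpace ℝ (Fin d)) :
    ∫ v, (inner ℝ v x) ^ 4 ∂(gaussAt b θ) = (inner ℝ θ x) ^ 4 +
      6 * (inner ℝ θ x) ^ 2 * (‖x‖ ^ 2 / b) + 3 * (‖x‖ ^ 2 / b) ^ 2 := by
  have := isProbabilityMeasure_gaussAt hb (0 : EuclideanSpace ℝ (Fin d))
  rw [integral_gaussAt_translate hb]
  have i1 : Integrable (fun v => (inner ℝ v x)) (gaussAt b 0) := by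
    simpa using integrable_inner_pow_gaussAt_zero hb x 1
  have i2 := integrable_inner_pow_gaussAt_zero hb x 2
  have i3 := integrable_inner_pow_gaussAt_zero hb x 3
  have i4 := integrable_inner_pow_gaussAt_zero hb x 4
  obtain ⟨m1, m2, m3, m4⟩ := moments_gaussAt_zero hb x
  have : (fun v : EuclideanSpace ℝ (Fin d) => (inner ℝ (v + θ) x) ^ 4) =
      fun v => (inner ℝ v x) ^ 4 + (4 * inner ℝ θ x) * (inner ℝ v x) ^ 3 +
        (6 * (inner ℝ θ x) ^ 2) * (inner ℝ v x) ^ 2 + (4 * (inner ℝ θ x) ^ 3) * (inner ℝ v x) +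
        (inner ℝ θ x) ^ 4 := by
    funext v
    rw [inner_add_left]
    ring
  rw [this, integral_add
        (((i4.fun_add (i3.const_mul _)).fun_add (i2.const_mul _)).fun_add (i1.const_mul _))
      (integrable_const _), integral_add ((i4.fun_add (i3.const_mul _)).fun_add (i2.const_mul _))
      (i1.const_mul _), integral_add (i4.fun_add (i3.const_mul _)) (i2.const_mul _),
      integral_add i4 (i3.const_mul _), integral_const_mul, integral_const_mul,
      integral_const_mul, m1, m2, m3, m4]
  simp
  ring

lemma integrable_norm_pow_four_gaussAt {b : ℝ} (hb : 0 < b) (θ : EuclideanSpace ℝ (Fin d)) :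
    Integrable (fun v => ‖v‖ ^ 4) (gaussAt b θ) := by
  have := isProbabilityMeasure_gaussAt hb θ
  have hdom : Integrable (fun v : EuclideanSpace ℝ (Fin d) =>
      (d : ℝ) * ∑ i, (inner ℝ v (EuclideanSpace.single i (1 : ℝ))) ^ 4) (gaussAt b θ) :=
    (integrable_finsetSum _ fun i _ => integrable_inner_pow_gaussAt hb θ _ 4).const_mul _
  refine hdom.mono' (by fun_prop) (Filter.Eventually.of_forall fun v => ?_)
  have h1 : ‖v‖ ^ 4 = (∑ i, (v i) ^ 2) ^ 2 := by
    rw [← EuclideanSpace.real_norm_sq_eq]; ring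
  have h2 : (∑ i, (v i) ^ 2) ^ 2 ≤ (d : ℝ) * ∑ i, ((v i) ^ 2) ^ 2 := by
    simpa using sq_sum_le_card_mul_sum_sq (s := Finset.univ) (f := fun i => (v i) ^ 2)
  rw [Real.norm_of_nonneg (by positivity), h1]
  refine h2.trans (le_of_eq ?_)
  congr 1
  refine Finset.sum_congr rfl fun i _ => ?_
  simp [EuclideanSpace.inner_single_right]
  ring

/-- The duality between entropy and exponential moments, for the Gaussian law with mean `θ`
relative to the centred one, whose relative entropy is `b ‖θ‖² / 2`. -/
lemma integral_gaussAt_le_log {b : ℝ} (hb : 0 < b) (θ : EuclideanSpace ℝ (Fin d))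
    (h : EuclideanSpace ℝ (Fin d) → ℝ) (hm : Measurable h) (C : ℝ) (hC : ∀ v, |h v| ≤ C) :
    ∫ v, h v ∂(gaussAt b θ) ≤
      Real.log (∫ v, Real.exp (h v) ∂(gaussAt b 0)) + b * ‖θ‖ ^ 2 / 2 := by
  have := isProbabilityMeasure_gaussAt hb θ
  have := isProbabilityMeasure_gaussAt hb (0 : EuclideanSpace ℝ (Fin d))
  have hcmp : ∀ v, gaussDens b 0 v * Real.exp (h v) =
      gaussDens b θ v * Real.exp (h v - b * inner ℝ v θ + b * ‖θ‖ ^ 2 / 2) := by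
    intro v
    simp only [gaussDens, mul_assoc, ← Real.exp_add]
    congr 2
    rw [sub_zero, norm_sub_sq_real]
    ring
  have iexp0 : Integrable (fun v => Real.exp (h v)) (gaussAt b 0) := by
    refine Integrable.of_bound (by fun_prop) (Real.exp C) (Filter.Eventually.of_forall fun v => ?_)
    rw [Real.norm_of_nonneg (Real.exp_pos _).le]
    exact Real.exp_le_exp.2 ((le_abs_self _).trans (hC v))
  have ih : Integrable h (gaussAt b θ) :=
    Integrable.of_bound (by fun_prop) C (Filter.Eventually.of_forall fun v => hC v)
  have iin : Integrable (fun v => inner ℝ v θ) (gaussAt b θ) := by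
    simpa using integrable_inner_pow_gaussAt hb θ θ 1
  have hin : ∫ v, inner ℝ v θ ∂(gaussAt b θ) = ‖θ‖ ^ 2 := by
    have i1 : Integrable (fun v => (inner ℝ v θ)) (gaussAt b 0) := by
      simpa using integrable_inner_pow_gaussAt_zero hb θ 1
    rw [integral_gaussAt_translate hb]
    simp_rw [inner_add_left]
    rw [integral_add i1 (integrable_const _), (moments_gaussAt_zero hb θ).1]
    simp
  set g : EuclideanSpace ℝ (Fin d) → ℝ := fun v => h v - b * inner ℝ v θ + b * ‖θ‖ ^ 2 / 2 with hg
  have isub : Integrable (fun v => h v - b * inner ℝ v θ) (gaussAt b θ) :=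
    ih.sub (iin.const_mul b)
  have ig : Integrable g (gaussAt b θ) :=
    isub.fun_add (integrable_const _)
  have iexpg : Integrable (fun v => Real.exp (g v)) (gaussAt b θ) := by
    rw [integrable_gaussAt_iff hb] at iexp0 ⊢
    exact iexp0.congr (Filter.Eventually.of_forall hcmp)
  have heq : ∫ v, Real.exp (h v) ∂(gaussAt b 0) = ∫ v, Real.exp (g v) ∂(gaussAt b θ) := by
    rw [integral_gaussAt hb, integral_gaussAt hb]
    exact integral_congr_ae (Filter.Eventually.of_forall hcmp)
  have hgm : ∫ v, g v ∂(gaussAt b θ) = ∫ v, h v ∂(gaussAt b θ) - b * ‖θ‖ ^ 2 / 2 := by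
    rw [hg, integral_add isub (integrable_const _),
      integral_sub ih (iin.const_mul b), integral_const_mul, hin]
    simp
    ring
  have hJ : Real.exp (∫ v, g v ∂(gaussAt b θ)) ≤ ∫ v, Real.exp (g v) ∂(gaussAt b θ) :=
    convexOn_exp.map_integral_le Real.continuous_exp.continuousOn isClosed_univ (by simp) ig iexpg
  rw [← heq, hgm] at hJ
  have := (Real.le_log_iff_exp_le ((Real.exp_pos _).trans_le hJ)).2 hJ
  linarith

end Gaussian

/-! ### The influence function -/

section Influence

/-- `log (1 + y + y² / 2)`, the function that dominates `ψ`. -/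
def logQuad (y : ℝ) : ℝ := Real.log (1 + y + y ^ 2 / 2)

lemma quad_pos (y : ℝ) : 0 < 1 + y + y ^ 2 / 2 := by nlinarith [sq_nonneg (1 + y)]

lemma half_le_quad (y : ℝ) : 1 / 2 ≤ 1 + y + y ^ 2 / 2 := by nlinarith [sq_nonneg (1 + y)]

lemma continuous_logQuad : Continuous logQuad := by
  unfold logQuad
  exact Continuous.log (by fun_prop) fun y => (quad_pos y).ne'

lemma neg_log_two_le_logQuad (y : ℝ) : -Real.log 2 ≤ logQuad y := by
  rw [logQuad, ← Real.log_inv]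
  exact Real.log_le_log (by norm_num) (by simpa using half_le_quad y)

lemma hasDerivAt_logQuad (y : ℝ) : HasDerivAt logQuad ((1 + y) / (1 + y + y ^ 2 / 2)) y := by
  have h : HasDerivAt (fun y : ℝ => 1 + y + y ^ 2 / 2) (1 + y) y := by
    have := ((hasDerivAt_id y).const_add 1).add ((hasDerivAt_pow 2 y).div_const 2)
    exact this.congr_deriv (by push_cast; ring)
  exact h.log (quad_pos y).ne'

/-- The second derivative of `logQuad` is at least `-1/4`, as a tangent inequality. -/
lemma logQuad_tangent (u y : ℝ) :
    logQuad u + (1 + u) / (1 + u + u ^ 2 / 2) * (y - u) - (y - u) ^ 2 / 8 ≤ logQuad y := by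
  have hderiv : ∀ y, HasDerivAt (fun y => logQuad y + y ^ 2 / 8)
      ((1 + y) / (1 + y + y ^ 2 / 2) + y / 4) y := by
    intro y
    have := (hasDerivAt_logQuad y).add ((hasDerivAt_pow 2 y).div_const 8)
    exact this.congr_deriv (by push_cast; ring)
  have hmono : Monotone (deriv fun y => logQuad y + y ^ 2 / 8) := by
    have e : (deriv fun y => logQuad y + y ^ 2 / 8) =
        fun y => (1 + y) / (1 + y + y ^ 2 / 2) + y / 4 := funext fun y => (hderiv y).deriv
    rw [e]
    intro s t hst
    have key : (1 + t) / (1 + t + t ^ 2 / 2) + t / 4 - ((1 + s) / (1 + s + s ^ 2 / 2) + s / 4) =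
        (t - s) * ((1 + t + t ^ 2 / 2) * (1 + s + s ^ 2 / 2) / 4 - (t + s + t * s) / 2) /
          ((1 + t + t ^ 2 / 2) * (1 + s + s ^ 2 / 2)) := by
      have h1 := (quad_pos s).ne'
      have h2 := (quad_pos t).ne'
      generalize hQ : 1 + s + s ^ 2 / 2 = Q at h1
      generalize hR : 1 + t + t ^ 2 / 2 = R at h2
      field_simp
      rw [← hQ, ← hR]
      ring
    have hnum : 0 ≤ (1 + t + t ^ 2 / 2) * (1 + s + s ^ 2 / 2) / 4 - (t + s + t * s) / 2 := by
      nlinarith [sq_nonneg ((1 + t) * (1 + s) - 1), sq_nonneg (t - s), sq_nonneg (t + s),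
        sq_nonneg ((1 + t) * (1 + s) - 2), sq_nonneg ((1 + t) * (1 + s) - 3)]
    have : 0 ≤ (t - s) * ((1 + t + t ^ 2 / 2) * (1 + s + s ^ 2 / 2) / 4 - (t + s + t * s) / 2) /
          ((1 + t + t ^ 2 / 2) * (1 + s + s ^ 2 / 2)) :=
      div_nonneg (mul_nonneg (by linarith) hnum) (mul_pos (quad_pos t) (quad_pos s)).le
    dsimp only
    linarith
  have hconv : ConvexOn ℝ Set.univ fun y => logQuad y + y ^ 2 / 8 :=
    hmono.convexOn_univ_of_deriv fun y => (hderiv y).differentiableAt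
  rcases lt_trichotomy u y with h | h | h
  · have := hconv.le_slope_of_hasDerivAt (Set.mem_univ u) (Set.mem_univ y) h (hderiv u)
    rw [slope_def_field, le_div_iff₀ (by linarith)] at this
    nlinarith
  · simp [h]
  · have := hconv.slope_le_of_hasDerivAt (Set.mem_univ y) (Set.mem_univ u) h (hderiv u)
    rw [slope_def_field, div_le_iff₀ (by linarith)] at this
    nlinarith

lemma abs_psi_le (t : ℝ) : |psi t| ≤ Real.log 2 := by
  have h2 : 0 < Real.log 2 := Real.log_pos (by norm_num)
  have aux : ∀ w : ℝ, 1 / 2 ≤ w → w ≤ 1 → -Real.log 2 ≤ Real.log w ∧ Real.log w ≤ 0 := by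
    intro w hw hw1
    refine ⟨?_, Real.log_nonpos (by linarith) hw1⟩
    rw [← Real.log_inv]
    exact Real.log_le_log (by norm_num) (by linarith)
  unfold psi
  split_ifs with h1 h3 h4
  · exact (abs_of_pos h2).le
  · have := aux (1 - t + t ^ 2 / 2) (by nlinarith [sq_nonneg (1 - t)]) (by nlinarith)
    rw [abs_le]; constructor <;> linarith [this.1, this.2]
  · have := aux (1 + t + t ^ 2 / 2) (by nlinarith [sq_nonneg (1 + t)]) (by nlinarith)
    rw [abs_le]; constructor <;> linarith [this.1, this.2]
  · rw [abs_neg, abs_of_pos h2]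

/-- `psi` through the truncations of `t` to `[0, 1]` and `[-1, 0]`. -/
lemma psi_eq_clamp (t : ℝ) :
    psi t = logQuad (-max 0 (min (-t) 1)) - logQuad (-max 0 (min t 1)) := by
  have l0 : logQuad (-0) = 0 := by simp [logQuad]
  have l1 : logQuad (-1) = -Real.log 2 := by
    rw [logQuad, ← Real.log_inv]; norm_num
  unfold psi
  split_ifs with h1 h3 h4
  · rw [min_eq_right h1, max_eq_right zero_le_one, min_eq_left (by linarith),
      max_eq_left (by linarith), l0, l1]
    ring
  · rw [min_eq_left (not_le.1 h1).le, max_eq_right h3, min_eq_left (by linarith),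
      max_eq_left (by linarith), l0, logQuad]
    ring_nf
  · rw [min_eq_left (not_le.1 h1).le, max_eq_left (not_le.1 h3).le, min_eq_left (by linarith),
      max_eq_right (by linarith), l0, logQuad]
    ring_nf
  · rw [min_eq_left (not_le.1 h1).le, max_eq_left (not_le.1 h3).le, min_eq_right (by linarith),
      max_eq_right zero_le_one, l0, l1]
    ring

lemma psi_neg (t : ℝ) : psi (-t) = -psi t := by
  rw [psi_eq_clamp, psi_eq_clamp, neg_neg]
  ring

lemma continuous_psi : Continuous psi := by
  have e : psi = fun t => logQuad (-max 0 (min (-t) 1)) - logQuad (-max 0 (min t 1)) :=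
    funext psi_eq_clamp
  rw [e]
  exact (continuous_logQuad.comp (by fun_prop)).sub (continuous_logQuad.comp (by fun_prop))

lemma monotone_psi : Monotone psi := by
  have hanti : ∀ x y : ℝ, 0 ≤ x → x ≤ y → y ≤ 1 → logQuad (-y) ≤ logQuad (-x) := by
    intro x y hx hxy hy
    exact Real.log_le_log (quad_pos _) (by nlinarith)
  intro s t hst
  rw [psi_eq_clamp, psi_eq_clamp]
  have h1 := hanti (max 0 (min s 1)) (max 0 (min t 1)) (le_max_left _ _) (by gcongr)
    (max_le zero_le_one (min_le_right _ _))
  have h2 := hanti (max 0 (min (-t) 1)) (max 0 (min (-s) 1)) (le_max_left _ _) (by gcongr)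
    (max_le zero_le_one (min_le_right _ _))
  linarith

lemma psi_le_logQuad (t : ℝ) : psi t ≤ logQuad t := by
  unfold psi logQuad
  split_ifs with h1 h3 h4
  · exact Real.log_le_log (by norm_num) (by nlinarith)
  · rw [← Real.log_inv]
    refine Real.log_le_log (inv_pos.2 (by nlinarith)) ?_
    rw [inv_le_iff_one_le_mul₀ (by nlinarith)]
    nlinarith [sq_nonneg (t ^ 2)]
  · exact le_rfl
  · exact neg_log_two_le_logQuad t

/-- A function bounded above by `log (2e)` which lies below `logQuad`. -/
def cutLog (y : ℝ) : ℝ := min (logQuad y) (1 + Real.log 2)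

lemma cut_constant {u : ℝ} (h0 : 0 ≤ u) (h1 : u ≤ 1) :
    1 / (2 * (1 - u + u ^ 2 / 2)) + 4 / 3 * ((1 + u) / (1 + u + u ^ 2 / 2)) ^ 2 ≤ 2 := by
  have hw : 0 < 1 - u + u ^ 2 / 2 := by nlinarith [sq_nonneg (1 - u)]
  have hq := quad_pos u
  rw [div_pow, ← mul_div_assoc, div_add_div _ _ (by positivity) (by positivity),
    div_le_iff₀ (by positivity)]
  have key : 0 ≤ (1 - u) ^ 2 + 3 * u ^ 2 * (1 - u) + u ^ 4 * (3 / 2 * u ^ 2 + 3 * u - 7 / 4) := by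
    have h2 : 0 ≤ 3 * u ^ 2 * (1 - u) := mul_nonneg (by positivity) (by linarith)
    rcases le_or_gt (1 / 2) u with h | h
    · have : 0 ≤ u ^ 4 * (3 / 2 * u ^ 2 + 3 * u - 7 / 4) := mul_nonneg (by positivity) (by nlinarith)
      nlinarith [sq_nonneg (1 - u)]
    · have h4 : u ^ 4 ≤ (1 / 2) ^ 4 := pow_le_pow_left₀ h0 h.le 4
      have : 0 ≤ u ^ 4 * (3 / 2 * u ^ 2 + 3 * u) := by positivity
      nlinarith
  nlinarith [key]

/-- `cutLog` dominates, at every point, a concave parabola through a point above `psi`. -/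
lemma exists_parabola_le_cutLog (u : ℝ) :
    ∃ p : ℝ, ∀ y, psi u + p * (y - u) - 3 / 16 * (y - u) ^ 2 ≤ cutLog y := by
  have hl2 : 0 < Real.log 2 := Real.log_pos (by norm_num)
  -- A parabola is bounded by its maximum `psi u + 4/3 p²`, and `p` is the slope of `logQuad`.
  have main : psi u + 4 / 3 * ((1 + u) / (1 + u + u ^ 2 / 2)) ^ 2 ≤ 1 + Real.log 2 →
      ∃ p : ℝ, ∀ y, psi u + p * (y - u) - 3 / 16 * (y - u) ^ 2 ≤ cutLog y := by
    intro h
    refine ⟨(1 + u) / (1 + u + u ^ 2 / 2), fun y => le_min ?_ ?_⟩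
    · have := logQuad_tangent u y
      have := psi_le_logQuad u
      nlinarith [sq_nonneg (y - u)]
    · nlinarith [sq_nonneg (3 / 8 * (y - u) - (1 + u) / (1 + u + u ^ 2 / 2))]
  have hpsi := abs_le.1 (abs_psi_le u)
  rcases lt_or_ge u (-1) with h | h
  · refine ⟨0, fun y => ?_⟩
    have e : psi u = -Real.log 2 := by
      unfold psi
      rw [if_neg (by linarith), if_neg (by linarith), if_neg (by linarith)]
    rw [e]
    refine le_min ?_ ?_
    · nlinarith [sq_nonneg (y - u), neg_log_two_le_logQuad y]
    · nlinarith [sq_nonneg (y - u)]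
  apply main
  have hq := quad_pos u
  rcases le_or_gt u 0 with h0 | h0
  · have h1 : ((1 + u) / (1 + u + u ^ 2 / 2)) ^ 2 ≤ 1 := by
      rw [sq_le_one_iff₀ (div_nonneg (by linarith) hq.le), div_le_one hq]
      nlinarith [sq_nonneg u]
    have h2 : psi u ≤ 0 := by
      refine (psi_le_logQuad u).trans (Real.log_nonpos hq.le (by nlinarith))
    have := Real.log_two_gt_d9
    nlinarith
  rcases le_or_gt u 1 with h1 | h1
  · have hw : 0 < 1 - u + u ^ 2 / 2 := by nlinarith [sq_nonneg (1 - u)]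
    have hpsi' : psi u ≤ Real.log 2 + (1 / (2 * (1 - u + u ^ 2 / 2)) - 1) := by
      have h3 : psi u ≤ -Real.log (1 - u + u ^ 2 / 2) := by
        unfold psi
        split_ifs with h4
        · have : u = 1 := le_antisymm h1 h4
          rw [this, ← Real.log_inv]; norm_num
        · exact le_rfl
        · exact absurd h0.le ‹_›
      have h5 := Real.log_le_sub_one_of_pos (x := 1 / (2 * (1 - u + u ^ 2 / 2))) (by positivity)
      rw [one_div, Real.log_inv, Real.log_mul (by norm_num) hw.ne'] at h5
      rw [one_div]
      linarith
    have := cut_constant h0.le h1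
    linarith
  · have h3 : ((1 + u) / (1 + u + u ^ 2 / 2)) ^ 2 ≤ (4 / 5) ^ 2 := by
      refine pow_le_pow_left₀ (div_nonneg (by linarith) hq.le) ?_ 2
      rw [div_le_iff₀ hq]
      nlinarith
    linarith [hpsi.2]

lemma continuous_cutLog : Continuous cutLog := continuous_logQuad.min continuous_const

lemma abs_cutLog_le (y : ℝ) : |cutLog y| ≤ 1 + Real.log 2 := by
  have hl2 : 0 < Real.log 2 := Real.log_pos (by norm_num)
  rw [abs_le]
  exact ⟨le_min (by linarith [neg_log_two_le_logQuad y]) (by linarith), min_le_right _ _⟩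

lemma neg_log_two_le_cutLog (y : ℝ) : -Real.log 2 ≤ cutLog y := by
  have hl2 : 0 < Real.log 2 := Real.log_pos (by norm_num)
  exact le_min (neg_log_two_le_logQuad y) (by linarith)

lemma exp_cutLog_le (y : ℝ) : Real.exp (cutLog y) ≤ 1 + y + y ^ 2 / 2 := by
  calc Real.exp (cutLog y) ≤ Real.exp (logQuad y) := Real.exp_le_exp.2 (min_le_left _ _)
    _ = _ := Real.exp_log (quad_pos y)

lemma exp_cutLog_le_two_e (y : ℝ) : Real.exp (cutLog y) ≤ 2 * Real.exp 1 := by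
  calc Real.exp (cutLog y) ≤ Real.exp (1 + Real.log 2) := Real.exp_le_exp.2 (min_le_right _ _)
    _ = _ := by rw [Real.exp_add, Real.exp_log (by norm_num)]; ring

/-- The cost of the correction term is within the constant `c`. -/
lemma correction_constant : 2 * Real.exp 1 * (15 / (4 * Real.log 2)) * (3 / 2) ≤ cc := by
  have hl2 : 0 < Real.log 2 := Real.log_pos (by norm_num)
  have h2 : √2 ^ 2 = 2 := Real.sq_sqrt (by norm_num)
  have hs0 : 1.4142 < √2 := by
    rw [Real.lt_sqrt (by norm_num)]; norm_num
  have hs1 : √2 < 1.4143 := by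
    rw [Real.sqrt_lt' (by norm_num)]; norm_num
  have hexp : 6 * (√2 - 1) ≤ Real.exp (√2 - 1 / 2) := by
    have := Real.sum_le_exp_of_nonneg (x := 0.9142) (by norm_num) 6
    have h3 : Real.exp 0.9142 ≤ Real.exp (√2 - 1 / 2) := Real.exp_le_exp.2 (by linarith)
    simp [Finset.sum_range_succ, Nat.factorial] at this
    linarith
  have hsplit : Real.exp ((1 + 2 * √2) / 2) = Real.exp 1 * Real.exp (√2 - 1 / 2) := by
    rw [← Real.exp_add]; congr 1; ring
  have hs : 0 < √2 - 1 := by linarith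
  rw [cc, hsplit]
  have : 2 * Real.exp 1 * (15 / (4 * Real.log 2)) * (3 / 2) =
      15 / (8 * Real.log 2 * (√2 - 1)) * (Real.exp 1 * (6 * (√2 - 1))) := by
    field_simp
    ring
  rw [this]
  gcongr

lemma cc_pos : 0 < cc := by
  refine lt_of_lt_of_le ?_ correction_constant
  have hl2 : 0 < Real.log 2 := Real.log_pos (by norm_num)
  positivity

/-- Convexity of `exp` on `[0, 4 log 2]`. -/
lemma exp_sub_one_le {h : ℝ} (h0 : 0 ≤ h) (h1 : h ≤ 4 * Real.log 2) :
    Real.exp h - 1 ≤ 15 / (4 * Real.log 2) * h := by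
  have hl2 : 0 < Real.log 2 := Real.log_pos (by norm_num)
  have hconv := convexOn_exp.2
  have hc := hconv (Set.mem_univ 0) (Set.mem_univ (4 * Real.log 2))
    (a := 1 - h / (4 * Real.log 2)) (b := h / (4 * Real.log 2))
    (by rw [sub_nonneg, div_le_one (by positivity)]; exact h1) (by positivity) (by ring)
  have e16 : Real.exp (4 * Real.log 2) = 16 := by
    rw [show 4 * Real.log 2 = Real.log (2 ^ 4) by rw [Real.log_pow]; norm_num,
      Real.exp_log (by norm_num)]
    norm_num
  simp only [smul_eq_mul, mul_zero, zero_add, Real.exp_zero, mul_one, e16] at hc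
  rw [div_mul_cancel₀ _ (by positivity)] at hc
  have : 15 / (4 * Real.log 2) * h = 15 * (h / (4 * Real.log 2)) := by ring
  linarith

/-- Exponential moment control of the perturbed influence: the correction `h ≤ 3/2 e`, truncated
at `4 log 2`, costs at most `cc * e`. -/
lemma exp_cutLog_add_le (y : ℝ) {h e : ℝ} (h0 : 0 ≤ h) (h1 : h ≤ 4 * Real.log 2)
    (he : h ≤ 3 / 2 * e) :
    Real.exp (cutLog y + h) ≤ 1 + y + y ^ 2 / 2 + cc * e := by
  have hl2 : 0 < Real.log 2 := Real.log_pos (by norm_num)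
  have he0 : 0 ≤ e := by linarith
  have hA := exp_cutLog_le y
  have hB := exp_cutLog_le_two_e y
  have hC := exp_sub_one_le h0 h1
  have hexp1 : 0 ≤ Real.exp h - 1 := by linarith [Real.add_one_le_exp h]
  have h3 : Real.exp (cutLog y) * (Real.exp h - 1) ≤ cc * e := by
    calc Real.exp (cutLog y) * (Real.exp h - 1)
        ≤ (2 * Real.exp 1) * (15 / (4 * Real.log 2) * (3 / 2 * e)) := by
          refine mul_le_mul hB (hC.trans ?_) hexp1 (by positivity)
          gcongr
      _ = 2 * Real.exp 1 * (15 / (4 * Real.log 2)) * (3 / 2) * e := by ring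
      _ ≤ cc * e := by gcongr; exact correction_constant
  rw [Real.exp_add]
  linarith

end Influence

/-! ### Moments of the law -/

section Moments

variable {d : ℕ}

/-- The bilinear form `uᵀ M v`. -/
def bil (M : Matrix (Fin d) (Fin d) ℝ) (u v : EuclideanSpace ℝ (Fin d)) : ℝ :=
  ∑ i, ∑ j, u i * M i j * v j

lemma quad_eq_bil (M : Matrix (Fin d) (Fin d) ℝ) (θ : EuclideanSpace ℝ (Fin d)) :
    quad M θ = bil M θ θ := rfl

lemma bil_ofEigen (l : Fin d → ℝ)
    (q : OrthonormalBasis (Fin d) ℝ (EuclideanSpace ℝ (Fin d))) (u v : EuclideanSpace ℝ (Fin d)) :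
    bil (ofEigen l q) u v = ∑ i, l i * (inner ℝ (q i) u * inner ℝ (q i) v) := by
  have h : ∀ i w, inner ℝ (q i) w = ∑ k, q i k * w k := by
    intro i w
    rw [PiLp.inner_apply]
    simp [mul_comm]
  simp only [bil, ofEigen, Matrix.sum_apply, Matrix.smul_apply, Matrix.vecMulVec_apply,
    smul_eq_mul, h]
  calc ∑ i, ∑ j, u i * (∑ k, l k * (q k i * q k j)) * v j
      = ∑ i, ∑ j, ∑ k, l k * ((q k i * u i) * (q k j * v j)) := by
        refine Finset.sum_congr rfl fun i _ => Finset.sum_congr rfl fun j _ => ?_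
        rw [Finset.mul_sum, Finset.sum_mul]
        exact Finset.sum_congr rfl fun k _ => by ring
    _ = ∑ k, ∑ i, ∑ j, l k * ((q k i * u i) * (q k j * v j)) := by
        rw [Finset.sum_comm (f := fun k i => ∑ j, l k * ((q k i * u i) * (q k j * v j)))]
        exact Finset.sum_congr rfl fun i _ => Finset.sum_comm
    _ = ∑ k, l k * ((∑ i, q k i * u i) * ∑ j, q k j * v j) := by
        refine Finset.sum_congr rfl fun k _ => ?_
        rw [Finset.sum_mul_sum, Finset.mul_sum]
        exact Finset.sum_congr rfl fun i _ => (Finset.mul_sum _ _ _).symm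

lemma quad_ofEigen (l : Fin d → ℝ)
    (q : OrthonormalBasis (Fin d) ℝ (EuclideanSpace ℝ (Fin d))) (θ : EuclideanSpace ℝ (Fin d)) :
    quad (ofEigen l q) θ = ∑ i, l i * (inner ℝ (q i) θ) ^ 2 := by
  rw [quad_eq_bil, bil_ofEigen]
  exact Finset.sum_congr rfl fun i _ => by ring

lemma quad_ofEigen_self (l : Fin d → ℝ)
    (q : OrthonormalBasis (Fin d) ℝ (EuclideanSpace ℝ (Fin d))) (i : Fin d) :
    quad (ofEigen l q) (q i) = l i := by
  rw [quad_ofEigen]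
  simp [OrthonormalBasis.inner_eq_ite]

variable {P : Measure (EuclideanSpace ℝ (Fin d))}

/-- The second moment `𝔼 ⟨θ, X⟩²` of a law. -/
def secMom (P : Measure (EuclideanSpace ℝ (Fin d))) (θ : EuclideanSpace ℝ (Fin d)) : ℝ :=
  ∫ x, (inner ℝ θ x) ^ 2 ∂P

lemma secMom_nonneg (θ : EuclideanSpace ℝ (Fin d)) : 0 ≤ secMom P θ :=
  integral_nonneg fun _ => sq_nonneg _

lemma secMom_smul (α : ℝ) (θ : EuclideanSpace ℝ (Fin d)) :
    secMom P (α • θ) = α ^ 2 * secMom P θ := by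
  simp only [secMom, inner_smul_left, mul_pow, integral_const_mul]
  simp

lemma inner_sq_le (θ x : EuclideanSpace ℝ (Fin d)) :
    (inner ℝ θ x) ^ 2 ≤ ‖θ‖ ^ 2 * ‖x‖ ^ 2 := by
  rw [← mul_pow, sq_le_sq, abs_of_nonneg (mul_nonneg (norm_nonneg θ) (norm_nonneg x))]
  exact abs_real_inner_le_norm θ x

lemma integrable_inner_pow_four (hP : Integrable (fun x => ‖x‖ ^ 4) P)
    (θ : EuclideanSpace ℝ (Fin d)) : Integrable (fun x => (inner ℝ θ x) ^ 4) P := by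
  refine (hP.const_mul (‖θ‖ ^ 4)).mono' (by fun_prop)
    (Filter.Eventually.of_forall fun x => ?_)
  rw [Real.norm_of_nonneg (by positivity)]
  have := pow_le_pow_left₀ (sq_nonneg _) (inner_sq_le θ x) 2
  nlinarith

lemma integrable_inner_sq_mul_norm_sq (hP : Integrable (fun x => ‖x‖ ^ 4) P)
    (θ : EuclideanSpace ℝ (Fin d)) :
    Integrable (fun x => (inner ℝ θ x) ^ 2 * ‖x‖ ^ 2) P := by
  refine (hP.const_mul (‖θ‖ ^ 2)).mono' (by fun_prop)
    (Filter.Eventually.of_forall fun x => ?_)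
  rw [Real.norm_of_nonneg (by positivity)]
  have := mul_le_mul_of_nonneg_right (inner_sq_le θ x) (sq_nonneg ‖x‖)
  nlinarith

lemma s4sq_sq (P : Measure (EuclideanSpace ℝ (Fin d))) : s4sq P ^ 2 = ∫ x, ‖x‖ ^ 4 ∂P :=
  Real.sq_sqrt (integral_nonneg fun _ => by positivity)

variable [IsProbabilityMeasure P]

lemma integrable_norm_sq (hP : Integrable (fun x => ‖x‖ ^ 4) P) :
    Integrable (fun x => ‖x‖ ^ 2) P := by
  refine (hP.add (integrable_const 1)).mono' (by fun_prop) (Filter.Eventually.of_forall fun x => ?_)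
  rw [Real.norm_of_nonneg (by positivity)]
  simp only [Pi.add_apply]
  nlinarith [sq_nonneg (‖x‖ ^ 2 - 1)]

lemma integrable_inner_sq (hP : Integrable (fun x => ‖x‖ ^ 4) P)
    (θ : EuclideanSpace ℝ (Fin d)) : Integrable (fun x => (inner ℝ θ x) ^ 2) P := by
  refine ((integrable_norm_sq hP).const_mul (‖θ‖ ^ 2)).mono' (by fun_prop)
    (Filter.Eventually.of_forall fun x => ?_)
  rw [Real.norm_of_nonneg (by positivity)]
  exact inner_sq_le θ x

lemma quad_gram (hP : Integrable (fun x => ‖x‖ ^ 4) P) (θ : EuclideanSpace ℝ (Fin d)) :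
    quad (gram P) θ = secMom P θ := by
  have hint : ∀ i j, Integrable (fun x : EuclideanSpace ℝ (Fin d) => x i * x j) P := by
    intro i j
    refine (integrable_norm_sq hP).mono' (by fun_prop) (Filter.Eventually.of_forall fun x => ?_)
    rw [norm_mul, sq]
    exact mul_le_mul (PiLp.norm_apply_le x i) (PiLp.norm_apply_le x j) (norm_nonneg _)
      (norm_nonneg _)
  have h : ∀ x, (inner ℝ θ x) ^ 2 = ∑ i, ∑ j, θ i * (x i * x j) * θ j := by
    intro x
    rw [PiLp.inner_apply, sq, Finset.sum_mul_sum]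
    refine Finset.sum_congr rfl fun i _ => Finset.sum_congr rfl fun j _ => ?_
    simp
    ring
  simp only [quad, secMom, h, gram, Matrix.of_apply]
  rw [integral_finsetSum _ fun i _ => integrable_finsetSum _ fun j _ =>
    ((hint i j).const_mul _).mul_const _]
  refine Finset.sum_congr rfl fun i _ => ?_
  rw [integral_finsetSum _ fun j _ => ((hint i j).const_mul _).mul_const _]
  refine Finset.sum_congr rfl fun j _ => ?_
  rw [integral_mul_const, integral_const_mul]

lemma ae_inner_eq_zero (hP : Integrable (fun x => ‖x‖ ^ 4) P) {θ : EuclideanSpace ℝ (Fin d)}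
    (h : secMom P θ = 0) : ∀ᵐ x ∂P, inner ℝ θ x = 0 := by
  rw [secMom, integral_eq_zero_iff_of_nonneg (fun _ => sq_nonneg _) (integrable_inner_sq hP θ)] at h
  filter_upwards [h] with x hx
  exact pow_eq_zero_iff (two_ne_zero) |>.1 hx

/-- In an eigenbasis of the Gram matrix, `⟨θ, X⟩` only involves the coordinates along which the law
is not degenerate; hence `⟨θ, X⟩²` is at most `𝔼 ⟨θ, X⟩²` times a multiple of `‖X‖²`. -/
lemma bddAbove_kappa (hP : Integrable (fun x => ‖x‖ ^ 4) P) {lam : Fin d → ℝ}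
    {p : OrthonormalBasis (Fin d) ℝ (EuclideanSpace ℝ (Fin d))} (hG : gram P = ofEigen lam p) :
    BddAbove {k | ∃ θ : EuclideanSpace ℝ (Fin d), 0 < ∫ x, (inner ℝ θ x) ^ 2 ∂P ∧
      k = (∫ x, (inner ℝ θ x) ^ 4 ∂P) / (∫ x, (inner ℝ θ x) ^ 2 ∂P) ^ 2} := by
  have hlam : ∀ i, secMom P (p i) = lam i := fun i => by
    rw [← quad_gram hP, hG, quad_ofEigen_self]
  have hlam0 : ∀ i, 0 ≤ lam i := fun i => hlam i ▸ secMom_nonneg _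
  have hae : ∀ᵐ x ∂P, ∀ i, lam i = 0 → inner ℝ (p i) x = 0 := by
    rw [ae_all_iff]
    intro i
    by_cases hi : lam i = 0
    · filter_upwards [ae_inner_eq_zero hP ((hlam i).trans hi)] with x hx _ using hx
    · exact Filter.Eventually.of_forall fun x h => absurd h hi
  set C := ∑ i, (lam i)⁻¹ with hC
  have hC0 : 0 ≤ C := Finset.sum_nonneg fun i _ => inv_nonneg.2 (hlam0 i)
  refine ⟨C ^ 2 * ∫ x, ‖x‖ ^ 4 ∂P, ?_⟩
  rintro k ⟨θ, hθ, rfl⟩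
  rw [div_le_iff₀ (by positivity)]
  have hN : ∫ x, (inner ℝ θ x) ^ 2 ∂P = ∑ i, lam i * (inner ℝ (p i) θ) ^ 2 := by
    rw [← quad_ofEigen, ← hG, quad_gram hP, secMom]
  have hpt : ∀ᵐ x ∂P, (inner ℝ θ x) ^ 4 ≤
      (∫ x, (inner ℝ θ x) ^ 2 ∂P) ^ 2 * (C ^ 2 * ‖x‖ ^ 4) := by
    filter_upwards [hae] with x hx
    have e : inner ℝ θ x =
        ∑ i, (√(lam i) * inner ℝ (p i) θ) * (inner ℝ (p i) x / √(lam i)) := by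
      rw [← p.sum_inner_mul_inner θ x]
      refine Finset.sum_congr rfl fun i _ => ?_
      rcases eq_or_ne (lam i) 0 with hi | hi
      · simp [hi, hx i hi]
      · have : √(lam i) ≠ 0 := Real.sqrt_ne_zero'.2 (lt_of_le_of_ne (hlam0 i) hi.symm)
        rw [real_inner_comm]
        field_simp
    have h1 : (inner ℝ θ x) ^ 2 ≤ (∑ i, lam i * (inner ℝ (p i) θ) ^ 2) * (C * ‖x‖ ^ 2) := by
      rw [e]
      refine (Finset.sum_mul_sq_le_sq_mul_sq _ _ _).trans ?_
      refine mul_le_mul (le_of_eq ?_) ?_ (Finset.sum_nonneg fun i _ => sq_nonneg _)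
        (Finset.sum_nonneg fun i _ => mul_nonneg (hlam0 i) (sq_nonneg _))
      · exact Finset.sum_congr rfl fun i _ => by rw [mul_pow, Real.sq_sqrt (hlam0 i)]
      · rw [hC, Finset.sum_mul]
        refine Finset.sum_le_sum fun i _ => ?_
        rw [div_pow, Real.sq_sqrt (hlam0 i), div_eq_inv_mul]
        refine mul_le_mul_of_nonneg_left ?_ (inv_nonneg.2 (hlam0 i))
        simpa using inner_sq_le (p i) x
    rw [hN]
    have := pow_le_pow_left₀ (sq_nonneg _) h1 2
    nlinarith
  have := integral_mono_ae (integrable_inner_pow_four hP θ) ((hP.const_mul _).const_mul _) hpt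
  rw [integral_const_mul, integral_const_mul] at this
  linarith

/-- The defining property of `κ`, extended to the degenerate directions. -/
lemma integral_inner_pow_four_le (hP : Integrable (fun x => ‖x‖ ^ 4) P) {lam : Fin d → ℝ}
    {p : OrthonormalBasis (Fin d) ℝ (EuclideanSpace ℝ (Fin d))} (hG : gram P = ofEigen lam p)
    (θ : EuclideanSpace ℝ (Fin d)) :
    ∫ x, (inner ℝ θ x) ^ 4 ∂P ≤ kappa P * secMom P θ ^ 2 := by
  rcases (secMom_nonneg (P := P) θ).eq_or_lt with h | h
  · have h0 : ∫ x, (inner ℝ θ x) ^ 4 ∂P = 0 := by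
      rw [integral_congr_ae (g := fun _ => (0 : ℝ))]
      · simp
      · filter_upwards [ae_inner_eq_zero hP h.symm] with x hx
        simp [hx]
    rw [h0, ← h]
    simp
  · rw [← div_le_iff₀ (by positivity)]
    exact le_csSup (bddAbove_kappa hP hG) ⟨θ, h, rfl⟩

lemma integral_inner_sq_mul_norm_sq_le (hP : Integrable (fun x => ‖x‖ ^ 4) P)
    {κ S : ℝ} (hκ : 0 < κ) (hS : 0 < S) (hSP : S ^ 2 = ∫ x, ‖x‖ ^ 4 ∂P)
    (θ : EuclideanSpace ℝ (Fin d)) (h4 : ∫ x, (inner ℝ θ x) ^ 4 ∂P ≤ κ * secMom P θ ^ 2) :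
    ∫ x, (inner ℝ θ x) ^ 2 * ‖x‖ ^ 2 ∂P ≤ √κ * secMom P θ * S := by
  have hk : 0 < √κ := Real.sqrt_pos.2 hκ
  have hk2 : √κ ^ 2 = κ := Real.sq_sqrt hκ.le
  rcases (secMom_nonneg (P := P) θ).eq_or_lt with h | h
  · have h0 : ∫ x, (inner ℝ θ x) ^ 2 * ‖x‖ ^ 2 ∂P = 0 := by
      rw [integral_congr_ae (g := fun _ => (0 : ℝ))]
      · simp
      · filter_upwards [ae_inner_eq_zero hP h.symm] with x hx
        simp [hx]
    rw [h0, ← h]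
    simp
  · set N := secMom P θ
    -- Young's inequality with the weight that balances the two fourth moments
    set t := S / (√κ * N) with ht
    have htpos : 0 < t := by positivity
    have hpt : ∀ x, (inner ℝ θ x) ^ 2 * ‖x‖ ^ 2 ≤
        t / 2 * (inner ℝ θ x) ^ 4 + t⁻¹ / 2 * ‖x‖ ^ 4 := by
      intro x
      have h2 : t / 2 * (inner ℝ θ x) ^ 4 + t⁻¹ / 2 * ‖x‖ ^ 4 - (inner ℝ θ x) ^ 2 * ‖x‖ ^ 2 =
          t⁻¹ / 2 * (t * (inner ℝ θ x) ^ 2 - ‖x‖ ^ 2) ^ 2 := by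
        field_simp
        ring
      have h3 : 0 ≤ t⁻¹ / 2 * (t * (inner ℝ θ x) ^ 2 - ‖x‖ ^ 2) ^ 2 := by positivity
      linarith
    have h5 := integral_mono (integrable_inner_sq_mul_norm_sq hP θ)
      (((integrable_inner_pow_four hP θ).const_mul (t / 2)).fun_add (hP.const_mul (t⁻¹ / 2))) hpt
    rw [integral_add ((integrable_inner_pow_four hP θ).const_mul _) (hP.const_mul _),
      integral_const_mul, integral_const_mul, ← hSP] at h5
    calc _ ≤ _ := h5
      _ ≤ t / 2 * (κ * N ^ 2) + t⁻¹ / 2 * S ^ 2 := by gcongr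
      _ = √κ * N * S := by
        rw [ht]
        generalize √κ = k at hk hk2
        subst hk2
        field_simp
        ring

lemma secMom_le (hP : Integrable (fun x => ‖x‖ ^ 4) P) {S : ℝ} (hS : 0 < S)
    (hSP : S ^ 2 = ∫ x, ‖x‖ ^ 4 ∂P) {θ : EuclideanSpace ℝ (Fin d)} (hθ : ‖θ‖ = 1) :
    secMom P θ ≤ S := by
  have hpt : ∀ x, (inner ℝ θ x) ^ 2 ≤ S / 2 + (2 * S)⁻¹ * ‖x‖ ^ 4 := by
    intro x
    have h1 := inner_sq_le θ x
    rw [hθ, one_pow, one_mul] at h1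
    refine h1.trans ?_
    have h2 : S / 2 + (2 * S)⁻¹ * ‖x‖ ^ 4 - ‖x‖ ^ 2 = (2 * S)⁻¹ * (S - ‖x‖ ^ 2) ^ 2 := by
      field_simp
      ring
    have h3 : 0 ≤ (2 * S)⁻¹ * (S - ‖x‖ ^ 2) ^ 2 := by positivity
    linarith
  have h5 := integral_mono (integrable_inner_sq hP θ)
      ((integrable_const (S / 2)).fun_add (hP.const_mul ((2 * S)⁻¹))) hpt
  rw [integral_add (integrable_const _) (hP.const_mul _), integral_const_mul, ← hSP] at h5
  refine h5.trans (le_of_eq ?_)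
  simp
  field_simp
  ring

end Moments

/-! ### Smoothing and the PAC-Bayes inequality -/

section Smoothing

variable {d : ℕ}

/-- The correction added to the perturbed influence to absorb the variance of `⟨v, x⟩²` under the
Gaussian perturbation, truncated so that its exponential moment stays under control. -/
def corr (b : ℝ) (v x : EuclideanSpace ℝ (Fin d)) : ℝ :=
  min (4 * Real.log 2) (3 / 2 * ((inner ℝ v x) ^ 2 * (‖x‖ ^ 2 / b)) + 3 / 4 * (‖x‖ ^ 2 / b) ^ 2)

/-- The perturbed influence: its Gaussian average around `θ` dominates
`ψ (sg (⟨θ, x⟩² - l))`, for a sign `sg`. -/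
def pert (b l sg : ℝ) (v x : EuclideanSpace ℝ (Fin d)) : ℝ :=
  cutLog (sg * ((inner ℝ v x) ^ 2 - ‖x‖ ^ 2 / b - l)) + corr b v x

/-- A polynomial upper bound for `exp (pert) - 1`. -/
def pertBound (b l sg : ℝ) (v x : EuclideanSpace ℝ (Fin d)) : ℝ :=
  sg * ((inner ℝ v x) ^ 2 - ‖x‖ ^ 2 / b - l) + ((inner ℝ v x) ^ 2 - ‖x‖ ^ 2 / b - l) ^ 2 / 2 +
    cc * ((inner ℝ v x) ^ 2 * (‖x‖ ^ 2 / b) + (‖x‖ ^ 2 / b) ^ 2 / 2)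

lemma corr_nonneg {b : ℝ} (hb : 0 < b) (v x : EuclideanSpace ℝ (Fin d)) : 0 ≤ corr b v x := by
  have : 0 < Real.log 2 := Real.log_pos (by norm_num)
  exact le_min (by positivity) (by positivity)

lemma corr_le (b : ℝ) (v x : EuclideanSpace ℝ (Fin d)) : corr b v x ≤ 4 * Real.log 2 :=
  min_le_left _ _

lemma continuous_corr (b : ℝ) :
    Continuous fun z : EuclideanSpace ℝ (Fin d) × EuclideanSpace ℝ (Fin d) => corr b z.1 z.2 := by
  unfold corr
  fun_prop

lemma continuous_pert (b l sg : ℝ) :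
    Continuous fun z : EuclideanSpace ℝ (Fin d) × EuclideanSpace ℝ (Fin d) =>
      pert b l sg z.1 z.2 := by
  refine Continuous.add (continuous_cutLog.comp (by fun_prop)) (continuous_corr b)

lemma abs_pert_le {b : ℝ} (hb : 0 < b) (l sg : ℝ) (v x : EuclideanSpace ℝ (Fin d)) :
    |pert b l sg v x| ≤ 1 + 5 * Real.log 2 := by
  have h1 := abs_cutLog_le (sg * ((inner ℝ v x) ^ 2 - ‖x‖ ^ 2 / b - l))
  have h2 : |corr b v x| ≤ 4 * Real.log 2 := by
    rw [abs_of_nonneg (corr_nonneg hb v x)]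
    exact corr_le b v x
  refine (abs_add_le _ _).trans ?_
  linarith

lemma exp_pert_le {b : ℝ} (hb : 0 < b) (l : ℝ) {sg : ℝ} (hsg : sg ^ 2 = 1)
    (v x : EuclideanSpace ℝ (Fin d)) :
    Real.exp (pert b l sg v x) ≤ 1 + pertBound b l sg v x := by
  have h := exp_cutLog_add_le (sg * ((inner ℝ v x) ^ 2 - ‖x‖ ^ 2 / b - l)) (corr_nonneg hb v x)
    (corr_le b v x) (e := (inner ℝ v x) ^ 2 * (‖x‖ ^ 2 / b) + (‖x‖ ^ 2 / b) ^ 2 / 2)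
    ((min_le_right _ _).trans (le_of_eq (by ring)))
  rw [mul_pow, hsg, one_mul] at h
  refine h.trans (le_of_eq ?_)
  rw [pertBound]
  ring

/-- The mean correction, by symmetry of the Gaussian law: one of `v`, `2θ - v` has
`⟨·, x⟩² ≥ ⟨θ, x⟩²`. -/
lemma le_integral_corr {b : ℝ} (hb : 0 < b) (θ x : EuclideanSpace ℝ (Fin d)) :
    min (2 * Real.log 2) (3 / 4 * ((inner ℝ θ x) ^ 2 * (‖x‖ ^ 2 / b)) + 3 / 8 * (‖x‖ ^ 2 / b) ^ 2) ≤
      ∫ v, corr b v x ∂(gaussAt b θ) := by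
  have := isProbabilityMeasure_gaussAt hb θ
  have hint : ∀ g : EuclideanSpace ℝ (Fin d) → EuclideanSpace ℝ (Fin d), Continuous g →
      Integrable (fun v => corr b (g v) x) (gaussAt b θ) := by
    intro g hg
    refine Integrable.of_bound ?_ (4 * Real.log 2) (Filter.Eventually.of_forall fun v => ?_)
    · exact ((continuous_corr b).comp (hg.prodMk continuous_const)).aestronglyMeasurable
    · rw [Real.norm_of_nonneg (corr_nonneg hb _ x)]
      exact corr_le b _ x
  have hpt : ∀ v, corr b θ x ≤ corr b v x + corr b ((2 : ℝ) • θ - v) x := by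
    intro v
    have hmono : ∀ w : EuclideanSpace ℝ (Fin d), (inner ℝ θ x) ^ 2 ≤ (inner ℝ w x) ^ 2 →
        corr b θ x ≤ corr b w x := by
      intro w hw
      unfold corr
      gcongr
    have h2 : inner ℝ ((2 : ℝ) • θ - v) x = 2 * inner ℝ θ x - inner ℝ v x := by
      rw [inner_sub_left, inner_smul_left]
      simp
    rcases le_or_gt ((inner ℝ θ x) ^ 2) ((inner ℝ v x) ^ 2) with h | h
    · linarith [hmono v h, corr_nonneg hb ((2 : ℝ) • θ - v) x]
    · have : corr b θ x ≤ corr b ((2 : ℝ) • θ - v) x := by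
        apply hmono
        rw [h2]
        nlinarith [sq_nonneg (inner ℝ θ x - inner ℝ v x)]
      linarith [corr_nonneg hb v x]
  have hI := integral_mono (integrable_const (corr b θ x))
    ((hint (fun v => v) continuous_id).fun_add (hint (fun v => (2 : ℝ) • θ - v) (by fun_prop))) hpt
  rw [integral_add (hint (fun v => v) continuous_id)
    (hint (fun v => (2 : ℝ) • θ - v) (by fun_prop)),
    integral_gaussAt_reflect hb θ (fun v => corr b v x)] at hI
  simp only [integral_const, probReal_univ, one_smul] at hI
  have : min (2 * Real.log 2)
      (3 / 4 * ((inner ℝ θ x) ^ 2 * (‖x‖ ^ 2 / b)) + 3 / 8 * (‖x‖ ^ 2 / b) ^ 2) =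
      corr b θ x / 2 := by
    rw [corr, ← min_div_div_right (by norm_num : (0 : ℝ) ≤ 2)]
    congr 1 <;> ring
  linarith

/-- The Gaussian average of the perturbed influence dominates the influence: a variance bound from
the parabolas below `cutLog`, truncated because `ψ` and `cutLog` are bounded, is repaid by the
correction. -/
lemma psi_le_integral_pert {b : ℝ} (hb : 0 < b) (l : ℝ) {sg : ℝ} (hsg : sg ^ 2 = 1)
    (θ x : EuclideanSpace ℝ (Fin d)) :
    psi (sg * ((inner ℝ θ x) ^ 2 - l)) ≤ ∫ v, pert b l sg v x ∂(gaussAt b θ) := by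
  have := isProbabilityMeasure_gaussAt hb θ
  set s := ‖x‖ ^ 2 / b with hs
  set m := (inner ℝ θ x) ^ 2 with hm
  have icut : Integrable (fun v => cutLog (sg * ((inner ℝ v x) ^ 2 - s - l))) (gaussAt b θ) :=
    Integrable.of_bound (continuous_cutLog.comp (by fun_prop)).aestronglyMeasurable _
      (Filter.Eventually.of_forall fun v => abs_cutLog_le _)
  have icorr : Integrable (fun v => corr b v x) (gaussAt b θ) :=
    Integrable.of_bound
      ((continuous_corr b).comp (continuous_id.prodMk continuous_const)).aestronglyMeasurable
      (4 * Real.log 2) (Filter.Eventually.of_forall fun v => by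
        rw [Real.norm_of_nonneg (corr_nonneg hb _ x)]
        exact corr_le b _ x)
  have e : ∫ v, pert b l sg v x ∂(gaussAt b θ) =
      ∫ v, cutLog (sg * ((inner ℝ v x) ^ 2 - s - l)) ∂(gaussAt b θ) +
        ∫ v, corr b v x ∂(gaussAt b θ) := integral_add icut icorr
  have hA : psi (sg * (m - l)) - 3 / 16 * (4 * m * s + 2 * s ^ 2) ≤
      ∫ v, cutLog (sg * ((inner ℝ v x) ^ 2 - s - l)) ∂(gaussAt b θ) := by
    obtain ⟨p, hp⟩ := exists_parabola_le_cutLog (sg * (m - l))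
    have i2 := integrable_inner_pow_gaussAt hb θ x 2
    have i4 := integrable_inner_pow_gaussAt hb θ x 4
    have epar : ∀ v : EuclideanSpace ℝ (Fin d), psi (sg * (m - l)) +
        p * (sg * ((inner ℝ v x) ^ 2 - s - l) - sg * (m - l)) -
        3 / 16 * (sg * ((inner ℝ v x) ^ 2 - s - l) - sg * (m - l)) ^ 2 =
        (psi (sg * (m - l)) - p * sg * (s + m) - 3 / 16 * (s + m) ^ 2) +
          ((p * sg + 3 / 8 * (s + m)) * (inner ℝ v x) ^ 2 + (-3 / 16) * (inner ℝ v x) ^ 4) := by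
      intro v
      linear_combination (-3 / 16 * ((inner ℝ v x) ^ 2 - s - m) ^ 2) * hsg
    have hI := integral_mono (((integrable_const
        (psi (sg * (m - l)) - p * sg * (s + m) - 3 / 16 * (s + m) ^ 2)).fun_add
        ((i2.const_mul (p * sg + 3 / 8 * (s + m))).fun_add (i4.const_mul (-3 / 16)))))
        icut (fun v => (epar v).symm.le.trans (hp _))
    rw [integral_add (integrable_const _) ((i2.const_mul _).fun_add (i4.const_mul _)),
      integral_add (i2.const_mul _) (i4.const_mul _), integral_const_mul, integral_const_mul,
      integral_inner_sq_gaussAt hb, integral_inner_pow_four_gaussAt hb] at hI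
    simp only [integral_const, probReal_univ, one_smul] at hI
    refine le_trans (le_of_eq ?_) hI
    rw [← hs, show (inner ℝ θ x) ^ 4 = m ^ 2 by rw [hm]; ring, ← hm]
    ring
  have hB : psi (sg * (m - l)) - 2 * Real.log 2 ≤
      ∫ v, cutLog (sg * ((inner ℝ v x) ^ 2 - s - l)) ∂(gaussAt b θ) := by
    have hI := integral_mono (integrable_const (-Real.log 2)) icut
      (fun v => neg_log_two_le_cutLog _)
    simp only [integral_const, probReal_univ, one_smul] at hI
    linarith [(abs_le.1 (abs_psi_le (sg * (m - l)))).2]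
  have hC := le_integral_corr hb θ x
  rw [e]
  rcases min_le_iff.1 hC with h | h
  · linarith
  · linarith

lemma integral_pertBound_gauss {b : ℝ} (hb : 0 < b) (l sg : ℝ) (θ x : EuclideanSpace ℝ (Fin d)) :
    ∫ v, pertBound b l sg v x ∂(gaussAt b θ) =
      (l ^ 2 / 2 - sg * l) + (sg - l) * (inner ℝ θ x) ^ 2 + 1 / 2 * (inner ℝ θ x) ^ 4 +
        (2 + cc) / b * ((inner ℝ θ x) ^ 2 * ‖x‖ ^ 2) + (2 + 3 * cc) / (2 * b ^ 2) * ‖x‖ ^ 4 := by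
  have := isProbabilityMeasure_gaussAt hb θ
  have i2 := integrable_inner_pow_gaussAt hb θ x 2
  have i4 := integrable_inner_pow_gaussAt hb θ x 4
  set s := ‖x‖ ^ 2 / b with hs
  have e : ∀ v : EuclideanSpace ℝ (Fin d), pertBound b l sg v x =
      (-sg * (s + l) + (s + l) ^ 2 / 2 + cc * s ^ 2 / 2) +
        ((sg - (s + l) + cc * s) * (inner ℝ v x) ^ 2 + 1 / 2 * (inner ℝ v x) ^ 4) := by
    intro v
    rw [pertBound, ← hs]
    ring
  simp_rw [e]
  rw [integral_add (integrable_const _) ((i2.const_mul _).fun_add (i4.const_mul _)),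
      integral_add (i2.const_mul _) (i4.const_mul _), integral_const_mul, integral_const_mul,
      integral_inner_sq_gaussAt hb, integral_inner_pow_four_gaussAt hb]
  simp only [integral_const, probReal_univ, one_smul]
  rw [hs]
  field_simp
  ring

variable {P : Measure (EuclideanSpace ℝ (Fin d))} [IsProbabilityMeasure P]

lemma integrable_pertBound_prod {b : ℝ} (hb : 0 < b) (l sg : ℝ) (θ : EuclideanSpace ℝ (Fin d))
    (hP : Integrable (fun x => ‖x‖ ^ 4) P) :
    Integrable (fun z : EuclideanSpace ℝ (Fin d) × EuclideanSpace ℝ (Fin d) =>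
      pertBound b l sg z.1 z.2) ((gaussAt b θ).prod P) := by
  have := isProbabilityMeasure_gaussAt hb θ
  have g4 := integrable_norm_pow_four_gaussAt hb θ
  have g2 := integrable_norm_sq g4
  have p4 := hP
  have p2 := integrable_norm_sq hP
  have iW : Integrable (fun z : EuclideanSpace ℝ (Fin d) × EuclideanSpace ℝ (Fin d) =>
      (inner ℝ z.1 z.2) ^ 2) ((gaussAt b θ).prod P) := by
    refine (g2.mul_prod p2).mono' (by fun_prop) (Filter.Eventually.of_forall fun z => ?_)
    rw [Real.norm_of_nonneg (by positivity)]
    exact inner_sq_le _ _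
  have iW2 : Integrable (fun z : EuclideanSpace ℝ (Fin d) × EuclideanSpace ℝ (Fin d) =>
      (inner ℝ z.1 z.2) ^ 4) ((gaussAt b θ).prod P) := by
    refine (g4.mul_prod p4).mono' (by fun_prop) (Filter.Eventually.of_forall fun z => ?_)
    rw [Real.norm_of_nonneg (by positivity)]
    have := pow_le_pow_left₀ (sq_nonneg _) (inner_sq_le z.1 z.2) 2
    nlinarith
  have iWs : Integrable (fun z : EuclideanSpace ℝ (Fin d) × EuclideanSpace ℝ (Fin d) =>
      (inner ℝ z.1 z.2) ^ 2 * ‖z.2‖ ^ 2) ((gaussAt b θ).prod P) := by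
    refine (g2.mul_prod p4).mono' (by fun_prop) (Filter.Eventually.of_forall fun z => ?_)
    rw [Real.norm_of_nonneg (by positivity)]
    have := mul_le_mul_of_nonneg_right (inner_sq_le z.1 z.2) (sq_nonneg ‖z.2‖)
    nlinarith
  have is : Integrable (fun z : EuclideanSpace ℝ (Fin d) × EuclideanSpace ℝ (Fin d) =>
      ‖z.2‖ ^ 2) ((gaussAt b θ).prod P) := p2.comp_snd _
  have is2 : Integrable (fun z : EuclideanSpace ℝ (Fin d) × EuclideanSpace ℝ (Fin d) =>
      ‖z.2‖ ^ 4) ((gaussAt b θ).prod P) := p4.comp_snd _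
  refine (((((iW.const_mul (sg - l)).add (iW2.const_mul (1 / 2))).add
    (iWs.const_mul ((cc - 1) / b))).add (is.const_mul ((l - sg) / b))).add
    ((is2.const_mul ((1 + cc) / (2 * b ^ 2))).add (integrable_const (l ^ 2 / 2 - sg * l)))).congr
    (Filter.Eventually.of_forall fun z => ?_)
  simp only [Pi.add_apply, pertBound]
  field_simp
  ring

/-- The mean over the sample law and over the perturbation of the bound on the log-Laplace
transform, in terms of `N = 𝔼 ⟨θ, X⟩²`, `κ` and `S`. -/
lemma integral_integral_pertBound_le {b : ℝ} (hb : 0 < b) {l : ℝ} {sg : ℝ}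
    (θ : EuclideanSpace ℝ (Fin d)) (hP : Integrable (fun x => ‖x‖ ^ 4) P)
    {κ S : ℝ} (hκ : 0 < κ) (hS : 0 < S) (hSP : S ^ 2 = ∫ x, ‖x‖ ^ 4 ∂P)
    (h4 : ∫ x, (inner ℝ θ x) ^ 4 ∂P ≤ κ * secMom P θ ^ 2) :
    ∫ v, ∫ x, pertBound b l sg v x ∂P ∂(gaussAt b θ) ≤
      sg * (secMom P θ - l) + (κ * secMom P θ ^ 2 - 2 * l * secMom P θ + l ^ 2) / 2 +
        (2 + cc) * √κ * S / b * secMom P θ + (2 + 3 * cc) * S ^ 2 / (2 * b ^ 2) := by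
  have := isProbabilityMeasure_gaussAt hb θ
  have hc := cc_pos
  rw [integral_integral_swap (integrable_pertBound_prod hb l sg θ hP)]
  simp_rw [integral_pertBound_gauss hb]
  have i1 := integrable_inner_sq hP θ
  have i2 := integrable_inner_pow_four hP θ
  have i3 := integrable_inner_sq_mul_norm_sq hP θ
  rw [integral_add ((((integrable_const _).fun_add (i1.const_mul _)).fun_add
      (i2.const_mul _)).fun_add (i3.const_mul _)) (hP.const_mul _),
    integral_add (((integrable_const _).fun_add (i1.const_mul _)).fun_add
      (i2.const_mul _)) (i3.const_mul _),
    integral_add ((integrable_const _).fun_add (i1.const_mul _)) (i2.const_mul _),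
    integral_add (integrable_const _) (i1.const_mul _), integral_const_mul, integral_const_mul,
    integral_const_mul, integral_const_mul, ← hSP]
  have h5 := integral_inner_sq_mul_norm_sq_le hP hκ hS hSP θ h4
  have h6 : (2 + cc) / b * ∫ x, (inner ℝ θ x) ^ 2 * ‖x‖ ^ 2 ∂P ≤
      (2 + cc) / b * (√κ * secMom P θ * S) := by gcongr
  simp only [integral_const, probReal_univ, one_smul]
  have e1 : (2 + cc) / b * (√κ * secMom P θ * S) = (2 + cc) * √κ * S / b * secMom P θ := by ring
  have e2 : (2 + 3 * cc) / (2 * b ^ 2) * S ^ 2 = (2 + 3 * cc) * S ^ 2 / (2 * b ^ 2) := by ring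
  have e3 : ∫ x, (inner ℝ θ x) ^ 2 ∂P = secMom P θ := rfl
  rw [e3]
  nlinarith

end Smoothing

section PACBayes

variable {T E : Type*} [MeasurableSpace T] [MeasurableSpace E]

/-- The exponential deviation inequality behind PAC-Bayes bounds: with probability at least
`1 - τ` over an i.i.d. sample, the average over a prior of the exponential of the centred empirical
sums is at most `1 / τ`. -/
lemma exists_event_integral_exp_le (ρ : Measure T) [IsProbabilityMeasure ρ]
    (P : Measure E) [IsProbabilityMeasure P] (n : ℕ) (f : T → E → ℝ)
    (hf : Measurable fun z : T × E => f z.1 z.2) (C : ℝ) (hC : ∀ t x, |f t x| ≤ C)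
    {τ : ℝ} (hτ : 0 < τ) :
    ∃ A : Set (Fin n → E), MeasurableSet A ∧
      (Measure.pi fun _ => P) Aᶜ ≤ ENNReal.ofReal τ ∧
      ∀ x ∈ A, 0 < ∫ t, Real.exp (∑ i, f t (x i) -
          n * Real.log (∫ y, Real.exp (f t y) ∂P)) ∂ρ ∧
        ∫ t, Real.exp (∑ i, f t (x i) -
          n * Real.log (∫ y, Real.exp (f t y) ∂P)) ∂ρ ≤ 1 / τ := by
  set L : T → ℝ := fun t => Real.log (∫ y, Real.exp (f t y) ∂P) with hL
  have hexpm : Measurable fun z : T × E => Real.exp (f z.1 z.2) := hf.exp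
  have hLm : Measurable L :=
    (hexpm.stronglyMeasurable.integral_prod_right' (ν := P)).measurable.log
  have hie : ∀ t, Integrable (fun y => Real.exp (f t y)) P := fun t =>
    Integrable.of_bound (hexpm.comp measurable_prodMk_left).aestronglyMeasurable (Real.exp C)
      (Filter.Eventually.of_forall fun y => by
        rw [Real.norm_of_nonneg (Real.exp_pos _).le]
        exact Real.exp_le_exp.2 ((le_abs_self _).trans (hC t y)))
  have hpos : ∀ t, 0 < ∫ y, Real.exp (f t y) ∂P := fun t => integral_exp_pos (hie t)
  have hexpL : ∀ t, Real.exp (L t) = ∫ y, Real.exp (f t y) ∂P := fun t => Real.exp_log (hpos t)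
  have hLlow : ∀ t, -C ≤ L t := by
    intro t
    rw [hL, Real.le_log_iff_exp_le (hpos t)]
    have := integral_mono (integrable_const (Real.exp (-C))) (hie t)
      (fun y => Real.exp_le_exp.2 (neg_le_of_abs_le (hC t y)))
    simpa using this
  set Φ : (Fin n → E) → T → ℝ := fun x t => Real.exp (∑ i, f t (x i) - n * L t) with hΦ
  have hΦm : Measurable fun z : (Fin n → E) × T => Φ z.1 z.2 := by
    refine Measurable.exp (Measurable.sub ?_ ?_)
    · refine Finset.measurable_fun_sum _ fun i _ => ?_
      exact hf.comp (measurable_snd.prodMk ((measurable_pi_apply i).comp measurable_fst))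
    · exact (hLm.comp measurable_snd).const_mul _
  have hΦb : ∀ x t, Φ x t ≤ Real.exp (n * C + n * C) := by
    intro x t
    refine Real.exp_le_exp.2 ?_
    have h1 : ∑ i, f t (x i) ≤ n * C := by
      calc ∑ i, f t (x i) ≤ ∑ _i : Fin n, C :=
            Finset.sum_le_sum fun i _ => (le_abs_self _).trans (hC t _)
        _ = n * C := by simp
    have h2 : -(n * L t) ≤ n * C := by
      have := mul_le_mul_of_nonneg_left (hLlow t) (Nat.cast_nonneg (α := ℝ) n)
      linarith
    linarith
  have hΦi : Integrable (fun z : (Fin n → E) × T => Φ z.1 z.2)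
      ((Measure.pi fun _ => P).prod ρ) :=
    Integrable.of_bound hΦm.aestronglyMeasurable (Real.exp (n * C + n * C))
      (Filter.Eventually.of_forall fun z => by
        rw [Real.norm_of_nonneg (Real.exp_pos _).le]
        exact hΦb z.1 z.2)
  set Z : (Fin n → E) → ℝ := fun x => ∫ t, Φ x t ∂ρ with hZ
  have hZm : Measurable Z := (hΦm.stronglyMeasurable.integral_prod_right' (ν := ρ)).measurable
  have hZi : Integrable Z (Measure.pi fun _ => P) := hΦi.integral_prod_left
  have hZpos : ∀ x, 0 < Z x := fun x => integral_exp_pos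
    (Integrable.of_bound (hΦm.comp measurable_prodMk_left).aestronglyMeasurable
      (Real.exp (n * C + n * C)) (Filter.Eventually.of_forall fun t => by
        rw [Real.norm_of_nonneg (Real.exp_pos _).le]
        exact hΦb x t))
  have hZ1 : ∫ x, Z x ∂(Measure.pi fun _ => P) = 1 := by
    rw [hZ, integral_integral_swap hΦi]
    have : ∀ t, ∫ x, Φ x t ∂(Measure.pi fun _ => P) = 1 := by
      intro t
      have e : ∀ x : Fin n → E, Φ x t = ∏ i, (Real.exp (f t (x i)) * Real.exp (-L t)) := by
        intro x
        rw [Finset.prod_mul_distrib, ← Real.exp_sum, Finset.prod_const, ← Real.exp_nat_mul,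
          ← Real.exp_add, hΦ]
        simp only [Finset.card_univ, Fintype.card_fin]
        ring_nf
      simp_rw [e]
      rw [integral_fintype_prod_eq_prod
        (fun (_ : Fin n) (y : E) => Real.exp (f t y) * Real.exp (-L t))]
      refine Finset.prod_eq_one fun i _ => ?_
      rw [integral_mul_const, ← hexpL, ← Real.exp_add, add_neg_cancel, Real.exp_zero]
    simp [this]
  refine ⟨{x | Z x < 1 / τ}, measurableSet_lt hZm measurable_const, ?_, fun x hx => ⟨hZpos x, hx.le⟩⟩
  have hM := mul_meas_ge_le_integral_of_nonneg
    (Filter.Eventually.of_forall fun x => (hZpos x).le) hZi (1 / τ)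
  rw [hZ1] at hM
  have hset : {x | Z x < 1 / τ}ᶜ = {x | 1 / τ ≤ Z x} := by
    ext x
    simp
  rw [hset, ← ofReal_measureReal]
  refine ENNReal.ofReal_le_ofReal ?_
  rwa [one_div_mul_eq_div, div_le_one hτ] at hM

end PACBayes

/-! ### The event of large probability -/

section Event

variable {d : ℕ} {P : Measure (EuclideanSpace ℝ (Fin d))} [IsProbabilityMeasure P]

/-- The log-Laplace transform of the perturbed influence. -/
def logLap (P : Measure (EuclideanSpace ℝ (Fin d))) (b l sg : ℝ)
    (v : EuclideanSpace ℝ (Fin d)) : ℝ :=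
  Real.log (∫ y, Real.exp (pert b l sg v y) ∂P)

lemma integrable_exp_pert {b : ℝ} (hb : 0 < b) (l sg : ℝ) (v : EuclideanSpace ℝ (Fin d)) :
    Integrable (fun y => Real.exp (pert b l sg v y)) P :=
  Integrable.of_bound ((continuous_pert b l sg).measurable.comp
    measurable_prodMk_left).exp.aestronglyMeasurable (Real.exp (1 + 5 * Real.log 2))
    (Filter.Eventually.of_forall fun y => by
      rw [Real.norm_of_nonneg (Real.exp_pos _).le]
      exact Real.exp_le_exp.2 ((le_abs_self _).trans (abs_pert_le hb l sg v y)))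

lemma measurable_pert (b l sg : ℝ) (y : EuclideanSpace ℝ (Fin d)) :
    Measurable fun v => pert b l sg v y :=
  ((continuous_pert b l sg).comp (continuous_id.prodMk continuous_const)).measurable

lemma integrable_pert {b : ℝ} (hb : 0 < b) (l sg : ℝ) (θ y : EuclideanSpace ℝ (Fin d)) :
    Integrable (fun v => pert b l sg v y) (gaussAt b θ) :=
  have := isProbabilityMeasure_gaussAt hb θ
  Integrable.of_bound (measurable_pert b l sg y).aestronglyMeasurable (1 + 5 * Real.log 2)
    (Filter.Eventually.of_forall fun v => abs_pert_le hb l sg v y)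

lemma integral_exp_pert_pos {b : ℝ} (hb : 0 < b) (l sg : ℝ) (v : EuclideanSpace ℝ (Fin d)) :
    0 < ∫ y, Real.exp (pert b l sg v y) ∂P :=
  integral_exp_pos (integrable_exp_pert hb l sg v)

lemma measurable_logLap (b l sg : ℝ) : Measurable (logLap P b l sg) :=
  ((continuous_pert b l sg).measurable.exp.stronglyMeasurable.integral_prod_right'
    (ν := P)).measurable.log

lemma abs_logLap_le {b : ℝ} (hb : 0 < b) (l sg : ℝ) (v : EuclideanSpace ℝ (Fin d)) :
    |logLap P b l sg v| ≤ 1 + 5 * Real.log 2 := by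
  have hpos := integral_exp_pert_pos (P := P) hb l sg v
  rw [abs_le, logLap]
  constructor
  · rw [Real.le_log_iff_exp_le hpos]
    have := integral_mono (integrable_const (Real.exp (-(1 + 5 * Real.log 2))))
      (integrable_exp_pert (P := P) hb l sg v)
      (fun y => Real.exp_le_exp.2 (neg_le_of_abs_le (abs_pert_le hb l sg v y)))
    simpa using this
  · rw [Real.log_le_iff_le_exp hpos]
    have := integral_mono (integrable_exp_pert (P := P) hb l sg v)
      (integrable_const (Real.exp (1 + 5 * Real.log 2)))
      (fun y => Real.exp_le_exp.2 ((le_abs_self _).trans (abs_pert_le hb l sg v y)))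
    simpa using this

lemma integrable_logLap {b : ℝ} (hb : 0 < b) (l sg : ℝ) (θ : EuclideanSpace ℝ (Fin d)) :
    Integrable (logLap P b l sg) (gaussAt b θ) :=
  have := isProbabilityMeasure_gaussAt hb θ
  Integrable.of_bound (measurable_logLap b l sg).aestronglyMeasurable (1 + 5 * Real.log 2)
    (Filter.Eventually.of_forall (abs_logLap_le hb l sg))

lemma integral_logLap_le {b : ℝ} (hb : 0 < b) (l : ℝ) {sg : ℝ} (hsg : sg ^ 2 = 1)
    (hP : Integrable (fun x => ‖x‖ ^ 4) P) (θ : EuclideanSpace ℝ (Fin d)) :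
    ∫ v, logLap P b l sg v ∂(gaussAt b θ) ≤
      ∫ v, ∫ y, pertBound b l sg v y ∂P ∂(gaussAt b θ) := by
  have := isProbabilityMeasure_gaussAt hb θ
  have hip := integrable_pertBound_prod hb l sg θ hP
  refine integral_mono_ae (integrable_logLap hb l sg θ) hip.integral_prod_left ?_
  filter_upwards [hip.prod_right_ae] with v hv
  have h1 : logLap P b l sg v ≤ (∫ y, Real.exp (pert b l sg v y) ∂P) - 1 :=
    Real.log_le_sub_one_of_pos (integral_exp_pert_pos hb l sg v)
  have h2 := integral_mono (integrable_exp_pert (P := P) hb l sg v)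
    ((integrable_const 1).fun_add hv) (fun y => exp_pert_le hb l hsg v y)
  rw [integral_add (integrable_const 1) hv] at h2
  simp only [integral_const, probReal_univ, one_smul] at h2
  linarith

/-- The entropy bound for the centred empirical sums, under the Gaussian law with mean `θ`. -/
lemma sum_integral_pert_le {n : ℕ} {b : ℝ} (hb : 0 < b) (l sg : ℝ)
    (x : Fin n → EuclideanSpace ℝ (Fin d)) (θ : EuclideanSpace ℝ (Fin d)) :
    ∑ i, ∫ v, pert b l sg v (x i) ∂(gaussAt b θ) - n * ∫ v, logLap P b l sg v ∂(gaussAt b θ) ≤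
      Real.log (∫ v, Real.exp (∑ i, pert b l sg v (x i) - n * logLap P b l sg v) ∂(gaussAt b 0)) +
        b * ‖θ‖ ^ 2 / 2 := by
  have hm : Measurable fun v => ∑ i, pert b l sg v (x i) - n * logLap P b l sg v := by
    refine Measurable.sub (Finset.measurable_fun_sum _ fun i _ => ?_)
      ((measurable_logLap b l sg).const_mul _)
    exact measurable_pert b l sg (x i)
  have hbound : ∀ v, |∑ i, pert b l sg v (x i) - n * logLap P b l sg v| ≤
      n * (1 + 5 * Real.log 2) + n * (1 + 5 * Real.log 2) := by
    intro v
    refine (abs_sub _ _).trans (add_le_add ?_ ?_)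
    · refine (Finset.abs_sum_le_sum_abs _ _).trans ?_
      calc _ ≤ ∑ _i : Fin n, (1 + 5 * Real.log 2) :=
            Finset.sum_le_sum fun i _ => abs_pert_le hb l sg v (x i)
        _ = n * (1 + 5 * Real.log 2) := by
          rw [Finset.sum_const, Finset.card_univ, Fintype.card_fin, nsmul_eq_mul]
    · rw [abs_mul, Nat.abs_cast]
      exact mul_le_mul_of_nonneg_left (abs_logLap_le hb l sg v) (Nat.cast_nonneg n)
  have hDV := integral_gaussAt_le_log hb θ _ hm _ hbound
  rwa [integral_sub (integrable_finsetSum _ fun i _ => integrable_pert hb l sg θ (x i))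
    ((integrable_logLap hb l sg θ).const_mul _),
    integral_finsetSum _ fun i _ => integrable_pert hb l sg θ (x i), integral_const_mul] at hDV

/-- A bound on one side of the empirical influence, uniform in `θ`, for one value of the parameters:
the Gaussian perturbation turns it into a PAC-Bayes bound with prior centred at `0`. -/
lemma exists_event_rEmp_le {n : ℕ} (hn : 0 < n) {b : ℝ} (hb : 0 < b) {l : ℝ} {sg : ℝ}
    (hsg : sg = 1 ∨ sg = -1) (hP : Integrable (fun x => ‖x‖ ^ 4) P)
    {κ S : ℝ} (hκ : 0 < κ) (hS : 0 < S) (hSP : S ^ 2 = ∫ x, ‖x‖ ^ 4 ∂P)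
    (h4 : ∀ θ : EuclideanSpace ℝ (Fin d), ∫ x, (inner ℝ θ x) ^ 4 ∂P ≤ κ * secMom P θ ^ 2)
    {τ : ℝ} (hτ : 0 < τ) :
    ∃ A : Set (Fin n → EuclideanSpace ℝ (Fin d)), MeasurableSet A ∧
      (Measure.pi fun _ => P) Aᶜ ≤ ENNReal.ofReal τ ∧
      ∀ x ∈ A, ∀ θ : EuclideanSpace ℝ (Fin d), sg * rEmp x l θ ≤
        sg * (secMom P θ - l) + (κ * secMom P θ ^ 2 - 2 * l * secMom P θ + l ^ 2) / 2 +
        (2 + cc) * √κ * S / b * secMom P θ + (2 + 3 * cc) * S ^ 2 / (2 * b ^ 2) +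
        b / (2 * n) * ‖θ‖ ^ 2 + Real.log (1 / τ) / n := by
  have hsg2 : sg ^ 2 = 1 := by rcases hsg with h | h <;> simp [h]
  have hn' : (0 : ℝ) < n := by exact_mod_cast hn
  have := isProbabilityMeasure_gaussAt hb (0 : EuclideanSpace ℝ (Fin d))
  obtain ⟨A, hA, hPA, hx⟩ := exists_event_integral_exp_le (gaussAt b 0) P n
    (pert b l sg) (continuous_pert b l sg).measurable _ (abs_pert_le hb l sg) hτ
  refine ⟨A, hA, hPA, fun x hxA θ => ?_⟩
  obtain ⟨hpos, hle⟩ := hx x hxA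
  have hlog := Real.log_le_log hpos hle
  have hDV : ∑ i, ∫ v, pert b l sg v (x i) ∂(gaussAt b θ) -
      n * ∫ v, logLap P b l sg v ∂(gaussAt b θ) ≤ Real.log (1 / τ) + b * ‖θ‖ ^ 2 / 2 :=
    (sum_integral_pert_le hb l sg x θ).trans (by simpa only [logLap] using add_le_add_left hlog _)
  have hpsi : ∑ i, psi (sg * ((inner ℝ θ (x i)) ^ 2 - l)) ≤
      ∑ i, ∫ v, pert b l sg v (x i) ∂(gaussAt b θ) :=
    Finset.sum_le_sum fun i _ => psi_le_integral_pert hb l hsg2 θ (x i)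
  have hfin := (integral_logLap_le hb l hsg2 hP θ).trans
    (integral_integral_pertBound_le hb (l := l) (sg := sg) θ hP hκ hS hSP (h4 θ))
  have hr : sg * rEmp x l θ = (n : ℝ)⁻¹ * ∑ i, psi (sg * ((inner ℝ θ (x i)) ^ 2 - l)) := by
    rw [rEmp, mul_left_comm, Finset.mul_sum]
    congr 1
    refine Finset.sum_congr rfl fun i _ => ?_
    rcases hsg with h | h
    · simp [h]
    · simp only [h, neg_mul, one_mul, psi_neg]
  generalize ∫ v, logLap P b l sg v ∂(gaussAt b θ) = I at hDV hfin
  rw [hr]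
  calc _ ≤ (n : ℝ)⁻¹ * (n * I + Real.log (1 / τ) + b * ‖θ‖ ^ 2 / 2) := by
        gcongr
        linarith
    _ = I + b / (2 * n) * ‖θ‖ ^ 2 + Real.log (1 / τ) / n := by
      field_simp
      ring
    _ ≤ _ := by linarith

/-- The two-sided comparison, at the parameters `(l, β)`, between the empirical influence of the
sample `x` and its population counterpart, uniformly in `θ`. -/
def InfluenceBounds {n : ℕ} (P : Measure (EuclideanSpace ℝ (Fin d))) (κ S ε a l β : ℝ)
    (x : Fin n → EuclideanSpace ℝ (Fin d)) : Prop :=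
  ∀ θ : EuclideanSpace ℝ (Fin d),
    rEmp x l θ ≤ κ / 2 * (secMom P θ - l) ^ 2 + (1 + muCoef κ S l β) * (secMom P θ - l) +
      gammaCoef n κ S ε a l β * l + β / (2 * n) * ‖θ‖ ^ 2 ∧
    -(κ / 2) * (secMom P θ - l) ^ 2 + (1 - muCoef κ S l β) * (secMom P θ - l) -
      gammaCoef n κ S ε a l β * l - β / (2 * n) * ‖θ‖ ^ 2 ≤ rEmp x l θ

lemma gridSize_pos (n : ℕ) (κ a : ℝ) : 0 < gridSize n κ a := by
  unfold gridSize
  omega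

lemma log_gridSize_pos {n : ℕ} {κ a ε : ℝ} (hε : 0 < ε) (hε1 : ε < 1) :
    0 < Real.log (gridSize n κ a / ε) := by
  refine Real.log_pos ?_
  rw [lt_div_iff₀ hε, one_mul]
  refine hε1.trans_le ?_
  exact_mod_cast gridSize_pos n κ a

lemma gridL_pos {n : ℕ} {κ S ε a t : ℝ} (hn : 0 < n) (hκ : 1 < κ) (hS : 0 < S) (hε : 0 < ε)
    (hε1 : ε < 1) (ht : 0 < t) : 0 < gridL n κ S ε a t := by
  have h1 := log_gridSize_pos (n := n) (κ := κ) (a := a) hε hε1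
  have hn' : (0 : ℝ) < n := by exact_mod_cast hn
  have hc := cc_pos
  have : 0 < κ - 1 := by linarith
  have : 0 < √κ := Real.sqrt_pos.2 (by linarith)
  refine Real.sqrt_pos.2 ?_
  positivity

lemma gridBeta_pos {n : ℕ} {κ S t : ℝ} (hn : 0 < n) (hκ : 1 < κ) (hS : 0 < S) (ht : 0 < t) :
    0 < gridBeta n κ S t := by
  have hn' : (0 : ℝ) < n := by exact_mod_cast hn
  have hc := cc_pos
  have : 0 < √κ := Real.sqrt_pos.2 (by linarith)
  refine Real.sqrt_pos.2 ?_
  positivity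

lemma gridT_pos {S a : ℝ} (hS : 0 < S) (j : ℕ) : 0 < gridT S a j :=
  mul_pos hS (Real.exp_pos _)

/-- The two-sided bounds hold simultaneously on the whole grid with probability `1 - 2 ε`. -/
lemma exists_event_influenceBounds {n : ℕ} (hn : 0 < n) (hP : Integrable (fun x => ‖x‖ ^ 4) P)
    {κ S ε a : ℝ} (hκ : 1 < κ) (hS : 0 < S) (hSP : S ^ 2 = ∫ x, ‖x‖ ^ 4 ∂P)
    (hε : 0 < ε) (hε1 : ε < 1)
    (h4 : ∀ θ : EuclideanSpace ℝ (Fin d), ∫ x, (inner ℝ θ x) ^ 4 ∂P ≤ κ * secMom P θ ^ 2) :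
    ∃ A : Set (Fin n → EuclideanSpace ℝ (Fin d)), MeasurableSet A ∧
      ENNReal.ofReal (1 - 2 * ε) ≤ (Measure.pi fun _ => P) A ∧
      ∀ x ∈ A, ∀ j < gridSize n κ a, InfluenceBounds P κ S ε a (gridL n κ S ε a (gridT S a j))
        (gridBeta n κ S (gridT S a j)) x := by
  set K := gridSize n κ a with hK
  have hKpos : (0 : ℝ) < K := by exact_mod_cast gridSize_pos n κ a
  have hτ : 0 < ε / K := by positivity
  have hn' : (0 : ℝ) < n := by exact_mod_cast hn
  have hT := fun j => gridT_pos (a := a) hS j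
  have hβ := fun j => gridBeta_pos hn hκ hS (hT j)
  have hl := fun j => gridL_pos (a := a) hn hκ hS hε hε1 (hT j)
  choose Ap hAp hPAp hxp using fun j => exists_event_rEmp_le (P := P) hn (hβ j)
    (l := gridL n κ S ε a (gridT S a j)) (sg := 1) (Or.inl rfl) hP (by linarith) hS hSP h4 hτ
  choose Am hAm hPAm hxm using fun j => exists_event_rEmp_le (P := P) hn (hβ j)
    (l := gridL n κ S ε a (gridT S a j)) (sg := -1) (Or.inr rfl) hP (by linarith) hS hSP h4 hτ
  set A : Set (Fin n → EuclideanSpace ℝ (Fin d)) := ⋂ j ∈ Finset.range K, (Ap j ∩ Am j) with hA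
  have hAmeas : MeasurableSet A :=
    Finset.measurableSet_biInter _ fun j _ => (hAp j).inter (hAm j)
  refine ⟨A, hAmeas, ?_, ?_⟩
  · have hcompl : (Measure.pi fun _ => P) Aᶜ ≤ ENNReal.ofReal (2 * ε) := by
      have e : Aᶜ = ⋃ j ∈ Finset.range K, (Ap j ∩ Am j)ᶜ := by
        simp only [hA, Set.compl_iInter]
      rw [e]
      refine (measure_biUnion_finset_le _ _).trans ?_
      calc _ ≤ ∑ _j ∈ Finset.range K, ENNReal.ofReal (2 * (ε / K)) := by
            refine Finset.sum_le_sum fun j _ => ?_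
            rw [Set.compl_inter, two_mul, ENNReal.ofReal_add hτ.le hτ.le]
            exact (measure_union_le _ _).trans (add_le_add (hPAp j) (hPAm j))
        _ = ENNReal.ofReal (2 * ε) := by
            rw [← ENNReal.ofReal_sum_of_nonneg (fun _ _ => by positivity)]
            congr 1
            simp
            field_simp
    have h1 := prob_compl_eq_one_sub (μ := Measure.pi fun _ => P) hAmeas.compl
    rw [compl_compl] at h1
    rw [h1, ENNReal.ofReal_sub _ (by positivity), ENNReal.ofReal_one]
    exact tsub_le_tsub_left hcompl 1
  · intro x hx j hj θ
    have hxj : x ∈ Ap j ∩ Am j := by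
      have := Set.mem_iInter₂.1 hx j (Finset.mem_range.2 hj)
      exact this
    have hp := hxp j x hxj.1 θ
    have hm := hxm j x hxj.2 θ
    have hl' := hl j
    have e1 : (1 : ℝ) / (ε / K) = K / ε := by field_simp
    rw [e1] at hp hm
    set l := gridL n κ S ε a (gridT S a j)
    set β := gridBeta n κ S (gridT S a j)
    have eγ : gammaCoef n κ S ε a l β * l = l ^ 2 * (κ - 1) / 2 + (2 + cc) * √κ * S / β * l +
        (2 + 3 * cc) * S ^ 2 / (2 * β ^ 2) + Real.log (K / ε) / n := by
      rw [gammaCoef, ← hK]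
      field_simp
    rw [eγ, muCoef]
    constructor
    · refine (le_of_eq (one_mul _).symm).trans (hp.trans (le_of_eq ?_))
      ring
    · have : rEmp x l θ = -(-1 * rEmp x l θ) := by ring
      rw [this]
      refine le_trans (le_of_eq ?_) (neg_le_neg hm)
      ring

end Event

/-- Transfer of an event on the sample space to the underlying probability space. -/
lemma exists_measurableSet_of_sample {d : ℕ}
    {P : Measure (EuclideanSpace ℝ (Fin d))} {Ω : Type*} [MeasurableSpace Ω] {μ : Measure Ω}
    [IsProbabilityMeasure μ] {n : ℕ} {X : Fin n → Ω → EuclideanSpace ℝ (Fin d)}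
    (hlaw : ∀ i, HasLaw (X i) P μ) (hindep : iIndepFun X μ)
    {A : Set (Fin n → EuclideanSpace ℝ (Fin d))} (hA : MeasurableSet A) :
    ∃ B : Set Ω, MeasurableSet B ∧ μ B = (Measure.pi fun _ => P) A ∧
      ∀ ω ∈ B, (fun i => X i ω) ∈ A := by
  have hX : ∀ i, AEMeasurable (X i) μ := fun i => (hlaw i).aemeasurable
  have hXm : AEMeasurable (fun ω i => X i ω) μ := aemeasurable_pi_lambda _ hX
  have hmap : μ.map (fun ω i => X i ω) = Measure.pi fun _ => P := by
    rw [(iIndepFun_iff_map_fun_eq_pi_map hX).1 hindep]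
    simp_rw [(hlaw _).map_eq]
  have hnull : NullMeasurableSet ((fun ω i => X i ω) ⁻¹' A) μ := hXm.nullMeasurable hA
  obtain ⟨B, hBsub, hB, hBae⟩ := hnull.exists_measurable_subset_ae_eq
  refine ⟨B, hB, ?_, fun ω hω => hBsub hω⟩
  rw [measure_congr hBae, ← hmap, Measure.map_apply_of_aemeasurable hXm hA]

/-! ### From the empirical criterion to a confidence interval -/

section Preliminary

variable {d n : ℕ}

lemma psi_neg_of_pos {l : ℝ} (hl : 0 < l) : psi (-l) < 0 := by
  set s := min l 1 with hs
  have hs0 : 0 < s := lt_min hl one_pos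
  have hs1 : s ≤ 1 := min_le_right _ _
  have h1 : psi (-l) ≤ psi (-s) := monotone_psi (neg_le_neg (min_le_left _ _))
  have h2 : logQuad (-s) < 0 := Real.log_neg (quad_pos _) (by nlinarith)
  exact (h1.trans (psi_le_logQuad _)).trans_lt h2

lemma rEmp_smul (x : Fin n → EuclideanSpace ℝ (Fin d)) (l : ℝ) (θ : EuclideanSpace ℝ (Fin d))
    (α : ℝ) : rEmp x l (α • θ) = (n : ℝ)⁻¹ * ∑ i, psi (α ^ 2 * (inner ℝ θ (x i)) ^ 2 - l) := by
  simp only [rEmp, inner_smul_left, mul_pow]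
  simp

lemma rEmp_smul_mono (x : Fin n → EuclideanSpace ℝ (Fin d)) (l : ℝ)
    (θ : EuclideanSpace ℝ (Fin d)) {α α' : ℝ} (h0 : 0 ≤ α) (h : α ≤ α') :
    rEmp x l (α • θ) ≤ rEmp x l (α' • θ) := by
  rw [rEmp_smul, rEmp_smul]
  refine mul_le_mul_of_nonneg_left (Finset.sum_le_sum fun i _ => monotone_psi ?_) (by positivity)
  gcongr

lemma continuous_rEmp_smul (x : Fin n → EuclideanSpace ℝ (Fin d)) (l : ℝ)
    (θ : EuclideanSpace ℝ (Fin d)) : Continuous fun α : ℝ => rEmp x l (α • θ) := by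
  simp_rw [rEmp_smul]
  refine continuous_const.mul (continuous_finsetSum _ fun i _ => continuous_psi.comp ?_)
  fun_prop

lemma rEmp_zero_neg (hn : 0 < n) (x : Fin n → EuclideanSpace ℝ (Fin d)) {l : ℝ} (hl : 0 < l)
    (θ : EuclideanSpace ℝ (Fin d)) : rEmp x l ((0 : ℝ) • θ) < 0 := by
  have hn' : (0 : ℝ) < n := by exact_mod_cast hn
  rw [rEmp_smul]
  simp only [ne_eq, OfNat.ofNat_ne_zero, not_false_eq_true, zero_pow, zero_mul, zero_sub,
    Finset.sum_const, Finset.card_univ, Fintype.card_fin, nsmul_eq_mul]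
  rw [inv_mul_cancel_left₀ hn'.ne']
  exact psi_neg_of_pos hl

/-- Below the root `α̂` the empirical influence is nonpositive; the condition `α < α̂` is written
`α² Ñ < l`, which is also correct when `α̂ = ∞`. -/
lemma rEmp_nonpos_of_lt (hn : 0 < n) (x : Fin n → EuclideanSpace ℝ (Fin d)) {l : ℝ} (hl : 0 < l)
    (θ : EuclideanSpace ℝ (Fin d)) {α : ℝ} (hα : 0 ≤ α) (h : α ^ 2 * nTilde x l θ < l) :
    rEmp x l (α • θ) ≤ 0 := by
  by_contra! hpos
  set s := {α : ℝ | 0 ≤ α ∧ rEmp x l (α • θ) ≤ 0} with hs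
  have h0s : (0 : ℝ) ∈ s := ⟨le_rfl, (rEmp_zero_neg hn x hl θ).le⟩
  have hub : ∀ a ∈ s, a ≤ α := by
    intro a ha
    by_contra! hlt
    exact absurd ha.2 (not_le.2 (hpos.trans_le (rEmp_smul_mono x l θ hα hlt.le)))
  have hbdd : BddAbove s := ⟨α, hub⟩
  have hle : sSup s ≤ α := csSup_le ⟨0, h0s⟩ hub
  have hspos : 0 < sSup s := by
    -- the influence is still negative slightly to the right of `0`
    have hev : ∀ᶠ a in nhdsWithin (0 : ℝ) (Set.Ioi 0), rEmp x l (a • θ) < 0 :=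
      ((continuous_rEmp_smul x l θ).tendsto 0).eventually_lt_const (rEmp_zero_neg hn x hl θ)
        |>.filter_mono nhdsWithin_le_nhds
    obtain ⟨a, ha, ha0⟩ := (hev.and self_mem_nhdsWithin).exists
    exact (show (0 : ℝ) < a from ha0).trans_le (le_csSup hbdd ⟨(show (0 : ℝ) < a from ha0).le, ha.le⟩)
  have e : nTilde x l θ = l / (sSup s) ^ 2 := rfl
  rw [e, mul_div_assoc', div_lt_iff₀ (by positivity)] at h
  have : sSup s ^ 2 ≤ α ^ 2 := by gcongr
  nlinarith

/-- At the root `α̂ < ∞` the empirical influence is nonnegative. -/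
lemma exists_root_of_nTilde_pos (x : Fin n → EuclideanSpace ℝ (Fin d)) {l : ℝ} (hl : 0 < l)
    (θ : EuclideanSpace ℝ (Fin d)) (h : 0 < nTilde x l θ) :
    ∃ α : ℝ, 0 < α ∧ α ^ 2 * nTilde x l θ = l ∧ 0 ≤ rEmp x l (α • θ) := by
  set s := {α : ℝ | 0 ≤ α ∧ rEmp x l (α • θ) ≤ 0} with hs
  have e : nTilde x l θ = l / (sSup s) ^ 2 := rfl
  have hne : sSup s ≠ 0 := by
    intro h0
    rw [e, h0] at h
    simp at h
  have hbdd : BddAbove s := by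
    by_contra hb
    exact hne (Real.sSup_of_not_bddAbove hb)
  have hpos : 0 < sSup s := lt_of_le_of_ne (Real.sSup_nonneg fun a ha => ha.1) hne.symm
  refine ⟨sSup s, hpos, ?_, ?_⟩
  · rw [e]
    field_simp
  · have ht : Filter.Tendsto (fun a : ℝ => rEmp x l (a • θ)) (nhdsWithin (sSup s) (Set.Ioi (sSup s)))
        (nhds (rEmp x l (sSup s • θ))) :=
      ((continuous_rEmp_smul x l θ).tendsto _).mono_left nhdsWithin_le_nhds
    refine ge_of_tendsto ht ?_
    filter_upwards [self_mem_nhdsWithin] with a ha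
    by_contra! hlt
    exact absurd (le_csSup hbdd ⟨(hpos.trans ha).le, hlt.le⟩) (not_le.2 ha)

lemma nTilde_nonneg (x : Fin n → EuclideanSpace ℝ (Fin d)) {l : ℝ} (hl : 0 ≤ l)
    (θ : EuclideanSpace ℝ (Fin d)) : 0 ≤ nTilde x l θ :=
  div_nonneg hl (sq_nonneg _)

end Preliminary

section Interval

variable {d n : ℕ} {P : Measure (EuclideanSpace ℝ (Fin d))}
  {κ S ε a l β : ℝ} {x : Fin n → EuclideanSpace ℝ (Fin d)} {θ : EuclideanSpace ℝ (Fin d)}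

/-- The lower bound for the influence, at the scale where the second moment is `l (1 + t)`. -/
lemma lower_parabola (hn : 0 < n) (hl : 0 < l) (hE : InfluenceBounds P κ S ε a l β x)
    (hθ : ‖θ‖ = 1) {t : ℝ} (ht : 0 ≤ t) (hlt : nTilde x l θ * (1 + t) < secMom P θ) :
    -(κ * l / 2) * t ^ 2 + (1 - muCoef κ S l β) * t - gammaCoef n κ S ε a l β -
      β / (2 * n) / secMom P θ * (1 + t) ≤ 0 := by
  have hNt := nTilde_nonneg x hl.le θ
  set N := secMom P θ
  have hN : 0 < N := lt_of_le_of_lt (by positivity) hlt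
  set α := √(l * (1 + t) / N) with hα
  have hα2 : α ^ 2 = l * (1 + t) / N := Real.sq_sqrt (by positivity)
  have hr : rEmp x l (α • θ) ≤ 0 := by
    refine rEmp_nonpos_of_lt hn x hl θ (Real.sqrt_nonneg _) ?_
    rw [hα2, div_mul_eq_mul_div, div_lt_iff₀ hN]
    nlinarith
  have h := (hE (α • θ)).2.trans hr
  rw [secMom_smul, norm_smul, hθ, mul_one, Real.norm_eq_abs, sq_abs, hα2,
    div_mul_cancel₀ _ hN.ne'] at h
  have e : -(κ / 2) * (l * (1 + t) - l) ^ 2 + (1 - muCoef κ S l β) * (l * (1 + t) - l) -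
      gammaCoef n κ S ε a l β * l - β / (2 * n) * (l * (1 + t) / N) =
      l * (-(κ * l / 2) * t ^ 2 + (1 - muCoef κ S l β) * t - gammaCoef n κ S ε a l β -
      β / (2 * n) / N * (1 + t)) := by ring
  rw [e] at h
  exact nonpos_of_mul_nonpos_right h hl

/-- The upper bound for the influence at its root, where the second moment is
`l N / Ñ`. -/
lemma upper_parabola (hl : 0 < l) (hE : InfluenceBounds P κ S ε a l β x)
    (hθ : ‖θ‖ = 1) (hpos : 0 < nTilde x l θ) :
    0 ≤ κ * l / 2 * (1 - secMom P θ / nTilde x l θ) ^ 2 -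
      (1 + muCoef κ S l β) * (1 - secMom P θ / nTilde x l θ) + gammaCoef n κ S ε a l β +
      β / (2 * n) / nTilde x l θ := by
  obtain ⟨α, hα, hα2, hr⟩ := exists_root_of_nTilde_pos x hl θ hpos
  have h := hr.trans (hE (α • θ)).1
  set N := secMom P θ with hN
  set T := nTilde x l θ
  have hα2' : α ^ 2 = l / T := by rw [eq_div_iff hpos.ne']; exact hα2
  rw [secMom_smul, norm_smul, hθ, mul_one, Real.norm_eq_abs, sq_abs, hα2', ← hN] at h
  have e : κ / 2 * (l / T * N - l) ^ 2 + (1 + muCoef κ S l β) * (l / T * N - l) +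
      gammaCoef n κ S ε a l β * l + β / (2 * n) * (l / T) =
      l * (κ * l / 2 * (1 - N / T) ^ 2 -
      (1 + muCoef κ S l β) * (1 - N / T) + gammaCoef n κ S ε a l β +
      β / (2 * n) / T) := by ring
  rw [e] at h
  exact nonneg_of_mul_nonneg_right h hl

/-- The confidence interval is valid: the two parabolas confine the ratio `N / Ñ`. -/
lemma abs_max_secMom_sub_le (hn : 0 < n) (hl : 0 < l) (hβ : 0 < β) (hκ : 0 < κ)
    (hμ : 0 ≤ muCoef κ S l β) (hγ : 0 ≤ gammaCoef n κ S ε a l β)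
    (hE : InfluenceBounds P κ S ε a l β x) (hθ : ‖θ‖ = 1) {σ : ℝ} (hσ : 0 < σ)
    (hD : κ * l / 2 ≤ widthDen n κ S ε a l β (max (nTilde x l θ) σ)) :
    |max (secMom P θ) σ - max (nTilde x l θ) σ| ≤
      max (nTilde x l θ) σ * relWidth n κ S ε a l β (max (nTilde x l θ) σ) := by
  have hn' : (0 : ℝ) < n := by exact_mod_cast hn
  have hlow := fun t => lower_parabola (t := t) hn hl hE hθ
  have hup := upper_parabola hl hE hθ
  have hN0 := secMom_nonneg (P := P) θ
  set N := secMom P θ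
  set T := nTilde x l θ
  set M := max T σ with hM
  set μ := muCoef κ S l β
  set γ := gammaCoef n κ S ε a l β
  have hM0 : 0 < M := lt_max_of_lt_right hσ
  have hη : 0 < β / (2 * n) := by positivity
  set η := β / (2 * n)
  set D := widthDen n κ S ε a l β M with hDdef
  have hDe : D = 1 - μ - γ - 2 * η / M := rfl
  have hD0 : 0 < D := lt_of_lt_of_le (by positivity) hD
  set g := γ + η / M with hg
  have hg0 : 0 < g := by positivity
  set w := relWidth n κ S ε a l β M with hw
  have hwe : w = g / D := rfl
  have hw0 : 0 < w := by rw [hwe]; positivity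
  have hDw : D * w = g := by rw [hwe]; field_simp
  have hκw : κ * l / 2 * w ≤ g := by rw [← hDw]; gcongr
  have hηM : 0 < η / M := by positivity
  have hDe' : D = 1 - μ - g - η / M := by rw [hDe, hg]; ring
  clear_value w D μ γ η
  rw [abs_le]
  constructor
  · by_contra! hlt
    have h1 : max N σ < M * (1 - w) := by linarith
    have hσM : σ < M := by
      have h2 : M * (1 - w) < M := by nlinarith
      linarith [le_max_right N σ]
    have hTM : T = M := by
      rcases max_choice T σ with h | h
      · exact h.symm
      · rw [← hM] at h; linarith
    have hT0 : 0 < T := hTM ▸ hM0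
    have h3 := hup hT0
    rw [hTM] at h3
    have hNM : N / M < 1 - w := by
      rw [div_lt_iff₀ hM0]
      linarith [le_max_left N σ]
    have hNM0 : 0 ≤ N / M := by positivity
    -- a convex function of `1 - N / M ∈ (w, 1]`, nonpositive at `w` and negative at `1`
    set y := 1 - N / M with hy
    have hyw : w < y := by rw [hy]; linarith
    have hy1 : y ≤ 1 := by rw [hy]; linarith
    have hA : κ * l / 2 * w ^ 2 - (1 + μ) * w + g ≤ 0 := by nlinarith
    have hB : κ * l / 2 - (1 + μ) + g < 0 := by linarith
    have hconv : (1 - w) * (κ * l / 2 * y ^ 2 - (1 + μ) * y + g) ≤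
        (1 - y) * (κ * l / 2 * w ^ 2 - (1 + μ) * w + g) +
          (y - w) * (κ * l / 2 - (1 + μ) + g) := by
      have h4 : 0 ≤ κ * l / 2 * ((1 - y) * (y - w) * (1 - w)) := by
        have : 0 ≤ (1 - y) * (y - w) * (1 - w) :=
          mul_nonneg (mul_nonneg (by linarith) (by linarith)) (by linarith)
        positivity
      linarith
    have h5 : (1 - y) * (κ * l / 2 * w ^ 2 - (1 + μ) * w + g) ≤ 0 :=
      mul_nonpos_of_nonneg_of_nonpos (by linarith) hA
    have h6 : (y - w) * (κ * l / 2 - (1 + μ) + g) < 0 := mul_neg_of_pos_of_neg (by linarith) hB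
    have h7 : 0 ≤ (1 - w) * (κ * l / 2 * y ^ 2 - (1 + μ) * y + g) :=
      mul_nonneg (by linarith) (by rw [hg]; linarith)
    linarith
  · by_contra! hlt
    have h1 : M * (1 + w) < max N σ := by linarith
    have hσM : σ ≤ M := le_max_right _ _
    have hN : max N σ = N := by
      rcases max_choice N σ with h | h
      · exact h
      · rw [h] at h1
        nlinarith
    rw [hN] at h1
    have hTM : T ≤ M := le_max_left _ _
    have h2 := hlow w hw0.le (by nlinarith)
    have hNpos : 0 < N := lt_trans (by positivity) h1
    have h3 : η / N * (1 + w) < η / M := by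
      rw [div_mul_eq_mul_div, div_lt_div_iff₀ hNpos hM0]
      nlinarith
    have h4 : 0 ≤ w * (g - κ * l / 2 * w) := mul_nonneg hw0.le (by linarith)
    have h5 : (1 - μ) * w = D * w + g * w + η / M * w := by rw [hDe']; ring
    have h6 : 0 < η / M * w := by positivity
    linarith

/-- The preliminary estimate is not much smaller than the second moment. -/
lemma half_le_max_nTilde (hn : 0 < n) (hl : 0 < l) (hE : InfluenceBounds P κ S ε a l β x)
    (hθ : ‖θ‖ = 1) {σ : ℝ} (hσ : 0 < σ)
    (h : κ * l / 2 + muCoef κ S l β + gammaCoef n κ S ε a l β +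
      2 * (β / (2 * n) / max (secMom P θ) σ) < 1) :
    max (secMom P θ) σ / 2 ≤ max (nTilde x l θ) σ := by
  by_contra! hlt
  have h1 : σ < max (secMom P θ) σ / 2 := (le_max_right _ _).trans_lt hlt
  have hN : max (secMom P θ) σ = secMom P θ := by
    rcases max_choice (secMom P θ) σ with h2 | h2
    · exact h2
    · rw [h2] at h1
      linarith
  rw [hN] at h hlt
  have := lower_parabola hn hl hE hθ (t := 1) zero_le_one
    (by linarith [le_max_left (nTilde x l θ) σ])
  linarith

/-- A bound for the width of the confidence interval in terms of the second moment itself. -/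
lemma max_nTilde_mul_relWidth_le (hn : 0 < n) (hl : 0 < l) (hβ : 0 < β) (hκ : 0 < κ)
    (hμγ : muCoef κ S l β = gammaCoef n κ S ε a l β) (hγ : 0 ≤ gammaCoef n κ S ε a l β)
    (hE : InfluenceBounds P κ S ε a l β x) (hθ : ‖θ‖ = 1) {σ z : ℝ} (hσ : 0 < σ)
    (hz : gammaCoef n κ S ε a l β + β / (2 * n) / max (secMom P θ) σ ≤ z)
    (hκz : κ * l / 2 + 4 * z < 1) :
    κ * l / 2 ≤ widthDen n κ S ε a l β (max (nTilde x l θ) σ) ∧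
    max (nTilde x l θ) σ * relWidth n κ S ε a l β (max (nTilde x l θ) σ) ≤
      max (secMom P θ) σ * (z / (1 - 4 * z)) := by
  have hn' : (0 : ℝ) < n := by exact_mod_cast hn
  have hκl : 0 < κ * l / 2 := by positivity
  have hη : 0 < β / (2 * n) := by positivity
  have hτ : 0 < max (secMom P θ) σ := lt_max_of_lt_right hσ
  have hM : 0 < max (nTilde x l θ) σ := lt_max_of_lt_right hσ
  have hz0 : 0 < z := lt_of_lt_of_le (by positivity) hz
  have hhalf := half_le_max_nTilde hn hl hE hθ hσ (by rw [hμγ]; linarith)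
  have hmain := abs_max_secMom_sub_le hn hl hβ hκ (hμγ ▸ hγ) hγ hE hθ hσ
  set τ := max (secMom P θ) σ
  set M := max (nTilde x l θ) σ
  have eD : widthDen n κ S ε a l β M =
      1 - 2 * (gammaCoef n κ S ε a l β + β / (2 * n) / M) := by
    rw [widthDen, hμγ]
    ring
  rw [relWidth, eD] at hmain ⊢
  set γ := gammaCoef n κ S ε a l β
  set η := β / (2 * n)
  set y := γ + η / M with hy
  have hy0 : 0 < y := by positivity
  have hMy : M * y = M * γ + η := by rw [hy, mul_add, mul_div_cancel₀ _ hM.ne']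
  have hτz : τ * γ + η ≤ τ * z := by
    have := mul_le_mul_of_nonneg_left hz hτ.le
    rwa [mul_add, mul_div_cancel₀ _ hτ.ne'] at this
  rcases le_or_gt τ M with h | h
  · have hyz : y ≤ z := by
      refine le_trans ?_ hz
      rw [hy]
      gcongr
    refine ⟨by linarith, ?_⟩
    have h1 := (abs_le.1 (hmain (by linarith))).1
    have hD : 0 < 1 - 2 * y := by linarith
    have h2 : M * (1 - 3 * y) ≤ τ * (1 - 2 * y) := by
      have h3 : M * (y / (1 - 2 * y)) * (1 - 2 * y) = M * y := by
        rw [mul_assoc, div_mul_cancel₀ _ hD.ne']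
      nlinarith
    rw [mul_div_assoc', mul_div_assoc', div_le_div_iff₀ hD (by linarith)]
    -- `M y (1 - 3 z) ≤ τ (1 - 2 y) z`
    have h4 : M * y * (1 - 4 * z) ≤ M * (1 - 3 * y) * z := by
      have : M * (y - z) ≤ 0 := mul_nonpos_of_nonneg_of_nonpos hM.le (by linarith)
      nlinarith [mul_pos (mul_pos hM hy0) hz0]
    nlinarith
  · have hyz : y ≤ 2 * z := by
      have h1 : η / M ≤ 2 * (η / τ) := by
        rw [mul_div_assoc', div_le_div_iff₀ hM hτ]
        nlinarith
      rw [hy]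
      linarith
    refine ⟨by linarith, ?_⟩
    have h1 : M * y ≤ τ * z := by
      rw [hMy]
      nlinarith
    rw [mul_div_assoc', mul_div_assoc']
    exact div_le_div₀ (by positivity) h1 (by linarith) (by linarith)

end Interval

/-! ### The grid of parameters -/

section Grid

variable {n : ℕ} {κ S ε a : ℝ}

/-- The common argument of the square roots in `gridL` and `zeta`. -/
def complexity (n : ℕ) (κ S ε a t : ℝ) : ℝ :=
  (2 + 3 * cc) * S / (4 * (2 + cc) * √κ * t) + Real.log (gridSize n κ a / ε)

lemma complexity_pos (hκ : 1 < κ) (hS : 0 < S) (hε : 0 < ε) (hε1 : ε < 1) {t : ℝ} (ht : 0 < t) :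
    0 < complexity n κ S ε a t := by
  have h1 := log_gridSize_pos (n := n) (κ := κ) (a := a) hε hε1
  have hc := cc_pos
  have : 0 < √κ := Real.sqrt_pos.2 (by linarith)
  unfold complexity
  positivity

lemma complexity_anti (hκ : 1 < κ) (hS : 0 < S) {t t' : ℝ} (ht : 0 < t) (h : t ≤ t') :
    complexity n κ S ε a t' ≤ complexity n κ S ε a t := by
  have hc := cc_pos
  have : 0 < √κ := Real.sqrt_pos.2 (by linarith)
  unfold complexity
  gcongr

lemma zeta_eq (t : ℝ) : zeta n κ S ε a t =
    √(2 * (κ - 1) * complexity n κ S ε a t) * Real.cosh (a / 4) +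
      √(2 * (2 + cc) * √κ * S / t) * Real.cosh (a / 2) := rfl

lemma zeta_pos (hκ : 1 < κ) (hS : 0 < S) (hε : 0 < ε) (hε1 : ε < 1) {t : ℝ} (ht : 0 < t) :
    0 < zeta n κ S ε a t := by
  have hc := cc_pos
  have : 0 < √κ := Real.sqrt_pos.2 (by linarith)
  have h1 := complexity_pos (n := n) (a := a) hκ hS hε hε1 ht
  have : 0 < κ - 1 := by linarith
  have := Real.cosh_pos (a / 4)
  have := Real.cosh_pos (a / 2)
  rw [zeta_eq]
  positivity

lemma zeta_anti (hκ : 1 < κ) (hS : 0 < S) {t t' : ℝ} (ht : 0 < t) (h : t ≤ t') :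
    zeta n κ S ε a t' ≤ zeta n κ S ε a t := by
  have hc := cc_pos
  have : 0 < √κ := Real.sqrt_pos.2 (by linarith)
  have h1 := complexity_anti (n := n) (ε := ε) (a := a) hκ hS ht h
  have : 0 < κ - 1 := by linarith
  have := Real.cosh_pos (a / 4)
  have := Real.cosh_pos (a / 2)
  rw [zeta_eq, zeta_eq]
  gcongr

/-- The function `t ↦ √t ζ(t)` is nondecreasing. -/
lemma sqrt_mul_zeta_mono (hκ : 1 < κ) (hS : 0 < S) (hε : 0 < ε) (hε1 : ε < 1) {t t' : ℝ}
    (ht : 0 < t) (h : t ≤ t') :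
    √t * zeta n κ S ε a t ≤ √t' * zeta n κ S ε a t' := by
  have hc := cc_pos
  have hk : 0 < √κ := Real.sqrt_pos.2 (by linarith)
  have hκ1 : 0 < κ - 1 := by linarith
  have ht' : 0 < t' := ht.trans_le h
  have hlog := log_gridSize_pos (n := n) (κ := κ) (a := a) hε hε1
  have e : ∀ u : ℝ, 0 < u → √u * zeta n κ S ε a u =
      √(2 * (κ - 1) * ((2 + 3 * cc) * S / (4 * (2 + cc) * √κ) +
        Real.log (gridSize n κ a / ε) * u)) * Real.cosh (a / 4) +
      √(2 * (2 + cc) * √κ * S) * Real.cosh (a / 2) := by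
    intro u hu
    rw [zeta_eq, mul_add, ← mul_assoc, ← mul_assoc, ← Real.sqrt_mul hu.le, ← Real.sqrt_mul hu.le]
    congr 3
    · rw [complexity]
      field_simp
    · field_simp
  rw [e t ht, e t' ht']
  have := Real.cosh_pos (a / 4)
  gcongr

/-- Every level `τ` at which the estimator is controlled has a grid point just above it. -/
lemma exists_grid_point (hn : 0 < n) (ha : 0 < a) (hκ : 1 < κ) (hS : 0 < S) {τ : ℝ} (hτ : 0 < τ)
    (hτS : τ ≤ S) (hζ : 6 * zeta n κ S ε a τ ≤ √n) :
    ∃ j < gridSize n κ a, τ ≤ gridT S a j ∧ gridT S a j ≤ τ * Real.exp a := by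
  have hn' : (0 : ℝ) < n := by exact_mod_cast hn
  have hc := cc_pos
  have hk : 0 < √κ := Real.sqrt_pos.2 (by linarith)
  have hlog : 0 ≤ Real.log (S / τ) := Real.log_nonneg ((one_le_div hτ).2 hτS)
  have hexp : Real.exp (Real.log (S / τ)) = S / τ := Real.exp_log (by positivity)
  set u := a⁻¹ * Real.log (S / τ) with hu
  have hu0 : 0 ≤ u := by positivity
  have hua : u * a = Real.log (S / τ) := by rw [hu]; field_simp
  have hfl := Nat.floor_le hu0
  have hfl2 := (Nat.lt_floor_add_one u).le
  refine ⟨⌊u⌋₊, ?_, ?_, ?_⟩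
  · have h1 : 6 * √(2 * (2 + cc) * √κ * S / τ) ≤ √n := by
      refine le_trans ?_ hζ
      rw [zeta_eq]
      have h2 : 0 ≤ √(2 * (κ - 1) * complexity n κ S ε a τ) * Real.cosh (a / 4) :=
        mul_nonneg (Real.sqrt_nonneg _) (Real.cosh_pos _).le
      have h3 := mul_le_mul_of_nonneg_left (Real.one_le_cosh (a / 2))
        (Real.sqrt_nonneg (2 * (2 + cc) * √κ * S / τ))
      linarith
    have h2 : S / τ ≤ n / (72 * (2 + cc) * √κ) := by
      have h3 := pow_le_pow_left₀ (by positivity) h1 2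
      rw [mul_pow, Real.sq_sqrt (by positivity), Real.sq_sqrt hn'.le] at h3
      rw [le_div_iff₀ (by positivity)]
      calc S / τ * (72 * (2 + cc) * √κ) = 6 ^ 2 * (2 * (2 + cc) * √κ * S / τ) := by ring
        _ ≤ n := h3
    have h4 : u ≤ a⁻¹ * Real.log (n / (72 * (2 + cc) * √κ)) := by
      rw [hu]
      gcongr
    have h5 : ⌊u⌋₊ ≤ ⌈a⁻¹ * Real.log (n / (72 * (2 + cc) * √κ))⌉₊ := by
      refine Nat.floor_le_of_le (h4.trans (Nat.le_ceil _))
    rw [gridSize]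
    omega
  · have h1 : Real.exp (-(⌊u⌋₊ * a)) ≥ Real.exp (-(Real.log (S / τ))) := by
      refine Real.exp_le_exp.2 ?_
      rw [← hua]
      nlinarith
    rw [Real.exp_neg (Real.log _), hexp, inv_div] at h1
    rw [gridT]
    calc τ = S * (τ / S) := by field_simp
      _ ≤ _ := by gcongr
  · have h1 : Real.exp (-(⌊u⌋₊ * a)) ≤ Real.exp (a - Real.log (S / τ)) := by
      refine Real.exp_le_exp.2 ?_
      rw [← hua]
      nlinarith
    rw [Real.exp_sub, hexp] at h1
    rw [gridT]
    calc _ ≤ S * (Real.exp a / (S / τ)) := by gcongr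
      _ = τ * Real.exp a := by field_simp

variable {t : ℝ}

lemma gridL_sq (hκ : 1 < κ) (hS : 0 < S) (hε : 0 < ε) (hε1 : ε < 1) (ht : 0 < t) :
    gridL n κ S ε a t ^ 2 = 2 / (n * (κ - 1)) * complexity n κ S ε a t := by
  have h1 := complexity_pos (n := n) (a := a) hκ hS hε hε1 ht
  have : 0 < κ - 1 := by linarith
  exact Real.sq_sqrt (by positivity)

lemma gridBeta_sq (hS : 0 < S) (ht : 0 < t) :
    gridBeta n κ S t ^ 2 = 2 * n * t * (2 + cc) * √κ * S := by
  have hc := cc_pos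
  exact Real.sq_sqrt (by positivity)

/-- At the grid parameters the last two terms of `γ` add up to `l (κ - 1) / 2`, so that `μ = γ`. -/
lemma gammaCoef_grid (hn : 0 < n) (hκ : 1 < κ) (hS : 0 < S) (hε : 0 < ε) (hε1 : ε < 1)
    (ht : 0 < t) :
    gammaCoef n κ S ε a (gridL n κ S ε a t) (gridBeta n κ S t) =
      gridL n κ S ε a t * (κ - 1) + (2 + cc) * √κ * S / gridBeta n κ S t := by
  have hn' : (0 : ℝ) < n := by exact_mod_cast hn
  have hc := cc_pos
  have hk : 0 < √κ := Real.sqrt_pos.2 (by linarith)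
  have hκ1 : 0 < κ - 1 := by linarith
  have hl := gridL_pos (a := a) hn hκ hS hε hε1 ht
  have hl2 := gridL_sq (n := n) (a := a) hκ hS hε hε1 ht
  have hb2 := gridBeta_sq (n := n) (κ := κ) hS ht
  have h1 : (2 + 3 * cc) * S ^ 2 / (2 * gridBeta n κ S t ^ 2 * gridL n κ S ε a t) +
      Real.log (gridSize n κ a / ε) / (n * gridL n κ S ε a t) =
      gridL n κ S ε a t * (κ - 1) / 2 := by
    have h2 : (2 + 3 * cc) * S ^ 2 / (2 * gridBeta n κ S t ^ 2 * gridL n κ S ε a t) +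
        Real.log (gridSize n κ a / ε) / (n * gridL n κ S ε a t) =
        complexity n κ S ε a t / (n * gridL n κ S ε a t) := by
      rw [hb2, complexity, add_div]
      congr 1
      field_simp
      ring
    have h3 : complexity n κ S ε a t = gridL n κ S ε a t ^ 2 * (n * (κ - 1)) / 2 := by
      rw [hl2]
      field_simp
    rw [h2, h3]
    field_simp
  rw [gammaCoef, add_assoc (_ + _), h1]
  ring

lemma muCoef_eq_gammaCoef_grid (hn : 0 < n) (hκ : 1 < κ) (hS : 0 < S) (hε : 0 < ε) (hε1 : ε < 1)
    (ht : 0 < t) :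
    muCoef κ S (gridL n κ S ε a t) (gridBeta n κ S t) =
      gammaCoef n κ S ε a (gridL n κ S ε a t) (gridBeta n κ S t) := by
  rw [gammaCoef_grid hn hκ hS hε hε1 ht, muCoef]

/-- At a grid point in `[τ, τ eᵃ]` the relative accuracy is at most `ζ(τ) / √n`. -/
lemma gammaCoef_add_le (hn : 0 < n) (ha : 0 < a) (hκ : 1 < κ) (hS : 0 < S) (hε : 0 < ε)
    (hε1 : ε < 1) {τ : ℝ} (hτ : 0 < τ) (h1 : τ ≤ t) (h2 : t ≤ τ * Real.exp a) :
    gammaCoef n κ S ε a (gridL n κ S ε a t) (gridBeta n κ S t) +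
      gridBeta n κ S t / (2 * n) / τ ≤ zeta n κ S ε a τ / √n := by
  have hn' : (0 : ℝ) < n := by exact_mod_cast hn
  have hc := cc_pos
  have hk : 0 < √κ := Real.sqrt_pos.2 (by linarith)
  have hκ1 : 0 < κ - 1 := by linarith
  have ht : 0 < t := hτ.trans_le h1
  have hl := gridL_pos (a := a) hn hκ hS hε hε1 ht
  have hb := gridBeta_pos hn hκ hS ht
  rw [gammaCoef_grid hn hκ hS hε hε1 ht, zeta_eq, add_div]
  set q := (2 + cc) * √κ * S with hq
  have hq0 : 0 < q := by positivity
  have hA : gridL n κ S ε a t * (κ - 1) ≤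
      √(2 * (κ - 1) * complexity n κ S ε a τ) * Real.cosh (a / 4) / √n := by
    have h3 : gridL n κ S ε a t * (κ - 1) = √(2 * (κ - 1) * complexity n κ S ε a t) / √n := by
      rw [← Real.sqrt_div' _ hn'.le, eq_comm,
        Real.sqrt_eq_iff_mul_self_eq
          (by have := complexity_pos (n := n) (a := a) hκ hS hε hε1 ht; positivity) (by positivity),
        ← sq, mul_pow, gridL_sq hκ hS hε hε1 ht]
      field_simp
    rw [h3]
    gcongr
    have h4 : √(2 * (κ - 1) * complexity n κ S ε a t) ≤
        √(2 * (κ - 1) * complexity n κ S ε a τ) := by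
      have := complexity_anti (n := n) (ε := ε) (a := a) hκ hS hτ h1
      gcongr
    refine h4.trans (le_mul_of_one_le_right (Real.sqrt_nonneg _) (Real.one_le_cosh _))
  have hB : q / gridBeta n κ S t + gridBeta n κ S t / (2 * n) / τ ≤
      √(2 * (2 + cc) * √κ * S / τ) * Real.cosh (a / 2) / √n := by
    set s := Real.log (t / τ) / 2 with hs
    have hs0 : 0 ≤ s := by
      have := Real.log_nonneg ((one_le_div hτ).2 h1)
      positivity
    have hsa : s ≤ a / 2 := by
      have : Real.log (t / τ) ≤ a := by
        rw [Real.log_le_iff_le_exp (by positivity), div_le_iff₀ hτ]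
        linarith
      linarith
    have hes : Real.exp s ^ 2 = t / τ := by
      rw [← Real.exp_nat_mul, hs]
      push_cast
      rw [mul_div_cancel₀ _ two_ne_zero, Real.exp_log (by positivity)]
    set R := √(2 * (2 + cc) * √κ * S / τ) / √n with hR
    have hR0 : 0 < R := by positivity
    have hR2 : R ^ 2 = 2 * q / (n * τ) := by
      rw [hR, div_pow, Real.sq_sqrt (by positivity), Real.sq_sqrt hn'.le, hq]
      field_simp
    have hbeta : gridBeta n κ S t = n * τ * R * Real.exp s := by
      rw [← sq_eq_sq₀ hb.le (by positivity), gridBeta_sq hS ht, mul_pow, mul_pow, hes, hR2, hq]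
      field_simp
    have hqR : q = R ^ 2 * (n * τ) / 2 := by rw [hR2]; field_simp
    have hexp := Real.exp_pos s
    have e : q / gridBeta n κ S t + gridBeta n κ S t / (2 * n) / τ = R * Real.cosh s := by
      rw [hbeta, hqR, Real.cosh_eq, Real.exp_neg]
      field_simp
      ring
    rw [e, mul_div_right_comm]
    refine mul_le_mul_of_nonneg_left ?_ hR0.le
    rw [Real.cosh_le_cosh, abs_of_nonneg hs0, abs_of_nonneg (by linarith)]
    exact hsa
  linarith

lemma gammaCoef_grid_nonneg (hn : 0 < n) (hκ : 1 < κ) (hS : 0 < S) (hε : 0 < ε) (hε1 : ε < 1)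
    (ht : 0 < t) : 0 ≤ gammaCoef n κ S ε a (gridL n κ S ε a t) (gridBeta n κ S t) := by
  have hc := cc_pos
  have hκ1 : 0 < κ - 1 := by linarith
  have hl := gridL_pos (a := a) hn hκ hS hε hε1 ht
  have hb := gridBeta_pos hn hκ hS ht
  rw [gammaCoef_grid hn hκ hS hε hε1 ht]
  positivity

end Grid

section Accuracy

variable {d n : ℕ} {P : Measure (EuclideanSpace ℝ (Fin d))}
  {κ S ε a σ : ℝ} {x : Fin n → EuclideanSpace ℝ (Fin d)} {θ : EuclideanSpace ℝ (Fin d)}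

lemma inInterval_secMom (hn : 0 < n) (hκ : 1 < κ) (hS : 0 < S) (hε : 0 < ε) (hε1 : ε < 1)
    (hσ : 0 < σ)
    (hE : ∀ j < gridSize n κ a, InfluenceBounds P κ S ε a (gridL n κ S ε a (gridT S a j))
        (gridBeta n κ S (gridT S a j)) x) (hθ : ‖θ‖ = 1) :
    InInterval κ S ε a σ x θ (secMom P θ) := by
  refine ⟨secMom_nonneg θ, fun j hj => ?_⟩
  intro l β M hD
  have ht := gridT_pos (a := a) hS j
  have hγ := gammaCoef_grid_nonneg (a := a) hn hκ hS hε hε1 ht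
  exact abs_max_secMom_sub_le hn (gridL_pos hn hκ hS hε hε1 ht) (gridBeta_pos hn hκ hS ht)
    (by linarith) (by rw [muCoef_eq_gammaCoef_grid hn hκ hS hε hε1 ht]; exact hγ) hγ (hE j hj) hθ hσ
    hD

/-- All the elements of the confidence interval are close to the second moment. -/
lemma abs_max_sub_le_of_inInterval (hn : 0 < n) (ha : 0 < a) (hκ : 1 < κ) (hS : 0 < S)
    (hε : 0 < ε) (hε1 : ε < 1) (hσ : 0 < σ)
    (hE : ∀ j < gridSize n κ a, InfluenceBounds P κ S ε a (gridL n κ S ε a (gridT S a j))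
        (gridBeta n κ S (gridT S a j)) x) (hθ : ‖θ‖ = 1)
    (hτS : max (secMom P θ) σ ≤ S)
    (hζ : (6 + (κ - 1)⁻¹) * zeta n κ S ε a (max (secMom P θ) σ) ≤ √n) {N : ℝ}
    (hN : InInterval κ S ε a σ x θ N) :
    |max N σ - max (secMom P θ) σ| ≤ 2 * max (secMom P θ) σ *
      (zeta n κ S ε a (max (secMom P θ) σ) / √n /
        (1 - 4 * (zeta n κ S ε a (max (secMom P θ) σ) / √n))) := by
  have hn' : (0 : ℝ) < n := by exact_mod_cast hn
  have hsn : 0 < √(n : ℝ) := Real.sqrt_pos.2 hn'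
  have hκ1 : 0 < κ - 1 := by linarith
  have hτ : 0 < max (secMom P θ) σ := lt_max_of_lt_right hσ
  have hζ0 := zeta_pos (n := n) (a := a) hκ hS hε hε1 hτ
  have hinv : 0 < (κ - 1)⁻¹ := inv_pos.2 hκ1
  obtain ⟨j, hj, h1, h2⟩ := exists_grid_point (ε := ε) hn ha hκ hS hτ hτS
    (le_trans (by nlinarith) hζ)
  have ht := gridT_pos (a := a) hS j
  have hz := gammaCoef_add_le hn ha hκ hS hε hε1 hτ h1 h2
  set z := zeta n κ S ε a (max (secMom P θ) σ) / √n with hzdef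
  have hz0 : 0 < z := by positivity
  have hz1 : (6 + (κ - 1)⁻¹) * z ≤ 1 := by
    rw [hzdef, mul_div_assoc', div_le_one hsn]
    exact hζ
  have hl := gridL_pos (a := a) hn hκ hS hε hε1 ht
  have hβ := gridBeta_pos hn hκ hS ht
  have hκl : κ * gridL n κ S ε a (gridT S a j) / 2 ≤ (1 + (κ - 1)⁻¹) * z / 2 := by
    have h3 : gridL n κ S ε a (gridT S a j) * (κ - 1) ≤ z := by
      have hc := cc_pos
      refine le_trans ?_ hz
      rw [gammaCoef_grid hn hκ hS hε hε1 ht, add_assoc]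
      exact le_add_of_nonneg_right (by positivity)
    have h4 : κ * gridL n κ S ε a (gridT S a j) =
        (1 + (κ - 1)⁻¹) * (gridL n κ S ε a (gridT S a j) * (κ - 1)) := by
      field_simp
      ring
    rw [h4]
    gcongr
  have hγ := gammaCoef_grid_nonneg (a := a) hn hκ hS hε hε1 ht
  have hμγ := muCoef_eq_gammaCoef_grid (a := a) hn hκ hS hε hε1 ht
  obtain ⟨hD, hw⟩ := max_nTilde_mul_relWidth_le hn hl hβ (by linarith) hμγ hγ (hE j hj) hθ hσ hz
    (by nlinarith)
  have hA := hN.2 j hj hD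
  have hB := (inInterval_secMom hn hκ hS hε hε1 hσ hE hθ).2 j hj hD
  rw [abs_le] at hA hB ⊢
  constructor <;> linarith [hA.1, hA.2, hB.1, hB.2]

end Accuracy

/-! ### Regularity of the error bound -/

section Bound

variable {n : ℕ} {κ S ε a σ : ℝ}

/-- The value of `B_*` as a real number; it is finite when `8 ζ(σ) ≤ √n` and `κ ≥ 3/2`. -/
def rate (n : ℕ) (κ S ε a σ t : ℝ) : ℝ :=
  zeta n κ S ε a (max t σ) / √n / (1 - 4 * (zeta n κ S ε a (max t σ) / √n))

/-- The value of `B` as a real number. -/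
def realBound (n : ℕ) (κ S ε a σ δ g t : ℝ) : ℝ :=
  2 * (max t σ * rate n κ S ε a σ (min t S)) + (7 * δ * g + σ)

/-- The conditions on the parameters under which `B` is finite and regular. -/
structure Admissible (n : ℕ) (κ S ε a σ : ℝ) : Prop where
  n_pos : 0 < n
  a_pos : 0 < a
  eps_pos : 0 < ε
  eps_lt : ε < 1
  sig_pos : 0 < σ
  sig_le : σ ≤ S
  kappa_ge : 3 / 2 ≤ κ
  zeta_le : 8 * zeta n κ S ε a σ ≤ √n

namespace Admissible

variable (h : Admissible n κ S ε a σ)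
include h

lemma kappa_gt : 1 < κ := by linarith [h.kappa_ge]

lemma S_pos : 0 < S := h.sig_pos.trans_le h.sig_le

lemma sqrt_pos : 0 < √(n : ℝ) := Real.sqrt_pos.2 (by exact_mod_cast h.n_pos)

lemma zeta_max_pos (t : ℝ) : 0 < zeta n κ S ε a (max t σ) :=
  zeta_pos h.kappa_gt h.S_pos h.eps_pos h.eps_lt (lt_max_of_lt_right h.sig_pos)

lemma zeta_div_pos (t : ℝ) : 0 < zeta n κ S ε a (max t σ) / √n :=
  div_pos (h.zeta_max_pos t) h.sqrt_pos

lemma zeta_div_le (t : ℝ) : zeta n κ S ε a (max t σ) / √n ≤ 1 / 8 := by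
  rw [div_le_iff₀ h.sqrt_pos]
  have := zeta_anti (n := n) (ε := ε) (a := a) h.kappa_gt h.S_pos h.sig_pos (le_max_right t σ)
  linarith [h.zeta_le]

lemma zeta_cond (t : ℝ) : (6 + (κ - 1)⁻¹) * zeta n κ S ε a (max t σ) ≤ √n := by
  have h1 : (κ - 1)⁻¹ ≤ 2 := by
    rw [inv_le_comm₀ (by linarith [h.kappa_gt]) (by norm_num)]
    linarith [h.kappa_ge]
  have h2 := h.zeta_div_le t
  rw [div_le_iff₀ h.sqrt_pos] at h2
  nlinarith [h.zeta_max_pos t]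

lemma rate_nonneg (t : ℝ) : 0 ≤ rate n κ S ε a σ t :=
  div_nonneg (h.zeta_div_pos t).le (by linarith [h.zeta_div_le t])

lemma rate_le (t : ℝ) : rate n κ S ε a σ t ≤ 1 / 4 := by
  have := h.zeta_div_le t
  rw [rate, div_le_iff₀ (by linarith)]
  linarith

lemma rate_anti {t t' : ℝ} (ht : t ≤ t') : rate n κ S ε a σ t' ≤ rate n κ S ε a σ t := by
  have h1 : zeta n κ S ε a (max t' σ) / √n ≤ zeta n κ S ε a (max t σ) / √n := by
    have hm : 0 < max t σ := lt_max_of_lt_right h.sig_pos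
    have := zeta_anti (n := n) (ε := ε) (a := a) h.kappa_gt h.S_pos hm (max_le_max_right σ ht)
    gcongr
  have h2 := h.zeta_div_le t
  exact div_le_div₀ (h.zeta_div_pos t).le h1 (by linarith) (by linarith)

/-- `t B_*(t)` is nondecreasing: this is where `ζ / √n ≤ 1/8` is needed. -/
lemma max_mul_rate_mono {t t' : ℝ} (ht : t ≤ t') :
    max t σ * rate n κ S ε a σ t ≤ max t' σ * rate n κ S ε a σ t' := by
  have hu : 0 < max t σ := lt_max_of_lt_right h.sig_pos
  have huu : max t σ ≤ max t' σ := max_le_max_right σ ht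
  have hu' : 0 < max t' σ := hu.trans_le huu
  have hz := h.zeta_div_pos t
  have hz' := h.zeta_div_pos t'
  have hz8 := h.zeta_div_le t
  have hz8' := h.zeta_div_le t'
  have hmono := sqrt_mul_zeta_mono (n := n) (a := a) h.kappa_gt h.S_pos h.eps_pos h.eps_lt hu huu
  have hmono' : √(max t σ) * (zeta n κ S ε a (max t σ) / √n) ≤
      √(max t' σ) * (zeta n κ S ε a (max t' σ) / √n) := by
    rw [mul_div_assoc', mul_div_assoc']
    have := h.sqrt_pos
    gcongr
  unfold rate
  have hs : √(max t σ) ^ 2 = max t σ := Real.sq_sqrt hu.le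
  have hs' : √(max t' σ) ^ 2 = max t' σ := Real.sq_sqrt hu'.le
  have hss : √(max t σ) ≤ √(max t' σ) := Real.sqrt_le_sqrt huu
  have hr : 0 < √(max t σ) := Real.sqrt_pos.2 hu
  have hr' : 0 < √(max t' σ) := Real.sqrt_pos.2 hu'
  generalize √(max t σ) = r at *
  generalize √(max t' σ) = r' at *
  generalize zeta n κ S ε a (max t σ) / √n = z at *
  generalize zeta n κ S ε a (max t' σ) / √n = z' at *
  rw [← hs, ← hs', mul_div_assoc', mul_div_assoc',
    div_le_div_iff₀ (by linarith) (by linarith)]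
  -- as `r z ≤ r' z'`, it remains to see that `r (1 - 4 z') ≤ r' (1 - 4 z)`
  have h3 : r * (1 - 4 * z') * (r * z) ≤ r * (1 - 4 * z') * (r' * z') :=
    mul_le_mul_of_nonneg_left hmono' (mul_nonneg hr.le (by linarith))
  have h4 : r * (1 - 4 * z') ≤ r' * (1 - 4 * z) := by nlinarith
  have h5 : r * (1 - 4 * z') * (r' * z') ≤ r' * (1 - 4 * z) * (r' * z') :=
    mul_le_mul_of_nonneg_right h4 (by positivity)
  linarith

lemma max_mul_rate_min_mono {t t' : ℝ} (ht : t ≤ t') :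
    max t σ * rate n κ S ε a σ (min t S) ≤ max t' σ * rate n κ S ε a σ (min t' S) := by
  rcases le_or_gt t S with h1 | h1
  · rw [min_eq_left h1]
    refine (h.max_mul_rate_mono (le_min ht h1)).trans ?_
    exact mul_le_mul_of_nonneg_right (max_le_max_right σ (min_le_left _ _)) (h.rate_nonneg _)
  · rw [min_eq_right h1.le, min_eq_right (h1.le.trans ht)]
    exact mul_le_mul_of_nonneg_right (max_le_max_right σ ht) (h.rate_nonneg _)

lemma max_mul_rate_min_add {t s : ℝ} (hs : 0 ≤ s) :
    max (t + s) σ * rate n κ S ε a σ (min (t + s) S) ≤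
      max t σ * rate n κ S ε a σ (min t S) + s / 4 := by
  have h1 : max (t + s) σ ≤ max t σ + s :=
    max_le (by linarith [le_max_left t σ]) (by linarith [le_max_right t σ])
  have h2 := h.rate_anti (min_le_min_right S (by linarith : t ≤ t + s))
  have h3 := h.rate_le (min t S)
  calc _ ≤ (max t σ + s) * rate n κ S ε a σ (min t S) :=
        mul_le_mul h1 h2 (h.rate_nonneg _) (by linarith [le_max_right t σ, h.sig_pos])
    _ ≤ _ := by nlinarith

variable {δ g : ℝ}

lemma realBound_nonneg (hδ : 0 ≤ δ) (hg : 0 ≤ g) (t : ℝ) :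
    0 ≤ realBound n κ S ε a σ δ g t := by
  have h1 : 0 ≤ max t σ * rate n κ S ε a σ (min t S) :=
    mul_nonneg (h.sig_pos.le.trans (le_max_right _ _)) (h.rate_nonneg _)
  have := h.sig_pos
  unfold realBound
  positivity

lemma realBound_mono {t t' : ℝ} (ht : t ≤ t') :
    realBound n κ S ε a σ δ g t ≤ realBound n κ S ε a σ δ g t' := by
  have := h.max_mul_rate_min_mono ht
  unfold realBound
  linarith

lemma realBound_le_of_le_add (hδ : 0 ≤ δ) (hg : 0 ≤ g) {t t' : ℝ}
    (ht : t' ≤ t + realBound n κ S ε a σ δ g t) :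
    realBound n κ S ε a σ δ g t' ≤ 3 / 2 * realBound n κ S ε a σ δ g t := by
  have h0 := h.realBound_nonneg hδ hg t
  refine (h.realBound_mono ht).trans ?_
  have h1 := h.max_mul_rate_min_add (t := t) h0
  have e : ∀ u, realBound n κ S ε a σ δ g u =
    2 * (max u σ * rate n κ S ε a σ (min u S)) + (7 * δ * g + σ) := fun _ => rfl
  rw [e (t + _)]
  have := e t
  linarith

lemma bound_eq (hδ : 0 ≤ δ) (hg : 0 ≤ g) (t : ℝ) :
    bound n κ S ε a σ δ g t = ENNReal.ofReal (realBound n κ S ε a σ δ g t) := by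
  have hm : 0 ≤ max t σ := h.sig_pos.le.trans (le_max_right _ _)
  have := h.sig_pos
  rw [bound, bStar, if_pos (h.zeta_cond _), realBound,
    ENNReal.ofReal_add (mul_nonneg zero_le_two (mul_nonneg hm (h.rate_nonneg _))) (by positivity),
    ENNReal.ofReal_mul zero_le_two, ENNReal.ofReal_mul hm, rate, mul_assoc]
  simp

end Admissible

end Bound

/-! ### Symmetric matrices and the convex program -/

section LinearAlgebra

variable {d : ℕ}

/-- The vector `M v`, in Euclidean space. -/
def app (M : Matrix (Fin d) (Fin d) ℝ) (v : EuclideanSpace ℝ (Fin d)) :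
    EuclideanSpace ℝ (Fin d) :=
  WithLp.toLp 2 fun i => ∑ j, M i j * v j

lemma bil_eq_inner_app (M : Matrix (Fin d) (Fin d) ℝ) (u v : EuclideanSpace ℝ (Fin d)) :
    bil M u v = inner ℝ u (app M v) := by
  rw [PiLp.inner_apply]
  simp only [bil, app, mul_assoc, RCLike.inner_apply, conj_trivial,
    Finset.sum_mul]
  exact Finset.sum_congr rfl fun i _ => Finset.sum_congr rfl fun j _ => by ring

lemma bil_comm {M : Matrix (Fin d) (Fin d) ℝ} (hM : M.IsSymm) (u v : EuclideanSpace ℝ (Fin d)) :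
    bil M u v = bil M v u := by
  unfold bil
  rw [Finset.sum_comm]
  refine Finset.sum_congr rfl fun i _ => Finset.sum_congr rfl fun j _ => ?_
  rw [hM.apply i j]
  ring

lemma bil_add_left (M : Matrix (Fin d) (Fin d) ℝ) (u u' v : EuclideanSpace ℝ (Fin d)) :
    bil M (u + u') v = bil M u v + bil M u' v := by
  simp only [bil_eq_inner_app, inner_add_left]

lemma bil_sub_left (M : Matrix (Fin d) (Fin d) ℝ) (u u' v : EuclideanSpace ℝ (Fin d)) :
    bil M (u - u') v = bil M u v - bil M u' v := by
  simp only [bil_eq_inner_app, inner_sub_left]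

lemma bil_smul_left (M : Matrix (Fin d) (Fin d) ℝ) (c : ℝ) (u v : EuclideanSpace ℝ (Fin d)) :
    bil M (c • u) v = c * bil M u v := by
  simp only [bil_eq_inner_app, inner_smul_left]
  simp

lemma bil_sub (M M' : Matrix (Fin d) (Fin d) ℝ) (u v : EuclideanSpace ℝ (Fin d)) :
    bil (M - M') u v = bil M u v - bil M' u v := by
  simp only [bil, Matrix.sub_apply, mul_sub, sub_mul, Finset.sum_sub_distrib]

lemma quad_sub (M M' : Matrix (Fin d) (Fin d) ℝ) (u : EuclideanSpace ℝ (Fin d)) :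
    quad (M - M') u = quad M u - quad M' u := bil_sub M M' u u

lemma quad_smul (M : Matrix (Fin d) (Fin d) ℝ) (hM : M.IsSymm) (c : ℝ)
    (u : EuclideanSpace ℝ (Fin d)) : quad M (c • u) = c ^ 2 * quad M u := by
  rw [quad_eq_bil, bil_smul_left, bil_comm hM, bil_smul_left, ← quad_eq_bil]
  ring

lemma frob_sq (M : Matrix (Fin d) (Fin d) ℝ) : frob M ^ 2 = ∑ i, ∑ j, M i j ^ 2 := by
  have e : (M.transpose * M).trace = ∑ i, ∑ j, M i j ^ 2 := by
    rw [Finset.sum_comm]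
    simp [Matrix.trace, Matrix.mul_apply, sq]
  have h0 : 0 ≤ (M.transpose * M).trace := by
    rw [e]
    exact Finset.sum_nonneg fun i _ => Finset.sum_nonneg fun j _ => sq_nonneg _
  exact (Real.sq_sqrt h0).trans e

lemma frob_nonneg (M : Matrix (Fin d) (Fin d) ℝ) : 0 ≤ frob M := Real.sqrt_nonneg _

/-- The Frobenius norm is computed by the entries in any two orthonormal bases. -/
lemma frob_sq_eq_sum_bil (M : Matrix (Fin d) (Fin d) ℝ)
    (p q : OrthonormalBasis (Fin d) ℝ (EuclideanSpace ℝ (Fin d))) :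
    frob M ^ 2 = ∑ i, ∑ j, bil M (p i) (q j) ^ 2 := by
  have hrow : ∀ k v, app M v k = inner ℝ (WithLp.toLp 2 (M k) : EuclideanSpace ℝ (Fin d)) v := by
    intro k v
    rw [PiLp.inner_apply]
    simp [app, mul_comm]
  calc frob M ^ 2 = ∑ k, ∑ j, M k j ^ 2 := frob_sq M
    _ = ∑ k, ‖(WithLp.toLp 2 (M k) : EuclideanSpace ℝ (Fin d))‖ ^ 2 := by
        refine Finset.sum_congr rfl fun k _ => ?_
        rw [EuclideanSpace.real_norm_sq_eq]
    _ = ∑ k, ∑ j, (app M (q j) k) ^ 2 := by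
        refine Finset.sum_congr rfl fun k _ => ?_
        rw [← q.sum_sq_inner_left]
        simp only [hrow]
    _ = ∑ j, ‖app M (q j)‖ ^ 2 := by
        rw [Finset.sum_comm]
        refine Finset.sum_congr rfl fun j _ => ?_
        rw [EuclideanSpace.real_norm_sq_eq]
    _ = ∑ j, ∑ i, bil M (p i) (q j) ^ 2 := by
        refine Finset.sum_congr rfl fun j _ => ?_
        rw [← p.sum_sq_inner_right]
        simp only [bil_eq_inner_app]
    _ = _ := Finset.sum_comm

lemma abs_bil_le (M : Matrix (Fin d) (Fin d) ℝ) (u v : EuclideanSpace ℝ (Fin d)) :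
    |bil M u v| ≤ frob M * ‖u‖ * ‖v‖ := by
  have h1 : ‖app M v‖ ≤ frob M * ‖v‖ := by
    refine le_of_sq_le_sq ?_ (mul_nonneg (frob_nonneg M) (norm_nonneg v))
    rw [mul_pow, EuclideanSpace.real_norm_sq_eq, EuclideanSpace.real_norm_sq_eq, frob_sq,
      Finset.sum_mul]
    refine Finset.sum_le_sum fun i _ => ?_
    exact Finset.sum_mul_sq_le_sq_mul_sq Finset.univ (fun j => M i j) fun j => v j
  rw [bil_eq_inner_app]
  refine (abs_real_inner_le_norm _ _).trans ?_
  calc ‖u‖ * ‖app M v‖ ≤ ‖u‖ * (frob M * ‖v‖) := by gcongr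
    _ = _ := by ring

lemma abs_quad_sub_quad_le {M : Matrix (Fin d) (Fin d) ℝ} (hM : M.IsSymm) {δ : ℝ}
    {θ ξ : EuclideanSpace ℝ (Fin d)} (hθ : ‖θ‖ = 1) (hξ : ‖ξ‖ = 1) (h : ‖θ - ξ‖ ≤ δ) :
    |quad M θ - quad M ξ| ≤ 2 * δ * frob M := by
  have e : quad M θ - quad M ξ = bil M (θ - ξ) (θ + ξ) := by
    rw [bil_sub_left, bil_comm hM θ, bil_comm hM ξ, bil_add_left, bil_add_left, bil_comm hM ξ θ]
    simp only [quad_eq_bil]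
    ring
  rw [e]
  refine (abs_bil_le M _ _).trans ?_
  have h1 : ‖θ + ξ‖ ≤ 2 := (norm_add_le _ _).trans (by rw [hθ, hξ]; norm_num)
  have h0 := frob_nonneg M
  have hδ : 0 ≤ δ := (norm_nonneg _).trans h
  calc frob M * ‖θ - ξ‖ * ‖θ + ξ‖ ≤ frob M * δ * 2 := by gcongr
    _ = _ := by ring

/-- A symmetric matrix whose quadratic form is bounded by `b` on the unit sphere has rows of norm at
most `b` in any orthonormal basis. -/
lemma sum_bil_sq_le {M : Matrix (Fin d) (Fin d) ℝ} (hM : M.IsSymm) {b : ℝ}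
    (hb : ∀ θ : EuclideanSpace ℝ (Fin d), ‖θ‖ = 1 → |quad M θ| ≤ b)
    (q : OrthonormalBasis (Fin d) ℝ (EuclideanSpace ℝ (Fin d))) {u : EuclideanSpace ℝ (Fin d)}
    (hu : ‖u‖ = 1) : ∑ j, bil M (q j) u ^ 2 ≤ b ^ 2 := by
  have hb' : ∀ θ : EuclideanSpace ℝ (Fin d), |quad M θ| ≤ b * ‖θ‖ ^ 2 := by
    intro θ
    rcases eq_or_ne θ 0 with h | h
    · subst h
      simp [quad]
    · have hn : ‖θ‖ ≠ 0 := norm_ne_zero_iff.2 h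
      have h1 := hb (‖θ‖⁻¹ • θ) (by rw [norm_smul, norm_inv, norm_norm, inv_mul_cancel₀ hn])
      rw [quad_smul M hM, abs_mul, abs_of_nonneg (sq_nonneg _), inv_pow,
        inv_mul_le_iff₀ (by positivity)] at h1
      linarith
  have hb0 : 0 ≤ b := (abs_nonneg _).trans (hb u hu)
  set w := app M u with hw
  have hsum : ∑ j, bil M (q j) u ^ 2 = ‖w‖ ^ 2 := by
    rw [← q.sum_sq_inner_right]
    simp only [bil_eq_inner_app, hw]
  rw [hsum]
  rcases eq_or_ne w 0 with h0 | h0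
  · rw [h0, norm_zero]
    nlinarith [sq_nonneg b]
  have hwn : 0 < ‖w‖ := norm_pos_iff.2 h0
  set v := ‖w‖⁻¹ • w with hv
  have hvn : ‖v‖ = 1 := by rw [hv, norm_smul, norm_inv, norm_norm, inv_mul_cancel₀ hwn.ne']
  have hbv : bil M v u = ‖w‖ := by
    rw [hv, bil_smul_left, bil_eq_inner_app, ← hw, real_inner_self_eq_norm_sq]
    field_simp
  -- polarization
  have hpol : 4 * bil M v u = quad M (v + u) - quad M (v - u) := by
    simp only [quad_eq_bil]
    rw [bil_add_left, bil_sub_left, bil_comm hM v (v + u), bil_comm hM u (v + u),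
      bil_comm hM v (v - u), bil_comm hM u (v - u), bil_add_left, bil_add_left, bil_sub_left,
      bil_sub_left, bil_comm hM u v]
    ring
  have h1 := (abs_le.1 (hb' (v + u))).2
  have h2 := (abs_le.1 (hb' (v - u))).1
  have h3 : ‖v + u‖ ^ 2 + ‖v - u‖ ^ 2 = 4 := by
    rw [norm_add_sq_real, norm_sub_sq_real, hvn, hu]
    ring
  have h4 : ‖w‖ ≤ b := by
    rw [← hbv]
    nlinarith
  exact pow_le_pow_left₀ hwn.le h4 2

lemma isSymm_ofEigen (l : Fin d → ℝ)
    (q : OrthonormalBasis (Fin d) ℝ (EuclideanSpace ℝ (Fin d))) : (ofEigen l q).IsSymm := by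
  ext i j
  simp only [Matrix.transpose_apply, ofEigen, Matrix.sum_apply, Matrix.smul_apply,
    Matrix.vecMulVec_apply, smul_eq_mul]
  exact Finset.sum_congr rfl fun k _ => by ring

lemma cfc_eq_ofEigen {Q : Matrix (Fin d) (Fin d) ℝ} (hQ : Q.IsHermitian) (f : ℝ → ℝ) :
    cfc f Q = ofEigen (fun i => f (hQ.eigenvalues i)) hQ.eigenvectorBasis := by
  rw [hQ.cfc_eq, Matrix.IsHermitian.cfc]
  ext i j
  rw [Unitary.conjStarAlgAut_apply]
  rw [Matrix.mul_apply]
  simp only [ofEigen, Matrix.sum_apply, Matrix.smul_apply, Matrix.vecMulVec_apply, smul_eq_mul,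
    Matrix.mul_diagonal, Matrix.star_apply, Function.comp,
    Matrix.IsHermitian.eigenvectorUnitary_apply]
  refine Finset.sum_congr rfl fun k _ => ?_
  simp
  ring

lemma eq_ofEigen_eigenvalues {Q : Matrix (Fin d) (Fin d) ℝ} (hQ : Q.IsHermitian) :
    Q = ofEigen hQ.eigenvalues hQ.eigenvectorBasis := by
  have h := cfc_eq_ofEigen hQ id
  rw [cfc_id ℝ Q hQ.isSelfAdjoint] at h
  exact h

/-- The quadratic form of the positive part exceeds that of `Q` by at most the absolute value of
the smallest eigenvalue. -/
lemma quad_posPart_bounds {Q : Matrix (Fin d) (Fin d) ℝ} (hQ : Q.IsSymm) {m : ℝ} (hm : 0 ≤ m)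
    (h : ∀ θ : EuclideanSpace ℝ (Fin d), ‖θ‖ = 1 → -m ≤ quad Q θ)
    {θ : EuclideanSpace ℝ (Fin d)} (hθ : ‖θ‖ = 1) :
    quad Q θ ≤ quad (posPart Q) θ ∧ quad (posPart Q) θ ≤ quad Q θ + m := by
  have hH : Q.IsHermitian := by
    rw [Matrix.IsHermitian, Matrix.conjTranspose_eq_transpose_of_trivial]
    exact hQ
  have e1 : quad Q θ = ∑ i, hH.eigenvalues i * (inner ℝ (hH.eigenvectorBasis i) θ) ^ 2 := by
    conv_lhs => rw [eq_ofEigen_eigenvalues hH]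
    rw [quad_ofEigen]
  have e2 : quad (posPart Q) θ =
      ∑ i, max (hH.eigenvalues i) 0 * (inner ℝ (hH.eigenvectorBasis i) θ) ^ 2 := by
    rw [posPart, cfc_eq_ofEigen hH, quad_ofEigen]
  have heig : ∀ i, -m ≤ hH.eigenvalues i := by
    intro i
    have h1 := h (hH.eigenvectorBasis i) (hH.eigenvectorBasis.orthonormal.1 i)
    have h2 := quad_ofEigen_self hH.eigenvalues hH.eigenvectorBasis i
    rw [← eq_ofEigen_eigenvalues hH] at h2
    linarith
  have hnorm : ∑ i, (inner ℝ (hH.eigenvectorBasis i) θ) ^ 2 = 1 := by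
    rw [hH.eigenvectorBasis.sum_sq_inner_right, hθ, one_pow]
  rw [e1, e2]
  constructor
  · exact Finset.sum_le_sum fun i _ => mul_le_mul_of_nonneg_right (le_max_left _ _) (sq_nonneg _)
  · rw [← mul_one m, ← hnorm, Finset.mul_sum, ← Finset.sum_add_distrib]
    refine Finset.sum_le_sum fun i _ => ?_
    rw [← add_mul]
    refine mul_le_mul_of_nonneg_right (max_le (by linarith) ?_) (sq_nonneg _)
    linarith [heig i]

lemma quad_posPart_nonneg {Q : Matrix (Fin d) (Fin d) ℝ} (hQ : Q.IsSymm)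
    (θ : EuclideanSpace ℝ (Fin d)) : 0 ≤ quad (posPart Q) θ := by
  have hH : Q.IsHermitian := by
    rw [Matrix.IsHermitian, Matrix.conjTranspose_eq_transpose_of_trivial]
    exact hQ
  rw [posPart, cfc_eq_ofEigen hH, quad_ofEigen]
  exact Finset.sum_nonneg fun i _ => mul_nonneg (le_max_right _ _) (sq_nonneg _)

/-- A dimension count: the span of the first `i + 1` vectors of one basis meets the span of the
last `d - i` vectors of another one. -/
lemma exists_unit_vector_of_bases
    (p q : OrthonormalBasis (Fin d) ℝ (EuclideanSpace ℝ (Fin d))) (i : Fin d) :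
    ∃ θ : EuclideanSpace ℝ (Fin d), ‖θ‖ = 1 ∧ (∀ k, k < i → inner ℝ (p k) θ = 0) ∧
      ∀ k, i < k → inner ℝ (q k) θ = 0 := by
  let T : EuclideanSpace ℝ (Fin d) →ₗ[ℝ] ({k : Fin d // k ≠ i} → ℝ) :=
    { toFun := fun θ k => if k.1 < i then inner ℝ (p k) θ else inner ℝ (q k) θ
      map_add' := by
        intro u v
        funext k
        simp only [Pi.add_apply]
        split_ifs <;> rw [inner_add_right]
      map_smul' := by
        intro c u
        funext k
        simp only [Pi.smul_apply, RingHom.id_apply, smul_eq_mul]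
        split_ifs <;> rw [inner_smul_right] }
  have hfin : Module.finrank ℝ ({k : Fin d // k ≠ i} → ℝ) <
      Module.finrank ℝ (EuclideanSpace ℝ (Fin d)) := by
    rw [Module.finrank_fintype_fun_eq_card, finrank_euclideanSpace_fin]
    calc Fintype.card {k : Fin d // k ≠ i} < Fintype.card (Fin d) :=
          Fintype.card_subtype_lt (x := i) (by simp)
      _ = d := Fintype.card_fin d
  obtain ⟨v, hv, hv0⟩ := (Submodule.ne_bot_iff _).1 (T.ker_ne_bot_of_finrank_lt hfin)
  have hT : ∀ k : Fin d, (hk : k ≠ i) →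
      (if k < i then inner ℝ (p k) v else inner ℝ (q k) v) = 0 := fun k hk =>
    congrFun (LinearMap.mem_ker.1 hv) ⟨k, hk⟩
  have hn : ‖v‖ ≠ 0 := norm_ne_zero_iff.2 hv0
  refine ⟨‖v‖⁻¹ • v, by rw [norm_smul, norm_inv, norm_norm, inv_mul_cancel₀ hn], ?_, ?_⟩
  · intro k hk
    have := hT k hk.ne
    rw [if_pos hk] at this
    rw [inner_smul_right, this, mul_zero]
  · intro k hk
    have := hT k hk.ne'
    rw [if_neg (not_lt.2 hk.le)] at this
    rw [inner_smul_right, this, mul_zero]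

/-- The min-max principle, in the form of a common test vector for two symmetric matrices. -/
lemma exists_test_vector {lam lamHat : Fin d → ℝ}
    {p q : OrthonormalBasis (Fin d) ℝ (EuclideanSpace ℝ (Fin d))} (hlam : Antitone lam)
    (hlamHat : Antitone lamHat) (i : Fin d) :
    ∃ θ : EuclideanSpace ℝ (Fin d), ‖θ‖ = 1 ∧ quad (ofEigen lam p) θ ≤ lam i ∧
      lamHat i ≤ quad (ofEigen lamHat q) θ := by
  obtain ⟨θ, hθ, h1, h2⟩ := exists_unit_vector_of_bases p q i
  have hp : ∑ k, (inner ℝ (p k) θ) ^ 2 = 1 := by rw [p.sum_sq_inner_right, hθ, one_pow]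
  have hq : ∑ k, (inner ℝ (q k) θ) ^ 2 = 1 := by rw [q.sum_sq_inner_right, hθ, one_pow]
  refine ⟨θ, hθ, ?_, ?_⟩
  · rw [quad_ofEigen, ← mul_one (lam i), ← hp, Finset.mul_sum]
    refine Finset.sum_le_sum fun k _ => ?_
    rcases lt_or_ge k i with hk | hk
    · simp [h1 k hk]
    · exact mul_le_mul_of_nonneg_right (hlam hk) (sq_nonneg _)
  · rw [quad_ofEigen, ← mul_one (lamHat i), ← hq, Finset.mul_sum]
    refine Finset.sum_le_sum fun k _ => ?_
    rcases lt_or_ge i k with hk | hk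
    · simp [h2 k hk]
    · exact mul_le_mul_of_nonneg_right (hlamHat hk) (sq_nonneg _)

end LinearAlgebra

section Program

variable {d n : ℕ} {κ S ε a σ : ℝ} {Θ : Finset (EuclideanSpace ℝ (Fin d))}
  {x : Fin n → EuclideanSpace ℝ (Fin d)}

lemma continuous_quad (θ : EuclideanSpace ℝ (Fin d)) :
    Continuous fun M : Matrix (Fin d) (Fin d) ℝ => quad M θ := by
  unfold quad
  refine continuous_finsetSum _ fun i _ => continuous_finsetSum _ fun j _ => ?_
  exact (continuous_const.mul (continuous_id.matrix_elem i j)).mul continuous_const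

lemma continuous_frob : Continuous fun M : Matrix (Fin d) (Fin d) ℝ => frob M := by
  unfold frob
  exact (continuous_id.matrix_transpose.matrix_mul continuous_id).matrix_trace.sqrt

lemma isClosed_feasible : IsClosed {Q | Feasible κ S ε a σ Θ x Q} := by
  have hint : ∀ ξ, IsClosed {N | InInterval κ S ε a σ x ξ N} := by
    intro ξ
    simp only [InInterval, Set.ofPred_and, Set.ofPred_forall]
    refine isClosed_Ici.inter (isClosed_iInter fun j => isClosed_iInter fun _ => ?_)
    refine isClosed_iInter fun _ => ?_
    exact isClosed_le (by fun_prop) continuous_const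
  have : {Q | Feasible κ S ε a σ Θ x Q} = {Q | Q.IsSymm} ∩
      ⋂ ξ ∈ Θ, {Q | InInterval κ S ε a σ x ξ (quad Q ξ)} := by
    ext Q
    simp [Feasible]
  rw [this]
  refine IsClosed.inter ?_ (isClosed_biInter fun ξ _ => (hint ξ).preimage (continuous_quad ξ))
  exact isClosed_eq continuous_id.matrix_transpose continuous_id

/-- The convex program has a solution as soon as its constraints are compatible: the Frobenius norm
is continuous with compact sublevel sets. -/
lemma exists_isSolution {G : Matrix (Fin d) (Fin d) ℝ} (hG : Feasible κ S ε a σ Θ x G) :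
    ∃ Q, IsSolution κ S ε a σ Θ x Q := by
  set F := {Q | Feasible κ S ε a σ Θ x Q ∧ frob Q ≤ frob G} with hF
  have hclosed : IsClosed F := isClosed_feasible.inter (isClosed_le continuous_frob continuous_const)
  have hsub : F ⊆ Set.univ.pi fun _ : Fin d => Set.univ.pi fun _ : Fin d =>
      Set.Icc (-frob G) (frob G) := by
    intro Q hQ i _ j _
    rw [Set.mem_Icc, ← abs_le]
    refine le_trans ?_ hQ.2
    rw [← sq_le_sq₀ (abs_nonneg _) (frob_nonneg Q), sq_abs, frob_sq]
    refine le_trans ?_ (Finset.single_le_sum (f := fun i => ∑ j, Q i j ^ 2)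
      (fun i _ => Finset.sum_nonneg fun j _ => sq_nonneg _) (Finset.mem_univ i))
    exact Finset.single_le_sum (f := fun j => Q i j ^ 2) (fun j _ => sq_nonneg _)
      (Finset.mem_univ j)
  have hcomp : IsCompact F :=
    (isCompact_univ_pi fun _ => isCompact_univ_pi fun _ => isCompact_Icc).of_isClosed_subset
      hclosed hsub
  obtain ⟨Q, hQ, hmin⟩ := hcomp.exists_isMinOn ⟨G, hG, le_rfl⟩ continuous_frob.continuousOn
  refine ⟨Q, hQ.1, fun Q' hQ' => ?_⟩
  rcases le_or_gt (frob Q') (frob G) with h | h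
  · exact hmin ⟨hQ', h⟩
  · exact hQ.2.trans h.le

lemma isSolution_qMat {G : Matrix (Fin d) (Fin d) ℝ} (hG : Feasible κ S ε a σ Θ x G) :
    IsSolution κ S ε a σ Θ x (qMat κ S ε a σ Θ x) := by
  have h := exists_isSolution hG
  rw [qMat, dif_pos h]
  exact h.choose_spec

end Program

/-! ### From quadratic forms to eigenvalues and the Frobenius norm -/

section QuadraticForms

variable {d n : ℕ} {P : Measure (EuclideanSpace ℝ (Fin d))}
  {κ S ε a σ δ : ℝ} {Θ : Finset (EuclideanSpace ℝ (Fin d))} {x : Fin n → EuclideanSpace ℝ (Fin d)}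

lemma isSymm_gram (P : Measure (EuclideanSpace ℝ (Fin d))) : (gram P).IsSymm := by
  ext i j
  simp only [gram, Matrix.transpose_apply, Matrix.of_apply, mul_comm]

lemma abs_sub_secMom_le_of_inInterval (h : Admissible n κ S ε a σ)
    (hE : ∀ j < gridSize n κ a, InfluenceBounds P κ S ε a (gridL n κ S ε a (gridT S a j))
        (gridBeta n κ S (gridT S a j)) x)
    {ξ : EuclideanSpace ℝ (Fin d)} (hξ : ‖ξ‖ = 1) (hτS : secMom P ξ ≤ S) {N : ℝ}
    (hN : InInterval κ S ε a σ x ξ N) :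
    |N - secMom P ξ| ≤
      2 * (max (secMom P ξ) σ * rate n κ S ε a σ (min (secMom P ξ) S)) + σ := by
  have h1 := abs_max_sub_le_of_inInterval h.n_pos h.a_pos h.kappa_gt h.S_pos h.eps_pos h.eps_lt
    h.sig_pos hE hξ (max_le hτS h.sig_le) (h.zeta_cond _) hN
  rw [min_eq_left hτS, rate, ← mul_assoc]
  have h0 : 0 ≤ secMom P ξ := secMom_nonneg ξ
  have h2 : max (secMom P ξ) σ ≤ secMom P ξ + σ :=
    max_le (by linarith [h.sig_pos]) (by linarith)
  have h3 : max N σ ≤ N + σ := max_le (by linarith [h.sig_pos]) (by linarith [hN.1])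
  have h4 := le_max_left N σ
  have h5 := le_max_left (secMom P ξ) σ
  rw [abs_le] at h1 ⊢
  constructor <;> linarith [h1.1, h1.2]

lemma isSymm_qMat : (qMat κ S ε a σ Θ x).IsSymm := by
  rw [qMat]
  split_ifs with h
  · exact h.choose_spec.1.1
  · exact Matrix.isSymm_zero

variable [IsProbabilityMeasure P]

/-- On the event where the confidence intervals are valid, the quadratic form of the estimator is
close to that of the Gram matrix in all directions. The term `7 δ ‖G‖_F` collects the cost of moving
to the net for both matrices, its effect on the argument of `B_*`, and the cost of taking the
positive part. -/
lemma abs_quad_gHat_sub_le (h : Admissible n κ S ε a σ) (hP : Integrable (fun x => ‖x‖ ^ 4) P)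
    (hS : ∀ θ : EuclideanSpace ℝ (Fin d), ‖θ‖ = 1 → secMom P θ ≤ S)
    (hE : ∀ j < gridSize n κ a, InfluenceBounds P κ S ε a (gridL n κ S ε a (gridT S a j))
        (gridBeta n κ S (gridT S a j)) x)
    (hΘ : IsNet δ Θ) {θ : EuclideanSpace ℝ (Fin d)} (hθ : ‖θ‖ = 1) :
    |quad (gHat κ S ε a σ Θ x) θ - quad (gram P) θ| ≤
      realBound n κ S ε a σ δ (frob (gram P)) (quad (gram P) θ) := by
  have hfeas : Feasible κ S ε a σ Θ x (gram P) := by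
    refine ⟨isSymm_gram P, fun ξ hξ => ?_⟩
    rw [quad_gram hP]
    exact inInterval_secMom h.n_pos h.kappa_gt h.S_pos h.eps_pos h.eps_lt h.sig_pos hE (hΘ.1 ξ hξ)
  obtain ⟨⟨hQs, hQi⟩, hQmin⟩ := isSolution_qMat hfeas
  have hQG := hQmin _ hfeas
  rw [gHat]
  generalize qMat κ S ε a σ Θ x = Q at *
  set g := frob (gram P) with hg
  have hδ : 0 ≤ δ := by
    obtain ⟨ξ, -, hξ⟩ := hΘ.2 θ hθ
    exact (norm_nonneg _).trans hξ
  have hδg : 2 * δ * frob Q ≤ 2 * δ * g := by gcongr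
  have hm : 0 ≤ 2 * δ * g := mul_nonneg (by linarith) (frob_nonneg _)
  have hlow : ∀ u : EuclideanSpace ℝ (Fin d), ‖u‖ = 1 → -(2 * δ * g) ≤ quad Q u := by
    intro u hu
    obtain ⟨ξ, hξΘ, hξ⟩ := hΘ.2 u hu
    have h1 := (abs_le.1 (abs_quad_sub_quad_le hQs hu (hΘ.1 ξ hξΘ) hξ)).1
    have h2 := (hQi ξ hξΘ).1
    linarith
  obtain ⟨hp1, hp2⟩ := quad_posPart_bounds hQs hm hlow hθ
  obtain ⟨ξ, hξΘ, hξ⟩ := hΘ.2 θ hθ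
  have hξ1 := hΘ.1 ξ hξΘ
  have e1 := abs_le.1 (abs_quad_sub_quad_le hQs hθ hξ1 hξ)
  have e2 := abs_le.1 (abs_quad_sub_quad_le (isSymm_gram P) hθ hξ1 hξ)
  have e3 := abs_le.1 (abs_sub_secMom_le_of_inInterval h hE hξ1 (hS ξ hξ1) (hQi ξ hξΘ))
  rw [← quad_gram hP] at e3
  have e4 := (h.max_mul_rate_min_mono (by linarith [e2.1] :
    quad (gram P) ξ ≤ quad (gram P) θ + 2 * δ * g)).trans (h.max_mul_rate_min_add hm)
  unfold realBound
  rw [abs_le]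
  constructor <;> linarith [e1.1, e1.2, e2.1, e2.2, e3.1, e3.2]

end QuadraticForms

section Shrinkage

variable {d : ℕ} {lam lamHat : Fin d → ℝ}
  {p q : OrthonormalBasis (Fin d) ℝ (EuclideanSpace ℝ (Fin d))}

lemma bil_ofEigen_left (l : Fin d → ℝ) (i : Fin d) (v : EuclideanSpace ℝ (Fin d)) :
    bil (ofEigen l p) (p i) v = l i * inner ℝ (p i) v := by
  rw [bil_ofEigen]
  simp [OrthonormalBasis.inner_eq_ite]

lemma bil_ofEigen_right (l : Fin d → ℝ) (j : Fin d) (u : EuclideanSpace ℝ (Fin d)) :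
    bil (ofEigen l q) u (q j) = l j * inner ℝ u (q j) := by
  rw [bil_comm (isSymm_ofEigen l q), bil_ofEigen_left, real_inner_comm]

/-- If two positive semidefinite matrices are `b`-close as quadratic forms, the eigenvalues of the
second one being at most those of the first one, then they are close in Frobenius norm: in the basis
`p i ⊗ q j`, the first `r` rows and the first `r` columns contribute at most `r b²` each, and the
remaining block is controlled by the eigenvalues. -/
lemma frob_sub_ofEigen_sq_le {l l' : Fin d → ℝ} (hl' : ∀ i, 0 ≤ l' i) (hll : ∀ i, l' i ≤ l i)
    {b : ℝ} (hb : ∀ θ : EuclideanSpace ℝ (Fin d), ‖θ‖ = 1 →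
      |quad (ofEigen l p - ofEigen l' q) θ| ≤ b) (r : ℕ) :
    frob (ofEigen l p - ofEigen l' q) ^ 2 ≤
      2 * r * b ^ 2 + 2 * ∑ i : Fin d with r ≤ i.val, l i ^ 2 := by
  set D := ofEigen l p - ofEigen l' q with hD
  have hDs : D.IsSymm := (isSymm_ofEigen l p).sub (isSymm_ofEigen l' q)
  have hentry : ∀ i j, bil D (p i) (q j) = (l i - l' j) * inner ℝ (p i) (q j) := by
    intro i j
    rw [hD, bil_sub, bil_ofEigen_left, bil_ofEigen_right]
    ring
  have hrow : ∀ i, ∑ j, bil D (p i) (q j) ^ 2 ≤ b ^ 2 := by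
    intro i
    simp only [bil_comm hDs (p i)]
    exact sum_bil_sq_le hDs hb q (p.orthonormal.1 i)
  have hcol : ∀ j, ∑ i, bil D (p i) (q j) ^ 2 ≤ b ^ 2 := fun j =>
    sum_bil_sq_le hDs hb p (q.orthonormal.1 j)
  have hpt : ∀ i j, bil D (p i) (q j) ^ 2 ≤
      ((if i.val < r then bil D (p i) (q j) ^ 2 else 0) +
        (if r ≤ i.val then l i ^ 2 * (inner ℝ (p i) (q j)) ^ 2 else 0)) +
      ((if j.val < r then bil D (p i) (q j) ^ 2 else 0) +
        (if r ≤ j.val then l' j ^ 2 * (inner ℝ (p i) (q j)) ^ 2 else 0)) := by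
    intro i j
    have h0 := sq_nonneg (bil D (p i) (q j))
    have h1 : 0 ≤ l i ^ 2 * (inner ℝ (p i) (q j)) ^ 2 := by positivity
    have h2 : 0 ≤ l' j ^ 2 * (inner ℝ (p i) (q j)) ^ 2 := by positivity
    rcases lt_or_ge i.val r with hi | hi
    · rw [if_pos hi, if_neg (not_le.2 hi)]
      split_ifs <;> linarith
    · rcases lt_or_ge j.val r with hj | hj
      · rw [if_pos hj, if_neg (not_le.2 hj)]
        split_ifs <;> linarith
      · rw [if_neg (not_lt.2 hi), if_pos hi, if_neg (not_lt.2 hj), if_pos hj, hentry, mul_pow,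
          zero_add, zero_add, ← add_mul]
        refine mul_le_mul_of_nonneg_right ?_ (sq_nonneg _)
        nlinarith [mul_nonneg ((hl' i).trans (hll i)) (hl' j)]
  have hcount : ∑ i : Fin d, (if i.val < r then b ^ 2 else 0) ≤ r * b ^ 2 := by
    rw [← Finset.sum_filter, Finset.sum_const, nsmul_eq_mul]
    refine mul_le_mul_of_nonneg_right ?_ (sq_nonneg b)
    have : (Finset.univ.filter fun i : Fin d => i.val < r).card ≤ (Finset.range r).card :=
      Finset.card_le_card_of_injOn Fin.val (fun i hi => by simpa using hi)
        Fin.val_injective.injOn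
    rw [Finset.card_range] at this
    exact_mod_cast this
  have hrows : ∑ i : Fin d, ((if i.val < r then ∑ j, bil D (p i) (q j) ^ 2 else 0) +
      (if r ≤ i.val then l i ^ 2 else 0)) ≤
        r * b ^ 2 + ∑ i : Fin d with r ≤ i.val, l i ^ 2 := by
    rw [Finset.sum_add_distrib, Finset.sum_filter]
    refine add_le_add (le_trans (Finset.sum_le_sum fun i _ => ?_) hcount) le_rfl
    split_ifs
    · exact hrow i
    · exact le_rfl
  have hcols : ∑ j : Fin d, ((if j.val < r then ∑ i, bil D (p i) (q j) ^ 2 else 0) +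
      (if r ≤ j.val then l' j ^ 2 else 0)) ≤
        r * b ^ 2 + ∑ i : Fin d with r ≤ i.val, l i ^ 2 := by
    rw [Finset.sum_add_distrib, Finset.sum_filter]
    refine add_le_add (le_trans (Finset.sum_le_sum fun j _ => ?_) hcount)
      (Finset.sum_le_sum fun j _ => ?_)
    · split_ifs
      · exact hcol j
      · exact le_rfl
    · split_ifs
      · exact pow_le_pow_left₀ (hl' j) (hll j) 2
      · exact le_rfl
  have hp1 : ∀ i, ∑ j, (inner ℝ (p i) (q j)) ^ 2 = 1 := fun i => by
    rw [q.sum_sq_inner_left, p.orthonormal.1 i, one_pow]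
  have hq1 : ∀ j, ∑ i, (inner ℝ (p i) (q j)) ^ 2 = 1 := fun j => by
    rw [p.sum_sq_inner_right, q.orthonormal.1 j, one_pow]
  calc frob D ^ 2 = ∑ i, ∑ j, bil D (p i) (q j) ^ 2 := frob_sq_eq_sum_bil D p q
    _ ≤ _ := Finset.sum_le_sum fun i _ => Finset.sum_le_sum fun j _ => hpt i j
    _ = ∑ i : Fin d, ((if i.val < r then ∑ j, bil D (p i) (q j) ^ 2 else 0) +
          (if r ≤ i.val then l i ^ 2 else 0)) +
        ∑ j : Fin d, ((if j.val < r then ∑ i, bil D (p i) (q j) ^ 2 else 0) +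
          (if r ≤ j.val then l' j ^ 2 else 0)) := by
        simp only [Finset.sum_add_distrib]
        congr 1
        · congr 1
          · refine Finset.sum_congr rfl fun i _ => ?_
            split_ifs <;> simp
          · refine Finset.sum_congr rfl fun i _ => ?_
            split_ifs
            · rw [← Finset.mul_sum, hp1, mul_one]
            · simp
        · congr 1
          · rw [Finset.sum_comm]
            refine Finset.sum_congr rfl fun i _ => ?_
            split_ifs <;> simp
          · rw [Finset.sum_comm]
            refine Finset.sum_congr rfl fun i _ => ?_
            split_ifs
            · rw [← Finset.mul_sum, hq1, mul_one]
            · simp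
    _ ≤ _ := by linarith

lemma quad_ofEigen_le {m : ℝ} (hlam : ∀ i, lam i ≤ m) {θ : EuclideanSpace ℝ (Fin d)} (hθ : ‖θ‖ = 1) :
    quad (ofEigen lam p) θ ≤ m := by
  have h : ∑ i, (inner ℝ (p i) θ) ^ 2 = 1 := by rw [p.sum_sq_inner_right, hθ, one_pow]
  rw [quad_ofEigen, ← mul_one m, ← h, Finset.mul_sum]
  exact Finset.sum_le_sum fun i _ => mul_le_mul_of_nonneg_right (hlam i) (sq_nonneg _)

/-- Shrinking the eigenvalues of an estimator by its own error bound makes them smaller than the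
true ones, and raises the error on the quadratic form by a factor `5/2` at most. -/
lemma frob_sub_shrink_sq_le (hd : 0 < d) (hlam : Antitone lam) (hlamHat : Antitone lamHat)
    (hlam0 : ∀ i, 0 ≤ lam i) (hlamHat0 : ∀ i, 0 ≤ lamHat i) {b : ℝ → ℝ} (hb0 : ∀ t, 0 ≤ b t)
    (hbm : Monotone b) (hb : ∀ t t', t' ≤ t + b t → b t' ≤ 3 / 2 * b t)
    (hq : ∀ θ : EuclideanSpace ℝ (Fin d), ‖θ‖ = 1 →
      |quad (ofEigen lamHat q) θ - quad (ofEigen lam p) θ| ≤ b (quad (ofEigen lam p) θ)) (r : ℕ) :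
    frob (ofEigen lam p - ofEigen (fun i => max (lamHat i - b (lamHat i)) 0) q) ^ 2 ≤
      13 * r * b (lam ⟨0, hd⟩) ^ 2 + 2 * ∑ i : Fin d with r ≤ i.val, lam i ^ 2 := by
  set b₁ := b (lam ⟨0, hd⟩) with hb₁
  have htop : ∀ i, lam i ≤ lam ⟨0, hd⟩ := fun i => hlam (Fin.mk_le_of_le_val (Nat.zero_le _))
  have hle : ∀ i, max (lamHat i - b (lamHat i)) 0 ≤ lam i := by
    intro i
    refine max_le ?_ (hlam0 i)
    obtain ⟨θ, hθ, h1, h2⟩ := exists_test_vector (p := p) (q := q) hlam hlamHat i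
    have h3 := (abs_le.1 (hq θ hθ)).2
    rcases le_or_gt (quad (ofEigen lam p) θ) (lamHat i) with h | h
    · linarith [hbm h]
    · linarith [hb0 (lamHat i)]
  have hquad : ∀ θ : EuclideanSpace ℝ (Fin d), ‖θ‖ = 1 →
      quad (ofEigen lam p) θ ≤ lam ⟨0, hd⟩ := fun θ hθ => quad_ofEigen_le htop hθ
  have hbHat : ∀ j, b (lamHat j) ≤ 3 / 2 * b₁ := by
    intro j
    have hj := q.orthonormal.1 j
    have h1 := (abs_le.1 (hq (q j) hj)).2
    rw [quad_ofEigen_self] at h1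
    exact hb _ _ (by linarith [hquad _ hj, hbm (hquad _ hj)])
  have hform : ∀ θ : EuclideanSpace ℝ (Fin d), ‖θ‖ = 1 →
      |quad (ofEigen lam p - ofEigen (fun i => max (lamHat i - b (lamHat i)) 0) q) θ| ≤
        5 / 2 * b₁ := by
    intro θ hθ
    have h1 := abs_le.1 ((hq θ hθ).trans (hbm (hquad θ hθ)))
    have hn : ∑ i, (inner ℝ (q i) θ) ^ 2 = 1 := by rw [q.sum_sq_inner_right, hθ, one_pow]
    have h2 : quad (ofEigen (fun i => max (lamHat i - b (lamHat i)) 0) q) θ ≤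
        quad (ofEigen lamHat q) θ := by
      rw [quad_ofEigen, quad_ofEigen]
      refine Finset.sum_le_sum fun i _ => mul_le_mul_of_nonneg_right ?_ (sq_nonneg _)
      exact max_le (by linarith [hb0 (lamHat i)]) (hlamHat0 i)
    have h3 : quad (ofEigen lamHat q) θ ≤
        quad (ofEigen (fun i => max (lamHat i - b (lamHat i)) 0) q) θ + 3 / 2 * b₁ := by
      rw [quad_ofEigen, quad_ofEigen, ← mul_one (3 / 2 * b₁), ← hn, Finset.mul_sum,
        ← Finset.sum_add_distrib]
      refine Finset.sum_le_sum fun i _ => ?_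
      rw [← add_mul]
      refine mul_le_mul_of_nonneg_right ?_ (sq_nonneg _)
      linarith [le_max_left (lamHat i - b (lamHat i)) 0, hbHat i]
    rw [quad_sub, abs_le]
    constructor <;> linarith [h1.1, h1.2]
  refine (frob_sub_ofEigen_sq_le (fun i => le_max_right _ _) hle hform r).trans ?_
  -- the constant obtained is `2 (5/2)² = 25/2`
  have : 0 ≤ (r : ℝ) * b₁ ^ 2 := by positivity
  nlinarith

lemma shrink_ofReal {l b : ℝ} (hb : 0 ≤ b) : shrink l (ENNReal.ofReal b) = max (l - b) 0 := by
  rw [shrink, ← ENNReal.ofReal_sub l hb, ENNReal.toReal_ofReal']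

lemma ofReal_le_iInf_rpow {f b : ℝ} (hb : 0 ≤ b)
    (h : ∀ r : ℕ, f ^ 2 ≤ 13 * r * b ^ 2 + 2 * ∑ i : Fin d with r ≤ i.val, lam i ^ 2) :
    ENNReal.ofReal f ≤ ⨅ r ∈ Finset.Icc 1 d,
      (13 * (r : ℝ≥0∞) * ENNReal.ofReal b ^ 2
        + 2 * ENNReal.ofReal (∑ i : Fin d with r ≤ i.val, lam i ^ 2)) ^ (1 / 2 : ℝ) := by
  refine le_iInf₂ fun r _ => ?_
  have hs : 0 ≤ ∑ i : Fin d with r ≤ i.val, lam i ^ 2 := Finset.sum_nonneg fun i _ => sq_nonneg _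
  have e : 13 * (r : ℝ≥0∞) * ENNReal.ofReal b ^ 2
      + 2 * ENNReal.ofReal (∑ i : Fin d with r ≤ i.val, lam i ^ 2) =
      ENNReal.ofReal (13 * r * b ^ 2 + 2 * ∑ i : Fin d with r ≤ i.val, lam i ^ 2) := by
    rw [ENNReal.ofReal_add (by positivity) (by positivity), ENNReal.ofReal_mul (by positivity),
      ENNReal.ofReal_mul (by positivity), ENNReal.ofReal_mul (by positivity), ENNReal.ofReal_pow hb]
    simp
  rw [e, ENNReal.ofReal_rpow_of_nonneg (by positivity) (by norm_num), ← Real.sqrt_eq_rpow]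
  exact ENNReal.ofReal_le_ofReal (Real.le_sqrt_of_sq_le (h r))

end Shrinkage

end

end RobustPCA

open RobustPCA in
theorem proposition5p3 {Ω : Type*} [MeasurableSpace Ω] (μ : Measure Ω) [IsProbabilityMeasure μ]
    {d : ℕ} (hd : 0 < d)
    (P : Measure (EuclideanSpace ℝ (Fin d))) [IsProbabilityMeasure P]
    (hP : Integrable (fun x => ‖x‖ ^ 4) P)
    (n : ℕ) (X : Fin n → Ω → EuclideanSpace ℝ (Fin d))
    (hlaw : ∀ i, HasLaw (X i) P μ) (hindep : iIndepFun X μ)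
    (a ε σ δ : ℝ) (ha : 0 < a) (hε : 0 < ε) (hσ : 0 < σ)
    (κ S : ℝ) (hκdef : κ = RobustPCA.kappa P) (hSdef : S = RobustPCA.s4sq P)
    (hσS : σ ≤ S) (hκ : 3 / 2 ≤ κ)
    (hζ : 8 * RobustPCA.zeta n κ S ε a σ ≤ √n)
    (Θ : Finset (EuclideanSpace ℝ (Fin d))) (hΘ : RobustPCA.IsNet δ Θ)
    (G : Matrix (Fin d) (Fin d) ℝ) (hGdef : G = RobustPCA.gram P)
    (lam : Fin d → ℝ) (p : OrthonormalBasis (Fin d) ℝ (EuclideanSpace ℝ (Fin d)))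
    (hG : RobustPCA.IsEigenDecomp G lam p)
    (B : ℝ → ℝ≥0∞) (hB : B = RobustPCA.bound n κ S ε a σ δ (RobustPCA.frob G)) :
    ∃ A : Set Ω, MeasurableSet A ∧ ENNReal.ofReal (1 - 2 * ε) ≤ μ A ∧
      ∀ ω ∈ A, ∀ (lamHat : Fin d → ℝ)
        (q : OrthonormalBasis (Fin d) ℝ (EuclideanSpace ℝ (Fin d))),
        RobustPCA.IsEigenDecomp (RobustPCA.gHat κ S ε a σ Θ (fun i => X i ω)) lamHat q →
        ENNReal.ofReal (RobustPCA.frob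
            (G - RobustPCA.ofEigen (fun i => RobustPCA.shrink (lamHat i) (B (lamHat i))) q)) ≤
          ⨅ r ∈ Finset.Icc 1 d,
            (13 * (r : ℝ≥0∞) * B (lam ⟨0, hd⟩) ^ 2
              + 2 * ENNReal.ofReal (∑ i : Fin d with r ≤ i.val, lam i ^ 2)) ^ (1 / 2 : ℝ) := by

  subst hκdef hSdef hGdef hB
  obtain ⟨hlam, hGe⟩ := hG
  have hκ1 : 1 < kappa P := by linarith
  have hS0 : 0 < s4sq P := hσ.trans_le hσS
  rcases le_or_gt (1 / 2) ε with hε1 | hε1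
  -- for `ε ≥ 1/2` there is nothing to prove
  · refine ⟨∅, MeasurableSet.empty, ?_, fun ω hω => absurd hω (Set.notMem_empty ω)⟩
    rw [ENNReal.ofReal_of_nonpos (by linarith)]
    exact zero_le
  have hε2 : ε < 1 := by linarith
  have hn : 0 < n := by
    rcases Nat.eq_zero_or_pos n with h0 | h0
    · have := zeta_pos (n := n) (a := a) hκ1 hS0 hε hε2 hσ
      rw [h0] at hζ this
      simp only [Nat.cast_zero, Real.sqrt_zero] at hζ
      linarith
    · exact h0
  have hadm : Admissible n (kappa P) (s4sq P) ε a σ := ⟨hn, ha, hε, hε2, hσ, hσS, hκ, hζ⟩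
  obtain ⟨A, hA, hAP, hAE⟩ := exists_event_influenceBounds (a := a) hn hP hκ1 hS0 (s4sq_sq P) hε hε2
    (integral_inner_pow_four_le hP hGe)
  obtain ⟨E, hEm, hEμ, hEA⟩ := exists_measurableSet_of_sample hlaw hindep hA
  refine ⟨E, hEm, hEμ ▸ hAP, fun ω hω lamHat q hHat => ?_⟩
  obtain ⟨hlamHat, hHat⟩ := hHat
  have hδ : 0 ≤ δ := by
    obtain ⟨ξ, -, hξ⟩ := hΘ.2 (p ⟨0, hd⟩) (p.orthonormal.1 _)
    exact (norm_nonneg _).trans hξ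
  have hg := frob_nonneg (gram P)
  have hquad : ∀ θ : EuclideanSpace ℝ (Fin d), ‖θ‖ = 1 → _ := fun θ hθ =>
    abs_quad_gHat_sub_le hadm hP (fun _ h => secMom_le hP hS0 (s4sq_sq P) h)
      (hAE _ (hEA ω hω)) hΘ hθ
  have hlam0 : ∀ i, 0 ≤ lam i := fun i => by
    rw [← quad_ofEigen_self lam p i, ← hGe, quad_gram hP]
    exact secMom_nonneg _
  have hlamHat0 : ∀ i, 0 ≤ lamHat i := fun i => by
    rw [← quad_ofEigen_self lamHat q i, ← hHat]
    exact quad_posPart_nonneg isSymm_qMat _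
  simp only [hadm.bound_eq hδ hg, shrink_ofReal (hadm.realBound_nonneg hδ hg _)]
  refine ofReal_le_iInf_rpow (hadm.realBound_nonneg hδ hg _) fun r => ?_
  rw [hHat] at hquad
  generalize frob (gram P) = g at *
  rw [hGe] at hquad ⊢
  exact frob_sub_shrink_sq_le hd hlam hlamHat hlam0 hlamHat0
    (fun t => hadm.realBound_nonneg hδ hg t) (fun t t' h => hadm.realBound_mono h)
    (fun t t' h => hadm.realBound_le_of_le_add hδ hg h) hquad r
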